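/- Let $(\Lambda,\mathcal E)$ be a finite graph (no self-loops, no multiple edges), $\beta>0$, $u\in[0,1]$, $S\in\mathbb N$, $\theta=2S+1$. **Random loops.** Let $\rho_u$ be the law of a Poisson point process on $\mathcal E\times[0,\beta]$ consisting of "crosses" with intensity $u$ and, independently, "double bars" with intensity $1-u$. A realization $\omega$ determines a set $\mathcal L(\omega)$ of loops in $\Lambda\times[0,\beta]_{\rm per}$: one moves vertically, with the time periodic, until a transition of $\omega$ at an edge containing the current site is met; at a cross one moves to the other endpoint of the edge and continues in the same vertical direction; at a double bar one moves to the other endpoint and continues in the opposite vertical direction. Let $\mathbb P$ be the probability measure $\frac1Y\theta^{|\mathcal L(\omega)|}\,{\rm d}\rho_u(\omega)$ with $Y=\int\theta^{|\mathcal L(\omega)|}\,{\rm d}\rho_u(\omega)$. For $x,y\in\Lambda$ and $t\in[0,\beta]$ let $E^+_{x,y,t}$ (resp. $E^-_{x,y,t}$) be the event that $(x,0)$ and $(y,t)$ belong to the same loop and that the loop has identical (resp. opposite) vertical directions at these two points, and let $E_{x,y,t}=E^+_{x,y,t}\cup E^-_{x,y,t}$. **Quantum spins.** Let $S^1,S^2,S^3$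 be the usual spin-$S$ matrices on $\mathbb C^{2S+1}$, with $|a\rangle$, $a\in\{-S,\dots,S\}$, the standard eigenvectors of $S^3$ (so that $S^1\pm{\rm i}S^2$ have nonnegative matrix elements), and let $S^i_x=S^i\otimes{\rm Id}_{\Lambda\setminus\{x\}}$ on $\mathcal H_\Lambda=\bigotimes_{x\in\Lambda}\mathbb C^{2S+1}$. Let $T_{xy}|a,b\rangle=|b,a\rangle$ and $\langle a,b|P_{xy}|c,d\rangle=(-1)^{a-c}\delta_{a,-b}\delta_{c,-d}$, and $$\tilde H=-\sum_{\{x,y\}\in\mathcal E}\bigl(uT_{xy}+(1-u)P_{xy}-1\bigr).$$ For operators $A,B$ on $\mathcal H_\Lambda$ and $\tilde Z={\rm Tr}\,e^{-\beta\tilde H}$ set $\langle A\rangle=\frac1{\tilde Z}{\rm Tr}\,A\,e^{-\beta\tilde H}$ and $\langle A;B\rangle(t)=\frac1{\tilde Z}{\rm Tr}\,A\,e^{-(\beta-t)\tilde H}\,B\,e^{-t\tilde H}$. **Theorem.** For all $x,y\in\Lambda$, $t\in[0,\beta]$ and $i\in\{1,2,3\}$, (a) $\langle S^i_x;S^i_y\rangle(t)=\frac13S(S+1)\bigl[\mathbb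 P(E^+_{x,y,t})-\mathbb P(E^-_{x,y,t})\bigr]$; (b) $\langle (S^i_x)^2;(S^i_y)^2\rangle(t)-\langle(S^i_x)^2\rangle\langle(S^i_y)^2\rangle=\frac1{45}S(S+1)(2S-1)(2S+3)\,\mathbb P(E_{x,y,t})$. -/

import Mathlib

open MeasureTheory
open scoped Nat

noncomputable section

namespace RandomLoops

/-! ## Random loops -/

/-- The two kinds of transitions of the Poisson point process. -/
inductive Kind : Type
  | cross
  | bar

/-- Vertical directions of motion along a loop. -/
inductive Dir : Type
  | up
  | down

instance : MeasurableSpace Kind := ⊤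

variable {V : Type*}

/-- A transition: an edge of the graph, its kind, and its time. -/
structure Transition (G : SimpleGraph V) where
  edge : G.edgeSet
  kind : Kind
  time : ℝ

/-- The discrete structure on edges and kinds, and the Borel structure on times. -/
instance (G : SimpleGraph V) : MeasurableSpace (Transition G) :=
  (⊤ : MeasurableSpace (G.edgeSet × Kind)).comap (fun m => (m.edge, m.kind)) ⊔
    (inferInstance : MeasurableSpace ℝ).comap (fun m => m.time)

/-- Realizations of a simple point process on `α` with finitely many points. -/
def Config (α : Type*) : Type _ := Finset α

open Classical in
/-- The set of points of a finite sequence of points. -/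
def Config.ofTuple {α : Type*} (l : Σ n : ℕ, (Fin n → α)) : Config α :=
  (Finset.univ.image l.2 : Finset α)

/-- A set of realizations is measurable when, for every `n`, the set of the `n`-tuples of points
that enumerate one of its elements is measurable. -/
instance {α : Type*} [MeasurableSpace α] : MeasurableSpace (Config α) :=
  MeasurableSpace.map Config.ofTuple inferInstance

instance {α : Type*} : Membership α (Config α) := ⟨fun ω a => a ∈ (show Finset α from ω)⟩

/-- The law of the Poisson point process with finite (diffuse) intensity measure `ν`: with
probability `exp (-ν(α)) ν(α)ⁿ / n!` there are `n` points, which are then independent with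
distribution `ν / ν(α)`. -/
def poissonLaw {α : Type*} [MeasurableSpace α] (ν : Measure α) : Measure (Config α) :=
  (Measure.sum fun n : ℕ =>
    (ENNReal.ofReal (Real.exp (-(ν Set.univ).toReal)) / (n ! : ENNReal)) •
      (Measure.pi fun _ : Fin n => ν).map
        (fun l => (⟨n, l⟩ : Σ n : ℕ, (Fin n → α)))).map Config.ofTuple

/-- Intensity measure on transitions: on every edge, Lebesgue measure on `[0, β]` times `u` for
the crosses, and times `1 - u` for the double bars. -/
def intensity (G : SimpleGraph V) [Fintype G.edgeSet] (β u : ℝ) : Measure (Transition G) :=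
  ∑ e : G.edgeSet,
    (ENNReal.ofReal u • (volume.restrict (Set.Icc 0 β)).map (fun s => ⟨e, Kind.cross, s⟩) +
      ENNReal.ofReal (1 - u) • (volume.restrict (Set.Icc 0 β)).map (fun s => ⟨e, Kind.bar, s⟩))

variable {G : SimpleGraph V}

/-- There is a transition of `ω` at time `s` on an edge that contains `x`. -/
def Touches (ω : Config (Transition G)) (x : V) (s : ℝ) : Prop :=
  ∃ m ∈ ω, x ∈ (m.edge : Sym2 V) ∧ m.time = s

/-- `ω` has a transition of kind `k` on the edge `{x, y}` at time `τ`. -/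
def HasTransition (ω : Config (Transition G)) (k : Kind) (x y : V) (τ : ℝ) : Prop :=
  ∃ m ∈ ω, (m.edge : Sym2 V) = s(x, y) ∧ m.kind = k ∧ m.time = τ

/-- Elementary moves of a directed point `(x, s, d)` along its loop in `V × [0, β]_per`:
vertical motion away from the transitions, periodicity in time, motion through a cross
(the site changes, the vertical direction is kept) and motion through a double bar
(the site changes, the vertical direction is reversed). -/
inductive Step (β : ℝ) (ω : Config (Transition G)) : V × ℝ × Dir → V × ℝ × Dir → Prop
  | vertical {x : V} {s s' : ℝ} (d : Dir) (h₀ : 0 ≤ s) (h : s ≤ s') (h₁ : s' ≤ β)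
      (hfree : ∀ r ∈ Set.Icc s s', ¬ Touches ω x r) : Step β ω (x, s, d) (x, s', d)
  | wrap {x : V} (d : Dir) (h₀ : ¬ Touches ω x 0) (h₁ : ¬ Touches ω x β) :
      Step β ω (x, β, d) (x, 0, d)
  | crossUp {x y : V} {s τ s' : ℝ} (hτ : HasTransition ω Kind.cross x y τ)
      (h₀ : 0 ≤ s) (h : s < τ) (h' : τ < s') (h₁ : s' ≤ β)
      (hx : ∀ r ∈ Set.Ico s τ, ¬ Touches ω x r) (hy : ∀ r ∈ Set.Ioc τ s', ¬ Touches ω y r) :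
      Step β ω (x, s, Dir.up) (y, s', Dir.up)
  | crossDown {x y : V} {s τ s' : ℝ} (hτ : HasTransition ω Kind.cross x y τ)
      (h₀ : 0 ≤ s') (h' : s' < τ) (h : τ < s) (h₁ : s ≤ β)
      (hx : ∀ r ∈ Set.Ioc τ s, ¬ Touches ω x r) (hy : ∀ r ∈ Set.Ico s' τ, ¬ Touches ω y r) :
      Step β ω (x, s, Dir.down) (y, s', Dir.down)
  | barFromBelow {x y : V} {s τ s' : ℝ} (hτ : HasTransition ω Kind.bar x y τ)
      (h₀ : 0 ≤ s) (h : s < τ) (h₀' : 0 ≤ s') (h' : s' < τ) (h₁ : τ ≤ β)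
      (hx : ∀ r ∈ Set.Ico s τ, ¬ Touches ω x r) (hy : ∀ r ∈ Set.Ico s' τ, ¬ Touches ω y r) :
      Step β ω (x, s, Dir.up) (y, s', Dir.down)
  | barFromAbove {x y : V} {s τ s' : ℝ} (hτ : HasTransition ω Kind.bar x y τ)
      (h₀ : 0 ≤ τ) (h : τ < s) (h₁ : s ≤ β) (h' : τ < s') (h₁' : s' ≤ β)
      (hx : ∀ r ∈ Set.Ioc τ s, ¬ Touches ω x r) (hy : ∀ r ∈ Set.Ioc τ s', ¬ Touches ω y r) :
      Step β ω (x, s, Dir.down) (y, s', Dir.up)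

/-- Two directed points lie on the same trajectory. As trajectories are closed, following them
forwards only, or both forwards and backwards, gives the same relation. -/
def SameTrajectory (β : ℝ) (ω : Config (Transition G)) : V × ℝ × Dir → V × ℝ × Dir → Prop :=
  Relation.EqvGen (Step β ω)

/-- The points of `V × [0, β]` that are not in the support of `ω`. -/
def FreePoint (β : ℝ) (ω : Config (Transition G)) : Type _ :=
  {p : V × ℝ // p.2 ∈ Set.Icc 0 β ∧ ¬ Touches ω p.1 p.2}

/-- The set of loops of `ω`: the points off the support of `ω`, two of them being identified when
they can be connected by moves along a loop (in whatever direction). -/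
def Loops (β : ℝ) (ω : Config (Transition G)) : Type _ :=
  Quot fun p q : FreePoint β ω =>
    ∃ d d' : Dir, Step β ω (p.1.1, p.1.2, d) (q.1.1, q.1.2, d')

/-- The number of loops. -/
def numLoops (β : ℝ) (ω : Config (Transition G)) : ℕ := Nat.card (Loops β ω)

/-- `(x, 0)` and `(y, t)` are on the same loop, with identical vertical directions. -/
def eventPlus (G : SimpleGraph V) (β : ℝ) (x y : V) (t : ℝ) : Set (Config (Transition G)) :=
  {ω | SameTrajectory β ω (x, 0, Dir.up) (y, t, Dir.up)}

/-- `(x, 0)` and `(y, t)` are on the same loop, with opposite vertical directions. -/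
def eventMinus (G : SimpleGraph V) (β : ℝ) (x y : V) (t : ℝ) : Set (Config (Transition G)) :=
  {ω | SameTrajectory β ω (x, 0, Dir.up) (y, t, Dir.down)}

/-- `(x, 0)` and `(y, t)` are on the same loop. -/
def eventConn (G : SimpleGraph V) (β : ℝ) (x y : V) (t : ℝ) : Set (Config (Transition G)) :=
  eventPlus G β x y t ∪ eventMinus G β x y t

/-- The law `ρ_u` of crosses and double bars. -/
def rho (G : SimpleGraph V) [Fintype G.edgeSet] (β u : ℝ) : Measure (Config (Transition G)) :=
  poissonLaw (intensity G β u)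

/-- The partition function `Y_θ^{(u)}(β, Λ)`. -/
def loopPartition (G : SimpleGraph V) [Fintype G.edgeSet] (β u θ : ℝ) : ENNReal :=
  ∫⁻ ω, ENNReal.ofReal θ ^ numLoops β ω ∂(rho G β u)

/-- The law of the model of random loops: density `θ ^ |L(ω)| / Y` with respect to `ρ_u`. -/
def loopMeasure (G : SimpleGraph V) [Fintype G.edgeSet] (β u θ : ℝ) :
    Measure (Config (Transition G)) :=
  (loopPartition G β u θ)⁻¹ •
    (rho G β u).withDensity fun ω => ENNReal.ofReal θ ^ numLoops β ω

/-! ## Quantum spins -/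

/-- The eigenvalue `a ∈ {-S, …, S}` of `S³` with label `k ∈ {0, …, 2S}`. -/
def mag (S : ℕ) (k : Fin (2 * S + 1)) : ℤ := (k : ℤ) - S

/-- The raising operator: `S⁺ |a⟩ = √(S(S+1) - a(a+1)) |a+1⟩`. -/
def raising (S : ℕ) : Matrix (Fin (2 * S + 1)) (Fin (2 * S + 1)) ℂ :=
  Matrix.of fun j k =>
    if mag S j = mag S k + 1 then
      ((Real.sqrt ((S : ℝ) * (S + 1) - (mag S k : ℝ) * (mag S k + 1)) : ℝ) : ℂ)
    else 0

/-- The spin operators `S¹, S², S³` on `ℂ^{2S+1}`, in the basis of eigenvectors of `S³`;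
the index `i : Fin 3` stands for the direction `i + 1`. -/
def spin (S : ℕ) : Fin 3 → Matrix (Fin (2 * S + 1)) (Fin (2 * S + 1)) ℂ :=
  ![(1 / 2 : ℂ) • (raising S + (raising S).conjTranspose),
    (1 / (2 * Complex.I) : ℂ) • (raising S - (raising S).conjTranspose),
    Matrix.diagonal fun k => (mag S k : ℂ)]

/-- Operators on `⊗_{x ∈ V} ℂ^{2S+1}`, as matrices in the product basis `|σ⟩`,
`σ : V → {-S, …, S}`. -/
abbrev Op (V : Type*) (S : ℕ) : Type _ :=
  Matrix (V → Fin (2 * S + 1)) (V → Fin (2 * S + 1)) ℂ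

variable [Fintype V] [DecidableEq V]

/-- `A ⊗ Id_{V ∖ {x}}`. -/
def siteOp {S : ℕ} (x : V) (A : Matrix (Fin (2 * S + 1)) (Fin (2 * S + 1)) ℂ) : Op V S :=
  Matrix.of fun σ τ => if ∀ z, z ≠ x → σ z = τ z then A (σ x) (τ x) else 0

/-- `B ⊗ Id_{V ∖ {x, y}}`, where `⟨a, b| B |c, d⟩ = B a b c d`. -/
def bondOp {S : ℕ} (x y : V)
    (B : Fin (2 * S + 1) → Fin (2 * S + 1) → Fin (2 * S + 1) → Fin (2 * S + 1) → ℂ) : Op V S :=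
  Matrix.of fun σ τ =>
    if ∀ z, z ≠ x → z ≠ y → σ z = τ z then B (σ x) (σ y) (τ x) (τ y) else 0

/-- Matrix elements `⟨a, b| T |c, d⟩` of the transposition operator. -/
def transpositionCoeff (S : ℕ) (a b c d : Fin (2 * S + 1)) : ℂ :=
  if a = d ∧ b = c then 1 else 0

/-- Matrix elements `⟨a, b| P |c, d⟩ = (-1)^{a-c} δ_{a,-b} δ_{c,-d}`. -/
def singletCoeff (S : ℕ) (a b c d : Fin (2 * S + 1)) : ℂ :=
  if mag S a = -mag S b ∧ mag S c = -mag S d then (-1 : ℂ) ^ (mag S a - mag S c) else 0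

theorem singletCoeff_swap (S : ℕ) (a b c d : Fin (2 * S + 1)) :
    singletCoeff S a b c d = singletCoeff S b a d c := by
  unfold singletCoeff
  by_cases h : mag S a = -mag S b ∧ mag S c = -mag S d
  · have h' : mag S b = -mag S a ∧ mag S d = -mag S c := by omega
    rw [if_pos h, if_pos h', h'.1, h'.2]
    have e : -mag S a - -mag S c = -(mag S a - mag S c) := by ring
    rw [e, zpow_neg, ← inv_zpow]
    norm_num
  · have h' : ¬ (mag S b = -mag S a ∧ mag S d = -mag S c) := by omega
    rw [if_neg h, if_neg h']

theorem transpositionCoeff_swap (S : ℕ) (a b c d : Fin (2 * S + 1)) :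
    transpositionCoeff S a b c d = transpositionCoeff S b a d c := by
  unfold transpositionCoeff
  simp only [and_comm]

theorem bondOp_comm {S : ℕ} (x y : V)
    (B : Fin (2 * S + 1) → Fin (2 * S + 1) → Fin (2 * S + 1) → Fin (2 * S + 1) → ℂ)
    (hB : ∀ a b c d, B a b c d = B b a d c) : bondOp x y B = bondOp y x B := by
  ext σ τ
  have h : (∀ z, z ≠ x → z ≠ y → σ z = τ z) ↔ (∀ z, z ≠ y → z ≠ x → σ z = τ z) :=
    ⟨fun H z a b => H z b a, fun H z a b => H z b a⟩
  simp only [bondOp, Matrix.of_apply, h]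
  rw [hB]

/-- The transposition operator `T_{xy}` of an edge `{x, y}`. -/
def edgeT (S : ℕ) (e : Sym2 V) : Op V S :=
  Sym2.lift ⟨fun x y => bondOp x y (transpositionCoeff S),
    fun x y => bondOp_comm x y _ (transpositionCoeff_swap S)⟩ e

/-- The operator `P_{xy}` of an edge `{x, y}`. -/
def edgeP (S : ℕ) (e : Sym2 V) : Op V S :=
  Sym2.lift ⟨fun x y => bondOp x y (singletCoeff S),
    fun x y => bondOp_comm x y _ (singletCoeff_swap S)⟩ e

/-- The Hamiltonian `H̃^{(u)} = -∑_{e} (u T_e + (1 - u) P_e - 1)`. -/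
def hamiltonian (G : SimpleGraph V) [Fintype G.edgeSet] (S : ℕ) (u : ℝ) : Op V S :=
  -∑ e ∈ G.edgeFinset, ((u : ℂ) • edgeT S e + ((1 - u : ℝ) : ℂ) • edgeP S e - 1)

/-- The Gibbs operator `exp (-s H̃^{(u)})`. -/
def gibbs (G : SimpleGraph V) [Fintype G.edgeSet] (S : ℕ) (u s : ℝ) : Op V S :=
  NormedSpace.exp (-(s : ℂ) • hamiltonian G S u)

/-- The partition function `Z̃^{(u)}(β, Λ)`. -/
def partition (G : SimpleGraph V) [Fintype G.edgeSet] (S : ℕ) (β u : ℝ) : ℂ :=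
  (gibbs G S u β).trace

/-- The expectation `⟨A⟩` in the Gibbs state. -/
def expectation (G : SimpleGraph V) [Fintype G.edgeSet] (S : ℕ) (β u : ℝ) (A : Op V S) : ℂ :=
  (A * gibbs G S u β).trace / partition G S β u

/-- The Schwinger function `⟨A; B⟩(t)`. -/
def schwinger (G : SimpleGraph V) [Fintype G.edgeSet] (S : ℕ) (β u : ℝ) (A B : Op V S)
    (t : ℝ) : ℂ :=
  (A * gibbs G S u (β - t) * B * gibbs G S u t).trace / partition G S β u

end RandomLoops

end

/-! Both sides are expanded into the same series. The constant in the Hamiltonian factors out, so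
`exp (-s H̃)` equals `exp (-s |E|)` times the exponential of the sum `K` of the transition operators
with weights `u` and `1 - u`. Expanding the exponentials on either side of the inserted observable
gives a sum over words (sequences of crosses and bars) with a marked position `k`. The coefficient
is `exp (-β |E|) / n!` times `n.choose k * t ^ k * (β - t) ^ (n - k)`, which is the Poisson weight
of seeing that word with `k` transitions before time `t` (`hasSum_trace`, `lintegral_rho`).

It remains to evaluate the trace of one word. The signs of `P` factor over the spins, so they are a
diagonal conjugation that cancels in a trace with diagonal observables. What remains counts
space-time spin configurations compatible with the word: a cross carries spins across the edge, a
bar forces opposite spins at its two ends. If the spin is read with a minus sign when travelling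
downwards, it is constant along a trajectory. Each loop therefore carries one free spin value and
contributes a factor `θ = 2S + 1` (`trace_interleave`, `FreeInvolutions.oddEquiv`).

For a diagonal observable `f` at both points, the trace divided by `θ ^ loops` is the mean of `f(a)
^ 2` for a common loop with identical directions, the mean of `f(a) f(-a)` for opposite directions,
and the squared mean of `f` for distinct loops (`trace_word_two`). These cases are exclusive because
a loop never traverses itself backwards: it is a dihedral orbit of two free involutions and splits
into exactly two oriented trajectories (`FreeInvolutions.not_oriented_left`).

This gives the claim for `S³`, with moments of a uniform spin. The other directions follow because
`T` and `P` commute with the total spin: invariance of the trace forms under infinitesimal rotations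
moves `S³` to `S¹` or `S²` (`Rotates.bilinear_eq`, `Rotates.bilinear_sq_eq`, `Rotates.linear_eq`).
-/

noncomputable section

namespace RandomLoops

/-! ### Loops as dihedral orbits of two free involutions. -/

section Involutions

open Equiv

variable {X : Type*} {R m : Perm X}

/-- Orbits of the composition of two involutions, seen as oriented trajectories. -/
def Oriented (R m : Perm X) (p q : X) : Prop := (R * m).SameCycle p q

theorem Oriented.refl (p : X) : Oriented R m p p := Perm.SameCycle.refl _ _

theorem Oriented.symm {p q : X} (h : Oriented R m p q) : Oriented R m q p :=
  Perm.SameCycle.symm h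

theorem Oriented.trans {p q r : X} (h : Oriented R m p q) (h' : Oriented R m q r) :
    Oriented R m p r :=
  Perm.SameCycle.trans h h'

theorem Oriented.step (p : X) : Oriented R m p (R (m p)) := ⟨1, by simp⟩

/-- An equivalence relation that contains the elementary steps contains `Oriented`. -/
theorem Oriented.lift {r : X → X → Prop} (hr : Equivalence r) (hs : ∀ p, r p (R (m p)))
    {p q : X} (h : Oriented R m p q) : r p q := by
  obtain ⟨i, rfl⟩ := h
  induction i using Int.induction_on with
  | zero => exact hr.refl _
  | succ k ih =>
    refine hr.trans ih ?_
    have e : ((R * m) ^ ((k : ℤ) + 1)) p = R (m (((R * m) ^ (k : ℤ)) p)) := by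
      rw [add_comm, zpow_add, zpow_one]; rfl
    rw [e]; exact hs _
  | pred k ih =>
    refine hr.trans ih (hr.symm ?_)
    have e : ((R * m) ^ (-(k : ℤ))) p = R (m (((R * m) ^ (-(k : ℤ) - 1)) p)) := by
      have : (-(k : ℤ)) = 1 + (-(k : ℤ) - 1) := by ring
      conv_lhs => rw [this, zpow_add, zpow_one]
      rfl
    rw [e]; exact hs _

/-- Two involutions without fixed points. -/
structure FreeInvolutions (R m : Perm X) : Prop where
  left_invol : ∀ p, R (R p) = p
  right_invol : ∀ p, m (m p) = p
  left_ne : ∀ p, R p ≠ p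
  right_ne : ∀ p, m p ≠ p

namespace FreeInvolutions

variable (h : FreeInvolutions R m)
include h

theorem inv_left : R⁻¹ = R := by
  ext p; rw [Perm.inv_eq_iff_eq, h.left_invol]

theorem inv_right : m⁻¹ = m := by
  ext p; rw [Perm.inv_eq_iff_eq, h.right_invol]

/-- The dihedral relation: conjugation by `R` inverts `R * m`. -/
theorem left_zpow (i : ℤ) (p : X) : R (((R * m) ^ i) p) = ((R * m) ^ (-i)) (R p) := by
  have e : R * (R * m) * R⁻¹ = (R * m)⁻¹ := by
    rw [mul_inv_rev, h.inv_left, h.inv_right, ← mul_assoc]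
    ext p; simp [h.left_invol]
  have e2 : R * (R * m) ^ i * R⁻¹ = (R * m) ^ (-i) := by
    rw [← conj_zpow, e, inv_zpow, zpow_neg]
  rw [← e2]; simp

theorem oriented_left {p q : X} (hpq : Oriented R m p q) : Oriented R m (R p) (R q) := by
  obtain ⟨i, rfl⟩ := hpq
  exact ⟨-i, (h.left_zpow i p).symm⟩

theorem oriented_left_comm {p q : X} : Oriented R m (R p) q ↔ Oriented R m p (R q) := by
  constructor
  · intro H; have := h.oriented_left H; rwa [h.left_invol] at this
  · intro H; have := h.oriented_left H; rwa [h.left_invol] at this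

/-- A path of `i` steps from `p` to `R p` is symmetric about its midpoint. The point reached after
half the steps would be fixed by `R` if `i` is even and by `m` if `i` is odd, and neither has fixed
points. -/
theorem not_oriented_left (p : X) : ¬ Oriented R m p (R p) := by
  rintro ⟨i, hi⟩
  obtain ⟨j, hj | hj⟩ := Int.even_or_odd' i
  · apply h.left_ne (((R * m) ^ j) p)
    rw [h.left_zpow, ← hi, hj, ← Perm.mul_apply, ← zpow_add]
    congr 2; ring
  · apply h.right_ne (((R * m) ^ j) p)
    apply R.injective
    rw [h.left_zpow, ← hi, hj]
    have : R (m (((R * m) ^ j) p)) = ((R * m) ^ (1 + j)) p := by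
      rw [zpow_add, zpow_one]; rfl
    rw [this, ← Perm.mul_apply, ← zpow_add]
    congr 2; ring

theorem oriented_right (p : X) : Oriented R m (R p) (m p) := by
  rw [h.oriented_left_comm]; exact Oriented.step p

/-- The equivalence relation of lying on the same loop, in whatever direction. -/
def setoid : Setoid X where
  r p q := Oriented R m p q ∨ Oriented R m p (R q)
  iseqv := by
    refine ⟨fun p => Or.inl (Oriented.refl p), ?_, ?_⟩
    · rintro p q (H | H)
      · exact Or.inl H.symm
      · exact Or.inr (h.oriented_left_comm.1 H.symm)
    · rintro p q r (H | H) (H' | H')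
      · exact Or.inl (H.trans H')
      · exact Or.inr (H.trans H')
      · exact Or.inr (H.trans (h.oriented_left H'))
      · refine Or.inl (H.trans ?_)
        have := h.oriented_left H'
        rwa [h.left_invol] at this

/-- Every loop consists of exactly two oriented trajectories, exchanged by `R`. -/
theorem oriented_left_iff_not {p r : X} (hpr : h.setoid.r p r) :
    Oriented R m (R p) r ↔ ¬ Oriented R m p r := by
  constructor
  · intro H H'
    exact h.not_oriented_left p (H'.trans H.symm)
  · intro H
    exact h.oriented_left_comm.2 (hpr.resolve_left H)

theorem setoid_left (p : X) : h.setoid.r (R p) p := Or.inr (Oriented.refl _)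

theorem setoid_right (p : X) : h.setoid.r (m p) p :=
  Or.inr (h.oriented_right p).symm

theorem oriented_right_iff {p r : X} : Oriented R m (m p) r ↔ Oriented R m (R p) r :=
  ⟨fun H => (h.oriented_right p).trans H, fun H => (h.oriented_right p).symm.trans H⟩

omit h in
/-- Functions that are odd under both involutions. -/
def Odd {M : Type*} (R m : Perm X) (ν : M → M) (s : X → M) : Prop :=
  (∀ p, s (R p) = ν (s p)) ∧ ∀ p, s (m p) = ν (s p)

omit h in
-- A step of `R * m` applies `ν` twice.
theorem Odd.eq_of_oriented {M : Type*} {ν : M → M} (hν : Function.Involutive ν) {s : X → M}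
    (hs : Odd R m ν s) {p q : X} (hpq : Oriented R m p q) : s p = s q := by
  refine Oriented.lift (r := fun p q => s p = s q)
    ⟨fun _ => rfl, fun h => h.symm, fun h h' => h.trans h'⟩ (fun p => ?_) hpq
  rw [hs.1, hs.2, hν]

open Classical in
/-- An odd function is determined by its arbitrary values at one point of every loop. -/
def oddEquiv {M : Type*} {ν : M → M} (hν : Function.Involutive ν) :
    {s : X → M // Odd R m ν s} ≃ (Quotient h.setoid → M) where
  toFun s q := s.1 q.out
  invFun c := ⟨fun p =>
    if Oriented R m p (Quotient.mk h.setoid p).out then c (Quotient.mk h.setoid p)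
    else ν (c (Quotient.mk h.setoid p)), by
      -- `R` and `m` are treated alike: either one stays on the loop and changes the orientation
      -- relative to the chosen representative.
      have key : ∀ p p', h.setoid.r p' p →
          (∀ r, h.setoid.r p r → (Oriented R m p' r ↔ ¬ Oriented R m p r)) →
          (if Oriented R m p' (Quotient.mk h.setoid p').out then c (Quotient.mk h.setoid p')
            else ν (c (Quotient.mk h.setoid p'))) =
          ν (if Oriented R m p (Quotient.mk h.setoid p).out then c (Quotient.mk h.setoid p)
            else ν (c (Quotient.mk h.setoid p))) := by
        intro p p' hp H
        have e : Quotient.mk h.setoid p' = Quotient.mk h.setoid p := Quotient.sound hp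
        rw [e]
        have hr : h.setoid.r p (Quotient.mk h.setoid p).out :=
          h.setoid.symm (Quotient.mk_out (s := h.setoid) p)
        rw [H _ hr]
        by_cases hh : Oriented R m p (Quotient.mk h.setoid p).out
        · simp [hh]
        · simp [hh, hν _]
      refine ⟨fun p => key p _ (h.setoid_left p) fun r hr => h.oriented_left_iff_not hr,
        fun p => key p _ (h.setoid_right p) fun r hr => ?_⟩
      rw [h.oriented_right_iff, h.oriented_left_iff_not hr]⟩
  left_inv s := by
    ext p
    have hr : h.setoid.r p (Quotient.mk h.setoid p).out :=
      h.setoid.symm (Quotient.mk_out (s := h.setoid) p)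
    show (if _ then _ else _) = _
    split_ifs with hh
    · exact (s.2.eq_of_oriented hν hh).symm
    · have := s.2.eq_of_oriented hν (hr.resolve_left hh)
      rw [this, s.2.1]
  right_inv c := by
    ext q
    simp only [Quotient.out_eq]
    rw [if_pos (Oriented.refl _)]

/-- The alternative stands outside the quantifier over `c`: whether `ν` intervenes depends on `p`
alone, so one case serves for a whole sum over `c`. -/
theorem oddEquiv_symm_apply {M : Type*} {ν : M → M} (hν : Function.Involutive ν) (p : X) :
    (∀ c, ((h.oddEquiv hν).symm c).1 p = c (Quotient.mk h.setoid p)) ∨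
    (∀ c, ((h.oddEquiv hν).symm c).1 p = ν (c (Quotient.mk h.setoid p))) := by
  by_cases hh : Oriented R m p (Quotient.mk h.setoid p).out
  · exact Or.inl fun c => if_pos hh
  · exact Or.inr fun c => if_neg hh

end FreeInvolutions

end Involutions

/-! ### Independent uniform values on a finite set of loops. -/

section SumOverFunctions

variable {Q M : Type*} [Fintype Q] [Fintype M] [DecidableEq Q]

/-- The sum over `c` is a product over `Q` in which only the factor `k` is not `card M`. The extra
`card M` on the left avoids the exponent `card Q - 1`. -/
theorem sum_apply (f : M → ℂ) (k : Q) :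
    (Fintype.card M : ℂ) * ∑ c : Q → M, f (c k) =
      (Fintype.card M : ℂ) ^ Fintype.card Q * ∑ a, f a := by
  have h1 : ∀ c : Q → M, f (c k) = ∏ j, if j = k then f (c j) else 1 := fun c => by
    rw [Finset.prod_ite_eq']; simp
  have h2 := Finset.prod_univ_sum (fun _ : Q => (Finset.univ : Finset M))
    (fun j a => if j = k then f a else (1 : ℂ))
  rw [Fintype.piFinset_univ] at h2
  simp_rw [h1, ← h2]
  rw [← Finset.mul_prod_erase _ _ (Finset.mem_univ k)]
  rw [Finset.prod_congr rfl (g := fun _ => (Fintype.card M : ℂ))]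
  · have : Fintype.card Q = Fintype.card Q - 1 + 1 :=
      (Nat.succ_pred_eq_of_pos (Fintype.card_pos_iff.2 ⟨k⟩)).symm
    simp only [Finset.prod_const, if_true, Finset.card_erase_of_mem (Finset.mem_univ k),
      Finset.card_univ]
    conv_rhs => rw [this, pow_succ]
    ring
  · intro j hj
    simp [Finset.ne_of_mem_erase hj]

theorem sum_apply_mul_apply (f g : M → ℂ) {k l : Q} (hkl : k ≠ l) :
    (Fintype.card M : ℂ) ^ 2 * ∑ c : Q → M, f (c k) * g (c l) =
      (Fintype.card M : ℂ) ^ Fintype.card Q * ((∑ a, f a) * ∑ a, g a) := by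
  have h1 : ∀ c : Q → M, f (c k) * g (c l) =
      ∏ j, if j = k then f (c j) else if j = l then g (c j) else 1 := fun c => by
    rw [← Finset.mul_prod_erase _ _ (Finset.mem_univ k),
      ← Finset.mul_prod_erase _ _ (Finset.mem_erase.2 ⟨hkl.symm, Finset.mem_univ l⟩)]
    rw [Finset.prod_eq_one]
    · simp [hkl.symm]
    · intro j hj
      simp only [Finset.mem_erase, Finset.mem_univ, and_true] at hj
      simp [hj.1, hj.2]
  have h2 := Finset.prod_univ_sum (fun _ : Q => (Finset.univ : Finset M))
    (fun j a => if j = k then f a else if j = l then g a else (1 : ℂ))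
  rw [Fintype.piFinset_univ] at h2
  simp_rw [h1, ← h2]
  rw [← Finset.mul_prod_erase _ _ (Finset.mem_univ k),
      ← Finset.mul_prod_erase _ _ (Finset.mem_erase.2 ⟨hkl.symm, Finset.mem_univ l⟩)]
  rw [Finset.prod_congr rfl (g := fun _ => (Fintype.card M : ℂ))]
  · have h3 : (Finset.univ.erase k).card = Fintype.card Q - 1 := by
      rw [Finset.card_erase_of_mem (Finset.mem_univ k), Finset.card_univ]
    have h4 : ((Finset.univ.erase k).erase l).card + 1 + 1 = Fintype.card Q := by
      rw [Finset.card_erase_add_one (Finset.mem_erase.2 ⟨hkl.symm, Finset.mem_univ l⟩),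
        Finset.card_erase_add_one (Finset.mem_univ k), Finset.card_univ]
    simp only [Finset.prod_const, if_true, if_neg hkl.symm]
    conv_rhs => rw [← h4, pow_succ, pow_succ]
    ring
  · intro j hj
    simp only [Finset.mem_erase, Finset.mem_univ, and_true] at hj
    simp [hj.1, hj.2]

end SumOverFunctions

namespace FreeInvolutions

open Equiv

variable {X : Type*} {R m : Perm X} [Finite X] {M : Type*} [Fintype M] {ν : M → M}

/-- The number of loops. -/
def numClasses (h : FreeInvolutions R m) : ℕ := Nat.card (Quotient h.setoid)

variable (h : FreeInvolutions R m) (hν : Function.Involutive ν)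
  [Fintype {s : X → M // Odd R m ν s}]
include hν

omit [Finite X] [Fintype M] in
theorem sum_odd_eq (F : {s : X → M // Odd R m ν s} → ℂ) [Fintype (Quotient h.setoid → M)] :
    ∑ s, F s = ∑ c : Quotient h.setoid → M, F ((h.oddEquiv hν).symm c) :=
  Fintype.sum_equiv (h.oddEquiv hν) _ _ fun s => by simp

omit [Finite X] [Fintype {s : X → M // Odd R m ν s}] in
theorem sum_comp_involution (f : M → ℂ) : ∑ a, f (ν a) = ∑ a, f a :=
  Fintype.sum_equiv (hν.toPerm) _ _ fun _ => rfl

/-- The value at `p` is the free value of its loop, possibly after `ν`; a sum over all of `M` does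
not see `ν`. Every other loop contributes `card M`. -/
theorem sum_odd_apply (f : M → ℂ) (p : X) :
    (Fintype.card M : ℂ) * ∑ s : {s : X → M // Odd R m ν s}, f (s.1 p) =
      (Fintype.card M : ℂ) ^ h.numClasses * ∑ a, f a := by
  classical
  have := Fintype.ofFinite (Quotient h.setoid)
  rw [sum_odd_eq h hν, numClasses, Nat.card_eq_fintype_card]
  rcases h.oddEquiv_symm_apply hν p with H | H
  · simp_rw [H]; exact sum_apply f _
  · simp_rw [H]; rw [← sum_comp_involution hν f]; exact sum_apply (fun a => f (ν a)) _

theorem sum_odd_of_oriented (f g : M → ℂ) {p q : X} (hpq : Oriented R m p q) :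
    (Fintype.card M : ℂ) * ∑ s : {s : X → M // Odd R m ν s}, f (s.1 p) * g (s.1 q) =
      (Fintype.card M : ℂ) ^ h.numClasses * ∑ a, f a * g a := by
  rw [← sum_odd_apply h hν (fun a => f a * g a) p]
  simp_rw [← fun s : {s : X → M // Odd R m ν s} => s.2.eq_of_oriented hν hpq]

theorem sum_odd_of_opposite (f g : M → ℂ) {p q : X} (hpq : Oriented R m p (R q)) :
    (Fintype.card M : ℂ) * ∑ s : {s : X → M // Odd R m ν s}, f (s.1 p) * g (s.1 q) =
      (Fintype.card M : ℂ) ^ h.numClasses * ∑ a, f a * g (ν a) := by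
  rw [← sum_odd_of_oriented h hν f (fun a => g (ν a)) hpq]
  simp_rw [fun s : {s : X → M // Odd R m ν s} => s.2.1 q, hν _]

/-- Distinct loops carry independent values. -/
theorem sum_odd_of_not (f g : M → ℂ) {p q : X} (hpq : ¬ h.setoid.r p q) :
    (Fintype.card M : ℂ) ^ 2 * ∑ s : {s : X → M // Odd R m ν s}, f (s.1 p) * g (s.1 q) =
      (Fintype.card M : ℂ) ^ h.numClasses * ((∑ a, f a) * ∑ a, g a) := by
  classical
  have := Fintype.ofFinite (Quotient h.setoid)
  have hne : Quotient.mk h.setoid p ≠ Quotient.mk h.setoid q := fun e => hpq (Quotient.exact e)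
  rw [sum_odd_eq h hν, numClasses, Nat.card_eq_fintype_card]
  rcases h.oddEquiv_symm_apply hν p with H | H <;> rcases h.oddEquiv_symm_apply hν q with H' | H'
  · simp_rw [H, H']; exact sum_apply_mul_apply f g hne
  · simp_rw [H, H']; rw [← sum_comp_involution hν g]
    exact sum_apply_mul_apply f (fun a => g (ν a)) hne
  · simp_rw [H, H']; rw [← sum_comp_involution hν f]
    exact sum_apply_mul_apply (fun a => f (ν a)) g hne
  · simp_rw [H, H']; rw [← sum_comp_involution hν f, ← sum_comp_involution hν g]
    exact sum_apply_mul_apply (fun a => f (ν a)) (fun a => g (ν a)) hne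

end FreeInvolutions

/-! ### Discrete trajectories of a word of transitions. -/

section Words

variable {V : Type*} [DecidableEq V] {G : SimpleGraph V}

/-- The edge and the kind of a transition. -/
abbrev Letter (G : SimpleGraph V) : Type _ := G.edgeSet × Kind

/-- The other endpoint of an edge, for the sites of the edge; the other sites are fixed. -/
def partner (e : Sym2 V) (x : V) : V :=
  Sym2.lift ⟨fun a b => Equiv.swap a b x, fun a b => by beta_reduce; rw [Equiv.swap_comm]⟩ e

@[simp] theorem partner_mk (a b x : V) : partner s(a, b) x = Equiv.swap a b x := rfl

theorem partner_partner (e : Sym2 V) (x : V) : partner e (partner e x) = x := by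
  induction e with | _ a b => simp

theorem partner_mem {e : Sym2 V} {x : V} : partner e x ∈ e ↔ x ∈ e := by
  induction e with | _ a b =>
  rw [partner_mk]
  by_cases ha : x = a
  · subst ha; simp
  by_cases hb : x = b
  · subst hb; simp
  rw [Equiv.swap_apply_of_ne_of_ne ha hb]

theorem partner_of_notMem {e : Sym2 V} {x : V} (hx : x ∉ e) : partner e x = x := by
  induction e with | _ a b =>
  simp only [Sym2.mem_iff, not_or] at hx
  exact Equiv.swap_apply_of_ne_of_ne hx.1 hx.2

theorem partner_ne (e : G.edgeSet) {x : V} (hx : x ∈ (e : Sym2 V)) : partner e x ≠ x := by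
  obtain ⟨e, he⟩ := e
  induction e with | _ a b =>
  have hab : a ≠ b := (G.mem_edgeSet.1 he).ne
  simp only [Sym2.mem_iff] at hx
  rcases hx with rfl | rfl
  · simpa using hab.symm
  · simpa using hab

theorem partner_spec {e : Sym2 V} {x : V} (hx : x ∈ e) : e = s(x, partner e x) := by
  induction e with | _ a b =>
  simp only [Sym2.mem_iff] at hx
  rcases hx with rfl | rfl
  · simp
  · simp [Sym2.eq_swap]

/-- The motion of sites through a transition, `none` being the absence of a transition. -/
def partnerOpt : Option (Letter G) → V → V
  | none, x => x
  | some l, x => partner (l.1 : Sym2 V) x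

/-- There is a double bar at `x`. -/
def IsBar : Option (Letter G) → V → Prop
  | none, _ => False
  | some l, x => l.2 = Kind.bar ∧ x ∈ (l.1 : Sym2 V)

theorem partnerOpt_partnerOpt (l : Option (Letter G)) (x : V) :
    partnerOpt l (partnerOpt l x) = x := by
  cases l
  · rfl
  · exact partner_partner _ _

theorem isBar_partnerOpt {l : Option (Letter G)} {x : V} :
    IsBar l (partnerOpt l x) ↔ IsBar l x := by
  cases l
  · rfl
  · exact and_congr_right fun _ => partner_mem

theorem IsBar.partnerOpt_ne {l : Option (Letter G)} {x : V} (h : IsBar l x) :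
    partnerOpt l x ≠ x := by
  cases l
  · exact h.elim
  · exact partner_ne _ h.2

/-- The opposite vertical direction. -/
def Dir.rev : Dir → Dir
  | up => down
  | down => up

theorem Dir.rev_rev (d : Dir) : d.rev.rev = d := by cases d <;> rfl

theorem Dir.rev_ne (d : Dir) : d.rev ≠ d := by cases d <;> simp [Dir.rev]

variable {n : ℕ}

/-- Reversal of the vertical direction. -/
def reversal (V : Type*) (n : ℕ) : Equiv.Perm (V × Fin (n + 1) × Dir) :=
  Function.Involutive.toPerm (fun p => (p.1, p.2.1, p.2.2.rev)) fun p => by simp [Dir.rev_rev]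

open Classical in
/-- The endpoint of a vertical segment that is joined to a given one by a transition, where
`w i` is the transition between the time slots `i` and `i + 1` (periodically). -/
def jumpFun (w : Fin (n + 1) → Option (Letter G)) :
    V × Fin (n + 1) × Dir → V × Fin (n + 1) × Dir
  -- `(x, i, up)` is the top end of slot `i` at `x` and `(x, i, down)` its bottom end. A bar joins
  -- two top ends of the same slot; otherwise a top end is joined to a bottom end of the next slot.
  -- Applying `reversal` afterwards gives the direction of travel in the slot just entered.
  | (x, i, Dir.up) =>
    if IsBar (w i) x then (partnerOpt (w i) x, i, Dir.up)
    else (partnerOpt (w i) x, i + 1, Dir.down)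
  | (x, i, Dir.down) =>
    if IsBar (w (i - 1)) x then (partnerOpt (w (i - 1)) x, i, Dir.down)
    else (partnerOpt (w (i - 1)) x, i - 1, Dir.up)

theorem jumpFun_jumpFun (w : Fin (n + 1) → Option (Letter G)) (p : V × Fin (n + 1) × Dir) :
    jumpFun w (jumpFun w p) = p := by
  obtain ⟨x, i, d | d⟩ := p
  · by_cases h : IsBar (w i) x
    · simp only [jumpFun, if_pos h, partnerOpt_partnerOpt]
      rw [if_pos (isBar_partnerOpt.2 h)]
    · simp only [jumpFun, if_neg h, add_sub_cancel_right, partnerOpt_partnerOpt]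
      rw [add_sub_cancel_right, if_neg (isBar_partnerOpt.not.2 h)]
  · by_cases h : IsBar (w (i - 1)) x
    · simp only [jumpFun, if_pos h, partnerOpt_partnerOpt]
      rw [if_pos (isBar_partnerOpt.2 h)]
    · simp only [jumpFun, if_neg h, sub_add_cancel, partnerOpt_partnerOpt]
      rw [if_neg (isBar_partnerOpt.not.2 h)]

/-- `jumpFun` as a permutation. -/
def jump (w : Fin (n + 1) → Option (Letter G)) : Equiv.Perm (V × Fin (n + 1) × Dir) :=
  Function.Involutive.toPerm (jumpFun w) (jumpFun_jumpFun w)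

/-- A bar changes the site, as an edge has distinct endpoints; any other jump changes the vertical
direction. -/
theorem freeInvolutions (w : Fin (n + 1) → Option (Letter G)) :
    FreeInvolutions (reversal V n) (jump w) where
  left_invol p := by
    obtain ⟨x, i, d⟩ := p
    show (x, i, d.rev.rev) = _
    rw [Dir.rev_rev]
  right_invol p := jumpFun_jumpFun w p
  left_ne p := by
    obtain ⟨x, i, d⟩ := p
    intro h
    exact Dir.rev_ne d (congrArg (fun q => q.2.2) h)
  right_ne p := by
    obtain ⟨x, i, d | d⟩ := p
    · show jumpFun w (x, i, Dir.up) ≠ _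
      by_cases h : IsBar (w i) x
      · simp only [jumpFun, if_pos h]
        exact fun H => h.partnerOpt_ne (congrArg (fun q => q.1) H)
      · simp only [jumpFun, if_neg h]
        exact fun H => by simpa using congrArg (fun q => q.2.2) H
    · show jumpFun w (x, i, Dir.down) ≠ _
      by_cases h : IsBar (w (i - 1)) x
      · simp only [jumpFun, if_pos h]
        exact fun H => h.partnerOpt_ne (congrArg (fun q => q.1) H)
      · simp only [jumpFun, if_neg h]
        exact fun H => by simpa using congrArg (fun q => q.2.2) H

/-- The transitions between consecutive time slots, with none at the end of the period. -/
def closeUp (lab : Fin n → Letter G) : Fin (n + 1) → Option (Letter G) :=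
  Fin.snoc (α := fun _ => Option (Letter G)) (fun i => some (lab i)) none

omit [DecidableEq V] in
@[simp] theorem closeUp_castSucc (lab : Fin n → Letter G) (i : Fin n) :
    closeUp lab i.castSucc = some (lab i) := by simp [closeUp]

omit [DecidableEq V] in
@[simp] theorem closeUp_last (lab : Fin n → Letter G) :
    closeUp lab (Fin.last n) = none := by simp [closeUp]

/-- Two directed slots are on the same trajectory. -/
def WordOriented (lab : Fin n → Letter G) : (p q : V × Fin (n + 1) × Dir) → Prop :=
  Oriented (reversal V n) (jump (closeUp lab))

theorem castSucc_add_one (k : Fin n) : k.castSucc + 1 = k.succ := Fin.coeSucc_eq_succ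

theorem succ_sub_one (k : Fin n) : k.succ - 1 = k.castSucc := by
  rw [← castSucc_add_one, add_sub_cancel_right]

theorem next_up_of_bar (lab : Fin n → Letter G) (k : Fin n) (x : V)
    (h : (lab k).2 = Kind.bar ∧ x ∈ ((lab k).1 : Sym2 V)) :
    reversal V n (jump (closeUp lab) (x, k.castSucc, Dir.up)) =
      (partner (lab k).1 x, k.castSucc, Dir.down) := by
  have h' : IsBar (closeUp lab k.castSucc) x := by rw [closeUp_castSucc]; exact h
  show reversal V n (jumpFun _ _) = _
  simp only [jumpFun, if_pos h']
  simp [partnerOpt, reversal, Dir.rev]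

theorem next_up_of_not_bar (lab : Fin n → Letter G) (k : Fin n) (x : V)
    (h : ¬ ((lab k).2 = Kind.bar ∧ x ∈ ((lab k).1 : Sym2 V))) :
    reversal V n (jump (closeUp lab) (x, k.castSucc, Dir.up)) =
      (partner (lab k).1 x, k.succ, Dir.up) := by
  have h' : ¬ IsBar (closeUp lab k.castSucc) x := by rw [closeUp_castSucc]; exact h
  show reversal V n (jumpFun _ _) = _
  simp only [jumpFun, if_neg h']
  simp [partnerOpt, reversal, Dir.rev]

theorem next_up_last (lab : Fin n → Letter G) (x : V) :
    reversal V n (jump (closeUp lab) (x, Fin.last n, Dir.up)) = (x, 0, Dir.up) := by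
  have h' : ¬ IsBar (closeUp lab (Fin.last n)) x := by rw [closeUp_last]; exact id
  show reversal V n (jumpFun _ _) = _
  simp only [jumpFun, if_neg h']
  simp [partnerOpt, reversal, Dir.rev]

theorem next_down_of_bar (lab : Fin n → Letter G) (k : Fin n) (x : V)
    (h : (lab k).2 = Kind.bar ∧ x ∈ ((lab k).1 : Sym2 V)) :
    reversal V n (jump (closeUp lab) (x, k.succ, Dir.down)) =
      (partner (lab k).1 x, k.succ, Dir.up) := by
  have h' : IsBar (closeUp lab (k.succ - 1)) x := by
    rw [succ_sub_one, closeUp_castSucc]; exact h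
  show reversal V n (jumpFun _ _) = _
  simp only [jumpFun, if_pos h', succ_sub_one]
  simp [partnerOpt, reversal, Dir.rev]

theorem next_down_of_not_bar (lab : Fin n → Letter G) (k : Fin n) (x : V)
    (h : ¬ ((lab k).2 = Kind.bar ∧ x ∈ ((lab k).1 : Sym2 V))) :
    reversal V n (jump (closeUp lab) (x, k.succ, Dir.down)) =
      (partner (lab k).1 x, k.castSucc, Dir.down) := by
  have h' : ¬ IsBar (closeUp lab (k.succ - 1)) x := by
    rw [succ_sub_one, closeUp_castSucc]; exact h
  show reversal V n (jumpFun _ _) = _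
  simp only [jumpFun, if_neg h', succ_sub_one]
  simp [partnerOpt, reversal, Dir.rev]

theorem next_down_zero (lab : Fin n → Letter G) (x : V) :
    reversal V n (jump (closeUp lab) (x, 0, Dir.down)) = (x, Fin.last n, Dir.down) := by
  have e : (0 : Fin (n + 1)) - 1 = Fin.last n := by
    rw [sub_eq_iff_eq_add]; simp
  have h' : ¬ IsBar (closeUp lab (0 - 1)) x := by rw [e, closeUp_last]; exact id
  show reversal V n (jumpFun _ _) = _
  simp only [jumpFun, if_neg h', e]
  simp [partnerOpt, reversal, Dir.rev]

/-- A transition away from `x` acts at `x` as no transition. The downward case is the `reversal` of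
the upward one. -/
theorem wordOriented_vertical (lab : Fin n → Letter G) (x : V) {i j : Fin (n + 1)} (hij : i ≤ j)
    (hx : ∀ k : Fin n, i ≤ k.castSucc → k.castSucc < j → x ∉ ((lab k).1 : Sym2 V)) (d : Dir) :
    WordOriented lab (x, i, d) (x, j, d) := by
  have up : WordOriented lab (x, i, Dir.up) (x, j, Dir.up) := by
    induction j using Fin.induction with
    | zero => rw [Fin.le_zero_iff.1 hij]; exact Oriented.refl _
    | succ j ih =>
      rcases eq_or_lt_of_le hij with rfl | hlt
      · exact Oriented.refl _
      have hle : i ≤ j.castSucc := by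
        rw [Fin.le_def]; rw [Fin.lt_def] at hlt; simp at hlt ⊢; omega
      refine (ih hle fun k h h' => hx k h (h'.trans (Fin.castSucc_lt_succ))).trans ?_
      have hj := hx j hle Fin.castSucc_lt_succ
      have := Oriented.step (R := reversal V n) (m := jump (closeUp lab)) (x, j.castSucc, Dir.up)
      rwa [next_up_of_not_bar _ _ _ fun h => hj h.2, partner_of_notMem hj] at this
  cases d
  · exact up
  · exact (freeInvolutions (closeUp lab)).oriented_left up

/-! ### From transition times in `[0, β]` to time slots. -/

section Times

variable (τ : Fin n → ℝ)

/-- The number of transitions before a given time. -/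
def idx (r : ℝ) : Fin (n + 1) :=
  ⟨(Finset.univ.filter fun j => τ j < r).card, by
    refine Nat.lt_succ_of_le ((Finset.card_le_univ _).trans_eq (Fintype.card_fin n))⟩

variable {τ}

/-- For increasing times, those before `r` form an initial segment, so their number locates `r`. -/
theorem lt_idx_iff (hτ : StrictMono τ) (r : ℝ) (k : Fin n) :
    k.castSucc < idx τ r ↔ τ k < r := by
  rw [Fin.lt_def]
  show (k : ℕ) < (Finset.univ.filter fun j => τ j < r).card ↔ _
  constructor
  · intro h
    by_contra hk
    have : (Finset.univ.filter fun j => τ j < r) ⊆ Finset.Iio k := fun j hj => by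
      simp only [Finset.mem_filter, Finset.mem_univ, true_and] at hj
      exact Finset.mem_Iio.2 (hτ.lt_iff_lt.1 (hj.trans_le (not_lt.1 hk)))
    have := Finset.card_le_card this
    rw [Fin.card_Iio] at this
    omega
  · intro h
    have : Finset.Iic k ⊆ (Finset.univ.filter fun j => τ j < r) := fun j hj => by
      simp only [Finset.mem_filter, Finset.mem_univ, true_and]
      exact (hτ.monotone (Finset.mem_Iic.1 hj)).trans_lt h
    have := Finset.card_le_card this
    rw [Fin.card_Iic] at this
    omega

theorem idx_eq_of {r : ℝ} {i : Fin (n + 1)} (h : ∀ k : Fin n, τ k < r ↔ k.castSucc < i) :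
    idx τ r = i := by
  ext
  show (Finset.univ.filter fun j => τ j < r).card = _
  simp_rw [h]
  rw [← Finset.card_map Fin.castSuccEmb]
  rw [← Fin.card_Iio i]
  congr 1
  ext j
  simp only [Finset.mem_map, Finset.mem_filter, Finset.mem_univ, true_and, Finset.mem_Iio]
  constructor
  · rintro ⟨k, hk, rfl⟩; exact hk
  · intro hj
    have hne : j ≠ Fin.last n := (hj.trans_le (Fin.le_last i)).ne
    exact ⟨j.castPred hne, by simpa using hj, by simp⟩

theorem idx_mono : Monotone (idx τ) := fun r s hrs => by
  rw [Fin.le_def]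
  refine Finset.card_le_card (s := Finset.univ.filter fun j => τ j < r)
    (t := Finset.univ.filter fun j => τ j < s) fun j hj => ?_
  simp only [Finset.mem_filter, Finset.mem_univ, true_and] at hj ⊢
  exact hj.trans_le hrs

theorem idx_apply (hτ : StrictMono τ) (k : Fin n) : idx τ (τ k) = k.castSucc :=
  idx_eq_of fun j => by rw [hτ.lt_iff_lt]; rfl

/-- The configuration with given letters at given times. -/
def config (lab : Fin n → Letter G) (τ : Fin n → ℝ) : Config (Transition G) :=
  Config.ofTuple ⟨n, fun j => ⟨(lab j).1, (lab j).2, τ j⟩⟩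

omit [DecidableEq V] in
theorem mem_config {lab : Fin n → Letter G} {m : Transition G} :
    m ∈ config lab τ ↔ ∃ j, (⟨(lab j).1, (lab j).2, τ j⟩ : Transition G) = m := by
  classical
  show m ∈ Finset.image _ _ ↔ _
  simp

omit [DecidableEq V] in
theorem touches_config {lab : Fin n → Letter G} {x : V} {s : ℝ} :
    Touches (config lab τ) x s ↔ ∃ j, x ∈ ((lab j).1 : Sym2 V) ∧ τ j = s := by
  constructor
  · rintro ⟨m, hm, hx, hs⟩
    obtain ⟨j, rfl⟩ := mem_config.1 hm
    exact ⟨j, hx, hs⟩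
  · rintro ⟨j, hx, hs⟩
    exact ⟨_, mem_config.2 ⟨j, rfl⟩, hx, hs⟩

omit [DecidableEq V] in
theorem hasTransition_config {lab : Fin n → Letter G} {k : Kind} {x y : V} {s : ℝ} :
    HasTransition (config lab τ) k x y s ↔
      ∃ j, ((lab j).1 : Sym2 V) = s(x, y) ∧ (lab j).2 = k ∧ τ j = s := by
  constructor
  · rintro ⟨m, hm, hx, hs⟩
    obtain ⟨j, rfl⟩ := mem_config.1 hm
    exact ⟨j, hx, hs⟩
  · rintro ⟨j, hx, hs⟩
    exact ⟨_, mem_config.2 ⟨j, rfl⟩, hx, hs⟩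

/-- Pairwise distinct times inside `(0, β)`, in increasing order. -/
structure Ordered (β : ℝ) (τ : Fin n → ℝ) : Prop where
  strictMono : StrictMono τ
  pos : ∀ j, 0 < τ j
  lt : ∀ j, τ j < β

variable {β : ℝ} (hτ : Ordered β τ) (lab : Fin n → Letter G)
include hτ

theorem Ordered.idx_zero : idx τ 0 = 0 := idx_eq_of fun k => by simp [(hτ.pos k).le]

theorem Ordered.idx_last : idx τ β = Fin.last n :=
  idx_eq_of fun k => by simp [hτ.lt k, Fin.castSucc_lt_last]

/-- The half-open interval suffices: `idx` counts strictly earlier times, so a transition at `s'`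
itself lies above the slot of `s'`. The slot just above the `j`-th transition is `j.succ`, as in
`wordOriented_succ`. -/
theorem wordOriented_idx {x : V} {s s' : ℝ} (h : s ≤ s')
    (hfree : ∀ r ∈ Set.Ico s s', ¬ Touches (config lab τ) x r) (d : Dir) :
    WordOriented lab (x, idx τ s, d) (x, idx τ s', d) := by
  refine wordOriented_vertical lab x (idx_mono h) (fun k hk hk' hx => ?_) d
  rw [lt_idx_iff hτ.strictMono] at hk'
  rw [← not_lt, lt_idx_iff hτ.strictMono, not_lt] at hk
  exact hfree _ ⟨hk, hk'⟩ (touches_config.2 ⟨k, hx, rfl⟩)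

theorem wordOriented_succ {y : V} {s' : ℝ} {j : Fin n} (h : τ j < s')
    (hfree : ∀ r ∈ Set.Ioc (τ j) s', ¬ Touches (config lab τ) y r) (d : Dir) :
    WordOriented lab (y, j.succ, d) (y, idx τ s', d) := by
  refine wordOriented_vertical lab y ?_ (fun k hk hk' hx => ?_) d
  · rw [← lt_idx_iff hτ.strictMono] at h
    rw [Fin.le_def]; rw [Fin.lt_def] at h; simpa using h
  · rw [lt_idx_iff hτ.strictMono] at hk'
    refine hfree _ ⟨hτ.strictMono ?_, hk'.le⟩ (touches_config.2 ⟨k, hx, rfl⟩)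
    rw [Fin.le_def] at hk
    rw [Fin.lt_def]; simpa using hk

/-- Moves along loops follow the trajectories of the discrete word. -/
theorem wordOriented_of_step {P Q : V × ℝ × Dir} (h : Step β (config lab τ) P Q) :
    WordOriented lab (P.1, idx τ P.2.1, P.2.2) (Q.1, idx τ Q.2.1, Q.2.2) := by
  have hfree := freeInvolutions (closeUp lab)
  have step := Oriented.step (R := reversal V n) (m := jump (closeUp lab))
  cases h with
  | vertical d h₀ h h₁ hf =>
    exact wordOriented_idx hτ lab h (fun r hr => hf r ⟨hr.1, hr.2.le⟩) d
  | @wrap x d h₀ h₁ =>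
    simp only [hτ.idx_zero, hτ.idx_last]
    have := step (x, Fin.last n, Dir.up)
    rw [next_up_last] at this
    cases d
    · exact this
    · exact hfree.oriented_left this
  | @crossUp x y s t s' ht h₀ h h' h₁ hx hy =>
    obtain ⟨j, hj, hk, rfl⟩ := hasTransition_config.1 ht
    refine (wordOriented_idx hτ lab h.le hx _).trans
      (Oriented.trans ?_ (wordOriented_succ hτ lab h' hy _))
    rw [idx_apply hτ.strictMono]
    have := step (x, j.castSucc, Dir.up)
    rwa [next_up_of_not_bar _ _ _ (by simp [hk]), hj, partner_mk, Equiv.swap_apply_left] at this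
  | @crossDown x y s t s' ht h₀ h' h h₁ hx hy =>
    obtain ⟨j, hj, hk, rfl⟩ := hasTransition_config.1 ht
    refine (wordOriented_succ hτ lab h hx _).symm.trans
      (Oriented.trans ?_ (wordOriented_idx hτ lab h'.le hy _).symm)
    rw [idx_apply hτ.strictMono]
    have := step (x, j.succ, Dir.down)
    rwa [next_down_of_not_bar _ _ _ (by simp [hk]), hj, partner_mk, Equiv.swap_apply_left] at this
  | @barFromBelow x y s t s' ht h₀ h h₀' h' h₁ hx hy =>
    obtain ⟨j, hj, hk, rfl⟩ := hasTransition_config.1 ht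
    refine (wordOriented_idx hτ lab h.le hx _).trans
      (Oriented.trans ?_ (wordOriented_idx hτ lab h'.le hy _).symm)
    rw [idx_apply hτ.strictMono]
    have := step (x, j.castSucc, Dir.up)
    rwa [next_up_of_bar _ _ _ (by simp [hk, hj]), hj, partner_mk, Equiv.swap_apply_left] at this
  | @barFromAbove x y s t s' ht h₀ h h₁ h' h₁' hx hy =>
    obtain ⟨j, hj, hk, rfl⟩ := hasTransition_config.1 ht
    refine (wordOriented_succ hτ lab h hx _).symm.trans
      (Oriented.trans ?_ (wordOriented_succ hτ lab h' hy _))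
    have := step (x, j.succ, Dir.down)
    rwa [next_down_of_bar _ _ _ (by simp [hk, hj]), hj, partner_mk, Equiv.swap_apply_left] at this

theorem wordOriented_of_sameTrajectory {P Q : V × ℝ × Dir}
    (h : SameTrajectory β (config lab τ) P Q) :
    WordOriented lab (P.1, idx τ P.2.1, P.2.2) (Q.1, idx τ Q.2.1, Q.2.2) := by
  induction h with
  | rel _ _ h => exact wordOriented_of_step hτ lab h
  | refl _ => exact Oriented.refl _
  | symm _ _ _ ih => exact Oriented.symm ih
  | trans _ _ _ _ _ ih ih' => exact Oriented.trans ih ih'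

variable (hβ : 0 < β)
include hβ

/-- Zero and the transitions before the slot all precede `β` and the transitions after it, and two
finite sets so ordered can be separated by a real number. -/
theorem exists_time (i : Fin (n + 1)) : ∃ r : ℝ, 0 < r ∧ r < β ∧
    (∀ k : Fin n, k.castSucc < i → τ k < r) ∧ ∀ k : Fin n, i ≤ k.castSucc → r < τ k := by
  classical
  obtain ⟨r, h1, h2⟩ := Order.exists_between_finsets
    (insert 0 ((Finset.univ.filter fun k : Fin n => k.castSucc < i).image τ))
    (insert β ((Finset.univ.filter fun k : Fin n => i ≤ k.castSucc).image τ)) (by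
      intro a ha b hb
      simp only [Finset.mem_insert, Finset.mem_image, Finset.mem_filter, Finset.mem_univ,
        true_and] at ha hb
      rcases ha with rfl | ⟨k, hk, rfl⟩ <;> rcases hb with rfl | ⟨l, hl, rfl⟩
      · exact hβ
      · exact hτ.pos l
      · exact hτ.lt k
      · exact hτ.strictMono (Fin.castSucc_lt_castSucc_iff.1 (hk.trans_le hl)))
  refine ⟨r, h1 _ (Finset.mem_insert_self _ _), h2 _ (Finset.mem_insert_self _ _),
    fun k hk => h1 _ ?_, fun k hk => h2 _ ?_⟩
  · exact Finset.mem_insert_of_mem (Finset.mem_image_of_mem _ (by simpa using hk))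
  · exact Finset.mem_insert_of_mem (Finset.mem_image_of_mem _ (by simpa using hk))

/-- A time in the interior of every time slot. -/
def slotTime (i : Fin (n + 1)) : ℝ := (exists_time hτ hβ i).choose

theorem slotTime_pos (i : Fin (n + 1)) : 0 < slotTime hτ hβ i :=
  (exists_time hτ hβ i).choose_spec.1

theorem slotTime_lt (i : Fin (n + 1)) : slotTime hτ hβ i < β :=
  (exists_time hτ hβ i).choose_spec.2.1

theorem lt_slotTime {i : Fin (n + 1)} {k : Fin n} (h : k.castSucc < i) :
    τ k < slotTime hτ hβ i :=
  (exists_time hτ hβ i).choose_spec.2.2.1 k h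

theorem slotTime_lt_time {i : Fin (n + 1)} {k : Fin n} (h : i ≤ k.castSucc) :
    slotTime hτ hβ i < τ k :=
  (exists_time hτ hβ i).choose_spec.2.2.2 k h

theorem lt_slotTime_iff {i : Fin (n + 1)} {k : Fin n} :
    τ k < slotTime hτ hβ i ↔ k.castSucc < i :=
  ⟨fun h => not_le.1 fun h' => (slotTime_lt_time hτ hβ h').not_gt h, lt_slotTime hτ hβ⟩

theorem slotTime_ne (i : Fin (n + 1)) (k : Fin n) : τ k ≠ slotTime hτ hβ i := by
  rcases lt_or_ge k.castSucc i with h | h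
  · exact (lt_slotTime hτ hβ h).ne
  · exact (slotTime_lt_time hτ hβ h).ne'

theorem idx_slotTime (i : Fin (n + 1)) : idx τ (slotTime hτ hβ i) = i :=
  idx_eq_of fun _ => lt_slotTime_iff hτ hβ

omit [DecidableEq V] in
theorem not_touches_slotTime (i : Fin (n + 1)) (x : V) :
    ¬ Touches (config lab τ) x (slotTime hτ hβ i) := fun h => by
  obtain ⟨j, _, hj⟩ := touches_config.1 h
  exact slotTime_ne hτ hβ i j hj

/-- The midway point of a slot. -/
def slotPoint (p : V × Fin (n + 1) × Dir) : V × ℝ × Dir := (p.1, slotTime hτ hβ p.2.1, p.2.2)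

-- No transition time lies strictly between `s` and the chosen time of its slot. The endpoint `s`
-- may be a transition time on another edge, hence the hypothesis that `x` is untouched at `s`.
omit [DecidableEq V] in
theorem sameTrajectory_slotTime_idx {x : V} {s : ℝ} (h₀ : 0 ≤ s) (h₁ : s ≤ β)
    (hs : ¬ Touches (config lab τ) x s) (d : Dir) :
    SameTrajectory β (config lab τ) (x, s, d) (x, slotTime hτ hβ (idx τ s), d) := by
  rcases le_total s (slotTime hτ hβ (idx τ s)) with h | h
  · refine Relation.EqvGen.rel _ _ (Step.vertical d h₀ h (slotTime_lt hτ hβ _).le ?_)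
    rintro r ⟨hr, hr'⟩ ht
    obtain ⟨j, _, rfl⟩ := touches_config.1 ht
    have h1 := lt_of_le_of_ne hr' (slotTime_ne hτ hβ _ j)
    rw [lt_slotTime_iff, lt_idx_iff hτ.strictMono] at h1
    exact h1.not_ge hr
  · refine Relation.EqvGen.symm _ _ (Relation.EqvGen.rel _ _
      (Step.vertical d (slotTime_pos hτ hβ _).le h h₁ ?_))
    rintro r ⟨hr, hr'⟩ ht
    obtain ⟨j, hj, rfl⟩ := touches_config.1 ht
    rcases eq_or_lt_of_le hr' with rfl | hlt
    · exact hs ht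
    · rw [← lt_idx_iff hτ.strictMono, ← lt_slotTime_iff hτ hβ] at hlt
      exact hlt.not_ge hr

-- Between the chosen times of consecutive slots there is only one transition time, `τ k`.
omit [DecidableEq V] in
theorem not_touches_of_mem_slots {k : Fin n} {x : V} {r : ℝ}
    (h₁ : slotTime hτ hβ k.castSucc ≤ r) (h₂ : r ≤ slotTime hτ hβ k.succ) (hr : r ≠ τ k) :
    ¬ Touches (config lab τ) x r := by
  intro ht
  obtain ⟨j, _, rfl⟩ := touches_config.1 ht
  have h2 := lt_of_le_of_ne h₂ (slotTime_ne hτ hβ _ j)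
  rw [lt_slotTime_iff] at h2
  have h3 : ¬ τ j < slotTime hτ hβ k.castSucc := h₁.not_gt
  rw [lt_slotTime_iff] at h3
  apply hr
  congr 1
  rw [Fin.lt_def] at h2 h3
  simp at h2 h3
  ext; omega

/-- Converse of `wordOriented_of_step`: each discrete step is realized by an elementary move, by the
reverse of one, or by a passage through the end of the period. -/
theorem sameTrajectory_next (p : V × Fin (n + 1) × Dir) :
    SameTrajectory β (config lab τ) (slotPoint hτ hβ p)
      (slotPoint hτ hβ (reversal V n (jump (closeUp lab) p))) := by
  have h0 := fun k : Fin n => slotTime_lt_time hτ hβ (le_refl k.castSucc)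
  have h1 := fun k : Fin n => lt_slotTime hτ hβ (Fin.castSucc_lt_succ (i := k))
  have hpos := slotTime_pos hτ hβ
  have hlt := slotTime_lt hτ hβ
  have hfree := fun (k : Fin n) (x : V) (r : ℝ) => not_touches_of_mem_slots hτ lab hβ
    (k := k) (x := x) (r := r)
  have hvert : ∀ (k : Fin n) (x : V), x ∉ ((lab k).1 : Sym2 V) → ∀ d,
      Step β (config lab τ) (x, slotTime hτ hβ k.castSucc, d) (x, slotTime hτ hβ k.succ, d) := by
    intro k x hx d
    refine Step.vertical d (hpos _).le ((h0 k).trans (h1 k)).le (hlt _).le fun r hr ht => ?_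
    by_cases hr' : r = τ k
    · obtain ⟨j, hj, hj'⟩ := touches_config.1 ht
      rw [hr'] at hj'
      rw [hτ.strictMono.injective hj'] at hj
      exact hx hj
    · exact hfree k x r hr.1 hr.2 hr' ht
  -- `Step.wrap` joins exactly `β` to `0`, so the last slot is first continued to time `β`, and the
  -- first slot is reached from time `0`.
  have hwrap : ∀ (x : V) (d : Dir), SameTrajectory β (config lab τ)
      (x, slotTime hτ hβ (Fin.last n), d) (x, slotTime hτ hβ 0, d) := by
    intro x d
    have hz : ∀ s, s = 0 ∨ s = β → ¬ Touches (config lab τ) x s := fun s hs ht => by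
      obtain ⟨j, _, hj'⟩ := touches_config.1 ht
      rcases hs with rfl | rfl
      · exact (hτ.pos j).ne' hj'
      · exact (hτ.lt j).ne hj'
    have e0 := sameTrajectory_slotTime_idx hτ lab hβ le_rfl hβ.le (hz 0 (Or.inl rfl)) d
    have e1 := sameTrajectory_slotTime_idx hτ lab hβ hβ.le le_rfl (hz β (Or.inr rfl)) d
    rw [hτ.idx_zero] at e0
    rw [hτ.idx_last] at e1
    exact (e1.symm _ _).trans _ _ _ ((Relation.EqvGen.rel _ _ (Step.wrap d
      (hz 0 (Or.inl rfl)) (hz β (Or.inr rfl)))).trans _ _ _ e0)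
  obtain ⟨x, i, d | d⟩ := p
  · induction i using Fin.lastCases with
    | last => rw [next_up_last]; exact hwrap x _
    | cast k =>
      by_cases hx : x ∈ ((lab k).1 : Sym2 V)
      · have hp := partner_spec hx
        cases hk : (lab k).2 with
        | cross =>
          rw [next_up_of_not_bar _ _ _ (by simp [hk])]
          exact Relation.EqvGen.rel _ _ (Step.crossUp
            (hasTransition_config.2 ⟨k, hp, hk, rfl⟩) (hpos _).le (h0 k) (h1 k) (hlt _).le
            (fun r hr => hfree k x r hr.1 (hr.2.trans (h1 k)).le hr.2.ne)
            (fun r hr => hfree k _ r ((h0 k).trans hr.1).le hr.2 hr.1.ne'))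
        | bar =>
          rw [next_up_of_bar _ _ _ ⟨hk, hx⟩]
          exact Relation.EqvGen.rel _ _ (Step.barFromBelow
            (hasTransition_config.2 ⟨k, hp, hk, rfl⟩) (hpos _).le (h0 k) (hpos _).le (h0 k)
            (hτ.lt k).le
            (fun r hr => hfree k x r hr.1 (hr.2.trans (h1 k)).le hr.2.ne)
            (fun r hr => hfree k _ r hr.1 (hr.2.trans (h1 k)).le hr.2.ne))
      · rw [next_up_of_not_bar _ _ _ fun h => hx h.2, partner_of_notMem hx]
        exact Relation.EqvGen.rel _ _ (hvert k x hx _)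
  · induction i using Fin.cases with
    | zero => rw [next_down_zero]; exact (hwrap x _).symm
    | succ k =>
      by_cases hx : x ∈ ((lab k).1 : Sym2 V)
      · have hp := partner_spec hx
        cases hk : (lab k).2 with
        | cross =>
          rw [next_down_of_not_bar _ _ _ (by simp [hk])]
          exact Relation.EqvGen.rel _ _ (Step.crossDown
            (hasTransition_config.2 ⟨k, hp, hk, rfl⟩) (hpos _).le (h0 k) (h1 k) (hlt _).le
            (fun r hr => hfree k x r ((h0 k).trans hr.1).le hr.2 hr.1.ne')
            (fun r hr => hfree k _ r hr.1 (hr.2.trans (h1 k)).le hr.2.ne))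
        | bar =>
          rw [next_down_of_bar _ _ _ ⟨hk, hx⟩]
          exact Relation.EqvGen.rel _ _ (Step.barFromAbove
            (hasTransition_config.2 ⟨k, hp, hk, rfl⟩) (hτ.pos k).le (h1 k) (hlt _).le (h1 k)
            (hlt _).le
            (fun r hr => hfree k x r ((h0 k).trans hr.1).le hr.2 hr.1.ne')
            (fun r hr => hfree k _ r ((h0 k).trans hr.1).le hr.2 hr.1.ne'))
      · rw [next_down_of_not_bar _ _ _ fun h => hx h.2, partner_of_notMem hx]
        exact (Relation.EqvGen.rel _ _ (hvert k x hx _)).symm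

theorem sameTrajectory_of_wordOriented {p q : V × Fin (n + 1) × Dir}
    (h : WordOriented lab p q) :
    SameTrajectory β (config lab τ) (slotPoint hτ hβ p) (slotPoint hτ hβ q) :=
  Oriented.lift (r := fun p q => SameTrajectory β (config lab τ) (slotPoint hτ hβ p)
    (slotPoint hτ hβ q)) ⟨fun _ => Relation.EqvGen.refl _, fun h => h.symm,
      fun h h' => h.trans _ _ _ h'⟩ (sameTrajectory_next hτ lab hβ) h

/-- Trajectories of free points are given by the discrete word. -/
theorem sameTrajectory_config_iff {x y : V} {s t : ℝ} (d d' : Dir)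
    (hs : s ∈ Set.Icc 0 β) (ht : t ∈ Set.Icc 0 β)
    (hx : ¬ Touches (config lab τ) x s) (hy : ¬ Touches (config lab τ) y t) :
    SameTrajectory β (config lab τ) (x, s, d) (y, t, d') ↔
      WordOriented lab (x, idx τ s, d) (y, idx τ t, d') := by
  refine ⟨wordOriented_of_sameTrajectory hτ lab, fun h => ?_⟩
  exact (sameTrajectory_slotTime_idx hτ lab hβ hs.1 hs.2 hx d).trans _ _ _
    ((sameTrajectory_of_wordOriented hτ lab hβ h).trans _ _ _
      (sameTrajectory_slotTime_idx hτ lab hβ ht.1 ht.2 hy d').symm)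

end Times

/-! ### Loops of a configuration and loops of its word. -/

section Counting

omit [DecidableEq V]

/-- The points of `V × [0, β]` off the support of `ω`. -/
def IsFree (β : ℝ) (ω : Config (Transition G)) (P : V × ℝ × Dir) : Prop :=
  P.2.1 ∈ Set.Icc 0 β ∧ ¬ Touches ω P.1 P.2.1

theorem Step.isFree {β : ℝ} {ω : Config (Transition G)} (hβ : 0 ≤ β) {P Q : V × ℝ × Dir}
    (h : Step β ω P Q) : IsFree β ω P ∧ IsFree β ω Q := by
  cases h with
  | vertical d h₀ h h₁ hf =>
    exact ⟨⟨⟨h₀, h.trans h₁⟩, hf _ ⟨le_rfl, h⟩⟩, ⟨⟨h₀.trans h, h₁⟩, hf _ ⟨h, le_rfl⟩⟩⟩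
  | wrap d h₀ h₁ => exact ⟨⟨⟨hβ, le_rfl⟩, h₁⟩, ⟨⟨le_rfl, hβ⟩, h₀⟩⟩
  | crossUp ht h₀ h h' h₁ hx hy =>
    exact ⟨⟨⟨h₀, (h.trans h').le.trans h₁⟩, hx _ ⟨le_rfl, h⟩⟩,
      ⟨⟨h₀.trans (h.trans h').le, h₁⟩, hy _ ⟨h', le_rfl⟩⟩⟩
  | crossDown ht h₀ h h' h₁ hx hy =>
    exact ⟨⟨⟨h₀.trans (h.trans h').le, h₁⟩, hx _ ⟨h', le_rfl⟩⟩,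
      ⟨⟨h₀, (h.trans h').le.trans h₁⟩, hy _ ⟨le_rfl, h⟩⟩⟩
  | barFromBelow ht h₀ h h₀' h' h₁ hx hy =>
    exact ⟨⟨⟨h₀, h.le.trans h₁⟩, hx _ ⟨le_rfl, h⟩⟩, ⟨⟨h₀', h'.le.trans h₁⟩, hy _ ⟨le_rfl, h'⟩⟩⟩
  | barFromAbove ht h₀ h h₁ h' h₁' hx hy =>
    exact ⟨⟨⟨h₀.trans h.le, h₁⟩, hx _ ⟨h, le_rfl⟩⟩, ⟨⟨h₀.trans h'.le, h₁'⟩, hy _ ⟨h', le_rfl⟩⟩⟩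

/-- `EqvGen` ranges over all directed points whereas `Loops` only has free points. Moves join free
points, so freeness propagates along the chain together with the class. -/
theorem SameTrajectory.loop_eq {β : ℝ} {ω : Config (Transition G)} (hβ : 0 ≤ β)
    {P Q : V × ℝ × Dir} (h : SameTrajectory β ω P Q) :
    (IsFree β ω P ↔ IsFree β ω Q) ∧ ∀ (hP : IsFree β ω P) (hQ : IsFree β ω Q),
      (Quot.mk _ ⟨(P.1, P.2.1), hP⟩ : Loops β ω) = Quot.mk _ ⟨(Q.1, Q.2.1), hQ⟩ := by
  induction h with
  | rel P Q h =>
    have := h.isFree hβ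
    exact ⟨⟨fun _ => this.2, fun _ => this.1⟩, fun _ _ => Quot.sound ⟨P.2.2, Q.2.2, h⟩⟩
  | refl P => exact ⟨Iff.rfl, fun _ _ => rfl⟩
  | symm P Q _ ih => exact ⟨ih.1.symm, fun hP hQ => (ih.2 hQ hP).symm⟩
  | trans P Q R _ _ ih ih' =>
    exact ⟨ih.1.trans ih'.1, fun hP hR => (ih.2 hP (ih.1.1 hP)).trans (ih'.2 _ hR)⟩

end Counting

variable {τ : Fin n → ℝ} {β : ℝ} (hτ : Ordered β τ) (hβ : 0 < β) (lab : Fin n → Letter G)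

/-- The loops of a configuration are those of the discrete word. -/
def loopsEquiv : Loops β (config lab τ) ≃ Quotient (freeInvolutions (closeUp lab)).setoid where
  toFun := Quot.lift
    (fun p => Quotient.mk (freeInvolutions (closeUp lab)).setoid (p.1.1, idx τ p.1.2, Dir.up)) (by
      rintro p q ⟨d, d', h⟩
      apply Quotient.sound
      have hfree := freeInvolutions (closeUp lab)
      have := wordOriented_of_step hτ lab h
      have hd : ∀ (x : V) (i : Fin (n + 1)) (d : Dir), hfree.setoid.r (x, i, d) (x, i, Dir.up) := by
        intro x i d
        cases d
        · exact hfree.setoid.refl _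
        · exact hfree.setoid_left (x, i, Dir.up)
      exact hfree.setoid.trans (hfree.setoid.symm (hd _ _ d))
        (hfree.setoid.trans (Or.inl this) (hd _ _ d')))
  invFun := Quotient.lift (fun p => (Quot.mk _ ⟨(p.1, slotTime hτ hβ p.2.1),
      ⟨(slotTime_pos hτ hβ _).le, (slotTime_lt hτ hβ _).le⟩, not_touches_slotTime hτ lab hβ _ _⟩ :
        Loops β (config lab τ))) (by
      rintro p q (h | h)
      · exact ((sameTrajectory_of_wordOriented hτ lab hβ h).loop_eq hβ.le).2 _ _
      · exact ((sameTrajectory_of_wordOriented hτ lab hβ h).loop_eq hβ.le).2 _ _)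
  left_inv := by
    rintro ⟨p⟩
    exact (((sameTrajectory_slotTime_idx hτ lab hβ p.2.1.1 p.2.1.2 p.2.2 Dir.up).loop_eq
      hβ.le).2 p.2 ⟨⟨(slotTime_pos hτ hβ _).le, (slotTime_lt hτ hβ _).le⟩,
        not_touches_slotTime hτ lab hβ _ _⟩).symm
  right_inv := by
    rintro ⟨x, i, d⟩
    have hfree := freeInvolutions (closeUp lab)
    apply Quotient.sound
    show hfree.setoid.r (x, idx τ (slotTime hτ hβ i), Dir.up) (x, i, d)
    rw [idx_slotTime]
    cases d
    · exact hfree.setoid.refl _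
    · exact hfree.setoid.symm (hfree.setoid_left (x, i, Dir.up))

include hτ hβ in
theorem numLoops_config : numLoops β (config lab τ) =
    (freeInvolutions (closeUp lab)).numClasses :=
  Nat.card_congr (loopsEquiv hτ hβ lab)

end Words

/-! ### Time-ordered products of operators. -/

section Interleave

variable {s : Type*} [Fintype s] [DecidableEq s]

theorem sum_snoc {L A : Type*} [Fintype L] [AddCommMonoid A] {n : ℕ}
    (f : (Fin (n + 1) → L) → A) :
    ∑ p, f p = ∑ a, ∑ q : Fin n → L, f (Fin.snoc (α := fun _ => L) q a) := by
  rw [← Fintype.sum_prod_type']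
  exact (Fintype.sum_equiv (Fin.snocEquiv fun _ => L) _ _ fun _ => rfl).symm

/-- The time-ordered product of the operators `O`, with operators `h` at the time slots. -/
def interleave : {n : ℕ} → (Fin n → Matrix s s ℂ) → (Fin (n + 1) → Matrix s s ℂ) → Matrix s s ℂ
  | 0, _, h => h 0
  | n + 1, O, h => h (Fin.last _) * O (Fin.last _) *
      interleave (fun k : Fin n => O k.castSucc) (fun i => h i.castSucc)

/-- Expansion of a matrix product over paths of basis states. Later times stand on the left, so a
path starts at the column index `τ` and ends at the row index `σ`. -/
theorem interleave_diagonal {n : ℕ} (O : Fin n → Matrix s s ℂ) (d : Fin (n + 1) → s → ℂ)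
    (σ τ : s) :
    interleave O (fun i => Matrix.diagonal (d i)) σ τ =
      ∑ p : Fin (n + 1) → s, if p (Fin.last n) = σ ∧ p 0 = τ then
        (∏ i, d i (p i)) * ∏ k : Fin n, O k (p k.succ) (p k.castSucc) else 0 := by
  induction n generalizing σ τ with
  | zero =>
    rw [interleave, Matrix.diagonal_apply]
    rw [Fintype.sum_equiv (Equiv.funUnique (Fin 1) s) _
      (fun a => if a = σ ∧ a = τ then d 0 a else 0)]
    · by_cases h : σ = τ
      · subst h; simp
      · rw [if_neg h, Finset.sum_eq_zero]
        intro a _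
        rw [if_neg]
        rintro ⟨rfl, rfl⟩; exact h rfl
    · intro p; simp [Equiv.funUnique]
  | succ n ih =>
    rw [interleave, Matrix.mul_assoc, Matrix.diagonal_mul, Matrix.mul_apply, sum_snoc,
      Finset.mul_sum]
    simp_rw [ih, Finset.mul_sum]
    rw [Finset.sum_comm]
    conv_rhs => rw [Finset.sum_comm]
    refine Finset.sum_congr rfl fun q _ => ?_
    rw [Finset.sum_eq_single (q (Fin.last n))]
    · rw [Finset.sum_eq_single σ]
      · have h0 : (Fin.snoc (α := fun _ => s) q σ : Fin (n + 2) → s) 0 = q 0 :=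
          Fin.snoc_castSucc (α := fun _ => s) (x := σ) (p := q) (i := 0)
        rw [h0]
        simp only [true_and, Fin.snoc_last]
        split_ifs
        · have e₁ := Fin.prod_univ_castSucc
            (fun i : Fin (n + 2) => d i (Fin.snoc (α := fun _ => s) q σ i))
          have e₂ := Fin.prod_univ_castSucc (fun k : Fin (n + 1) =>
            O k (Fin.snoc (α := fun _ => s) q σ k.succ) (Fin.snoc (α := fun _ => s) q σ k.castSucc))
          rw [e₁, e₂]
          simp only [Fin.succ_last, Fin.succ_castSucc, Fin.snoc_castSucc, Fin.snoc_last]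
          ring
        · simp
      · intro a _ ha
        rw [if_neg]
        simp [ha]
      · simp
    · intro a _ ha
      rw [if_neg]
      · simp
      · rintro ⟨h, _⟩; exact ha h.symm
    · simp

omit [DecidableEq s] in
theorem interleave_smul {n : ℕ} (c : Fin n → ℂ) (O : Fin n → Matrix s s ℂ)
    (h : Fin (n + 1) → Matrix s s ℂ) :
    interleave (fun k => c k • O k) h = (∏ k, c k) • interleave O h := by
  induction n with
  | zero => simp [interleave]
  | succ n ih =>
    rw [interleave, interleave, ih, Fin.prod_univ_castSucc]
    simp only [Matrix.mul_smul, Matrix.smul_mul, smul_smul]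

-- Multilinearity: a product of powers of the total transition operator becomes a sum over words.
omit [DecidableEq s] in
theorem sum_interleave {L : Type*} [Fintype L] (O : L → Matrix s s ℂ) {n : ℕ}
    (h : Fin (n + 1) → Matrix s s ℂ) :
    ∑ lab : Fin n → L, interleave (fun k => O (lab k)) h =
      interleave (fun _ => ∑ l, O l) h := by
  induction n with
  | zero => simp [interleave]
  | succ n ih =>
    rw [sum_snoc]
    simp only [interleave, Fin.snoc_last, Fin.snoc_castSucc]
    simp_rw [← Finset.mul_sum, ih, ← Finset.sum_mul, ← Finset.mul_sum]

theorem interleave_one (K : Matrix s s ℂ) (n : ℕ) :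
    interleave (fun _ : Fin n => K) (fun _ => 1) = K ^ n := by
  induction n with
  | zero => simp [interleave]
  | succ n ih => rw [interleave, ih, Matrix.one_mul, pow_succ']

theorem interleave_insert (K B : Matrix s s ℂ) {n : ℕ} (k : Fin (n + 1)) :
    interleave (fun _ : Fin n => K) (fun i => if i = k then B else 1) =
      K ^ (n - k) * B * K ^ (k : ℕ) := by
  induction n with
  | zero =>
    have : k = 0 := Fin.eq_zero k
    subst this
    simp [interleave]
  | succ n ih =>
    rw [interleave]
    induction k using Fin.lastCases with
    | last =>
      have : ∀ i : Fin (n + 1), i.castSucc ≠ Fin.last (n + 1) := fun i => (Fin.castSucc_lt_last i).ne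
      simp only [if_true, this, if_false, interleave_one]
      simp [pow_succ', Matrix.mul_assoc]
    | cast k =>
      have : Fin.last (n + 1) ≠ k.castSucc := (Fin.castSucc_lt_last k).ne'
      simp only [this, if_false, Fin.castSucc_inj, ih]
      have e : n + 1 - (k.castSucc : ℕ) = n - k + 1 := by simp; omega
      rw [e, pow_succ']
      simp [Matrix.mul_assoc]

/-- The factors `D` commute through the slots and cancel in pairs between consecutive letters; only
the outer two survive. -/
theorem interleave_conj {n : ℕ} {D : Matrix s s ℂ} (hD : D * D = 1) (O : Fin n → Matrix s s ℂ)
    {h : Fin (n + 1) → Matrix s s ℂ} (hh : ∀ i, D * h i = h i * D) :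
    interleave (fun k => D * O k * D) h = D * interleave O h * D := by
  induction n with
  | zero => rw [interleave, interleave, hh, Matrix.mul_assoc, hD, Matrix.mul_one]
  | succ n ih =>
    rw [interleave, interleave, ih _ fun i => hh i.castSucc]
    have e : ∀ Y : Matrix s s ℂ, D * (D * Y) = Y := fun Y => by
      rw [← Matrix.mul_assoc, hD, Matrix.one_mul]
    have e' : ∀ Y : Matrix s s ℂ, h (Fin.last (n + 1)) * (D * Y) =
        D * (h (Fin.last (n + 1)) * Y) := fun Y => by
      rw [← Matrix.mul_assoc, ← hh, Matrix.mul_assoc]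
    simp only [Matrix.mul_assoc, e, e']

end Interleave

/-! ### The trace of a word as a sum over compatible spin configurations. -/

section Operators

instance : Finite Dir := Finite.of_injective (fun d : Dir => match d with
  | Dir.up => true
  | Dir.down => false) (by intro a b; cases a <;> cases b <;> simp)

variable {V : Type*} [Fintype V] [DecidableEq V] {G : SimpleGraph V} {S : ℕ}

theorem mag_rev (a : Fin (2 * S + 1)) : mag S a.rev = -mag S a := by
  simp only [mag, Fin.val_rev]
  have := a.2
  omega

theorem mag_injective : Function.Injective (mag S) := fun a b h => by
  simp only [mag] at h
  ext; omega

theorem mag_eq_neg_iff {a b : Fin (2 * S + 1)} : mag S a = -mag S b ↔ b = a.rev := by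
  constructor
  · intro h; apply mag_injective; rw [mag_rev, h, neg_neg]
  · rintro rfl; rw [mag_rev, neg_neg]

/-- A sign whose product at opposite spin values is `(-1) ^ a`. -/
def gauge (a : Fin (2 * S + 1)) : ℂ := if 0 < mag S a then (-1) ^ mag S a else 1

theorem neg_one_zpow_mul_self (k : ℤ) : (-1 : ℂ) ^ k * (-1) ^ k = 1 := by
  rw [← mul_zpow]; simp

theorem neg_one_zpow_neg (k : ℤ) : (-1 : ℂ) ^ (-k) = (-1) ^ k := by
  rw [zpow_neg, ← inv_zpow]; norm_num

theorem gauge_mul_self (a : Fin (2 * S + 1)) : gauge a * gauge a = 1 := by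
  unfold gauge
  split_ifs
  · exact neg_one_zpow_mul_self _
  · simp

/-- Of two opposite nonzero spins exactly one is positive, and it carries the whole sign. -/
theorem gauge_mul_rev (a : Fin (2 * S + 1)) : gauge a * gauge a.rev = (-1) ^ mag S a := by
  unfold gauge
  rw [mag_rev]
  rcases lt_trichotomy (mag S a) 0 with h | h | h
  · rw [if_neg h.not_gt, if_pos (by omega), one_mul, neg_one_zpow_neg]
  · simp [h]
  · rw [if_pos h, if_neg (by omega), mul_one]

/-- The sign of `P` factors over the four spins, so a diagonal conjugation can remove it. -/
theorem singletCoeff_eq (a b c d : Fin (2 * S + 1)) :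
    singletCoeff S a b c d =
      if b = a.rev ∧ d = c.rev then gauge a * gauge b * (gauge c * gauge d) else 0 := by
  unfold singletCoeff
  simp only [mag_eq_neg_iff]
  split_ifs with h
  · rw [h.1, h.2, gauge_mul_rev, gauge_mul_rev, ← neg_one_zpow_neg (mag S c),
      ← zpow_add₀ (by norm_num), sub_eq_add_neg]
  · rfl

/-- The product of the gauge signs over the sites. -/
def gaugeProd (σ : V → Fin (2 * S + 1)) : ℂ := ∏ z, gauge (σ z)

omit [DecidableEq V] in
theorem gaugeProd_mul_self (σ : V → Fin (2 * S + 1)) : gaugeProd σ * gaugeProd σ = 1 := by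
  rw [gaugeProd, ← Finset.prod_mul_distrib]
  exact Finset.prod_eq_one fun z _ => gauge_mul_self _

/-- Compatibility of the spins above and below a transition. -/
def Compatible (l : Option (Letter G)) (σ τ : V → Fin (2 * S + 1)) : Prop :=
  ∀ x, (IsBar l x → σ (partnerOpt l x) = (σ x).rev ∧ τ (partnerOpt l x) = (τ x).rev) ∧
    (¬ IsBar l x → σ (partnerOpt l x) = τ x)

/-- The operator of a transition. -/
def letterOp (S : ℕ) (l : Letter G) : Op V S :=
  match l.2 with
  | Kind.cross => edgeT S (l.1 : Sym2 V)
  | Kind.bar => edgeP S (l.1 : Sym2 V)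

open Classical in
/-- The operator of a transition without the signs. -/
def compatibleOp (S : ℕ) (l : Letter G) : Op V S :=
  Matrix.of fun σ τ => if Compatible (some l) σ τ then 1 else 0

omit [Fintype V] in
theorem compatible_cross {a b : V} (h : s(a, b) ∈ G.edgeSet) (σ τ : V → Fin (2 * S + 1)) :
    Compatible (G := G) (some (⟨s(a, b), h⟩, Kind.cross)) σ τ ↔ σ ∘ Equiv.swap a b = τ := by
  simp only [Compatible, IsBar, partnerOpt, partner_mk, funext_iff, Function.comp]
  simp

omit [Fintype V] in
theorem compatible_bar {a b : V} (h : s(a, b) ∈ G.edgeSet) (σ τ : V → Fin (2 * S + 1)) :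
    Compatible (G := G) (some (⟨s(a, b), h⟩, Kind.bar)) σ τ ↔
      (∀ z, z ≠ a → z ≠ b → σ z = τ z) ∧ σ b = (σ a).rev ∧ τ b = (τ a).rev := by
  simp only [Compatible, IsBar, partnerOpt, partner_mk, Sym2.mem_iff, true_and]
  constructor
  · intro H
    refine ⟨fun z ha hb => ?_, by simpa using (H a).1 (Or.inl rfl)⟩
    have := (H z).2 (by simp [ha, hb])
    rwa [Equiv.swap_apply_of_ne_of_ne ha hb] at this
  · rintro ⟨H, h1, h2⟩ z
    refine ⟨?_, fun hz => ?_⟩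
    · rintro (rfl | rfl)
      · simp [h1, h2]
      · simp [h1, h2, Fin.rev_rev]
    · rw [not_or] at hz
      rw [Equiv.swap_apply_of_ne_of_ne hz.1 hz.2]
      exact H z hz.1 hz.2

omit [DecidableEq V] in
theorem gaugeProd_comp_perm (σ : V → Fin (2 * S + 1)) (π : Equiv.Perm V) :
    gaugeProd (σ ∘ π) = gaugeProd σ :=
  Equiv.prod_comp π fun z => gauge (σ z)

/-- For a cross, `gaugeProd` is invariant under permutation of sites and its two occurrences cancel.
For a bar, the unaffected sites cancel pairwise and the four gauges at the edge give the sign of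
`P`. -/
theorem letterOp_apply (l : Letter G) (σ τ : V → Fin (2 * S + 1)) :
    letterOp S l σ τ = gaugeProd σ * compatibleOp S l σ τ * gaugeProd τ := by
  classical
  obtain ⟨⟨e, he⟩, k⟩ := l
  induction e with | _ a b =>
  have hab : a ≠ b := (G.mem_edgeSet.1 he).ne
  cases k with
  | cross =>
    show bondOp a b (transpositionCoeff S) σ τ = _
    simp only [bondOp, compatibleOp, Matrix.of_apply, compatible_cross, transpositionCoeff]
    by_cases H : σ ∘ Equiv.swap a b = τ
    · have h1 : ∀ z, z ≠ a → z ≠ b → σ z = τ z := fun z ha hb => by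
        rw [← H]; simp [Equiv.swap_apply_of_ne_of_ne ha hb]
      have h2 : σ a = τ b ∧ σ b = τ a := by rw [← H]; simp
      rw [if_pos h1, if_pos h2, if_pos H, ← H, gaugeProd_comp_perm, mul_one, gaugeProd_mul_self]
    · rw [if_neg H, mul_zero, zero_mul]
      split_ifs with h1 h2
      · exfalso
        apply H
        funext z
        by_cases ha : z = a
        · subst ha; simpa using h2.2
        by_cases hb : z = b
        · subst hb; simpa using h2.1
        simpa [Equiv.swap_apply_of_ne_of_ne ha hb] using h1 z ha hb
      · rfl
      · rfl
  | bar =>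
    show bondOp a b (singletCoeff S) σ τ = _
    simp only [bondOp, compatibleOp, Matrix.of_apply, compatible_bar, singletCoeff_eq]
    by_cases h1 : ∀ z, z ≠ a → z ≠ b → σ z = τ z
    · by_cases h2 : σ b = (σ a).rev ∧ τ b = (τ a).rev
      · rw [if_pos h1, if_pos h2, if_pos ⟨h1, h2⟩, mul_one, gaugeProd, gaugeProd,
          ← Finset.prod_mul_distrib, ← Finset.mul_prod_erase _ _ (Finset.mem_univ a),
          ← Finset.mul_prod_erase _ _ (Finset.mem_erase.2 ⟨hab.symm, Finset.mem_univ b⟩),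
          Finset.prod_eq_one]
        · ring
        · intro z hz
          simp only [Finset.mem_erase, Finset.mem_univ, and_true] at hz
          rw [h1 z hz.2 hz.1, gauge_mul_self]
      · rw [if_pos h1, if_neg h2, if_neg fun h => h2 h.2, mul_zero, zero_mul]
    · rw [if_neg h1, if_neg fun h => h1 h.1, mul_zero, zero_mul]

theorem letterOp_eq (l : Letter G) :
    letterOp S l = Matrix.diagonal gaugeProd * compatibleOp S l * Matrix.diagonal gaugeProd := by
  ext σ τ
  rw [letterOp_apply, Matrix.mul_diagonal, Matrix.diagonal_mul]

theorem siteOp_diagonal (x : V) (f : Fin (2 * S + 1) → ℂ) :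
    siteOp x (Matrix.diagonal f) = Matrix.diagonal fun σ => f (σ x) := by
  ext σ τ
  simp only [siteOp, Matrix.of_apply, Matrix.diagonal_apply]
  by_cases h : σ = τ
  · subst h; simp
  · rw [if_neg h]
    split_ifs with h1 h2
    · exact (h (funext fun z => if hz : z = x then hz ▸ h2 else h1 z hz)).elim
    · rfl
    · rfl

variable {n : ℕ}

/-- Compatible space-time spin configurations are the odd functions on the endpoints of the
vertical segments. -/
def compatibleEquiv (w : Fin (n + 1) → Option (Letter G)) :
    {p : Fin (n + 1) → V → Fin (2 * S + 1) // ∀ i, Compatible (w i) (p (i + 1)) (p i)} ≃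
      {s : V × Fin (n + 1) × Dir → Fin (2 * S + 1) //
        FreeInvolutions.Odd (reversal V n) (jump w) Fin.rev s} where
  -- A top end carries the spin of its segment and a bottom end the opposite spin. Oddness under
  -- `reversal` is then automatic, and oddness under `jump` is exactly compatibility.
  toFun p := ⟨fun q => match q with
      | (x, i, Dir.up) => p.1 i x
      | (x, i, Dir.down) => (p.1 i x).rev, by
    constructor
    · rintro ⟨x, i, d | d⟩
      · rfl
      · exact (Fin.rev_rev _).symm
    · rintro ⟨x, i, d | d⟩
      · show (match jumpFun w (x, i, Dir.up) with
          | (x, i, Dir.up) => p.1 i x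
          | (x, i, Dir.down) => (p.1 i x).rev) = _
        by_cases h : IsBar (w i) x
        · simp only [jumpFun, if_pos h]
          exact ((p.2 i x).1 h).2
        · simp only [jumpFun, if_neg h]
          rw [(p.2 i x).2 h]
      · show (match jumpFun w (x, i, Dir.down) with
          | (x, i, Dir.up) => p.1 i x
          | (x, i, Dir.down) => (p.1 i x).rev) = _
        have hp := p.2 (i - 1)
        rw [sub_add_cancel] at hp
        by_cases h : IsBar (w (i - 1)) x
        · simp only [jumpFun, if_pos h]
          rw [((hp x).1 h).1]
        · simp only [jumpFun, if_neg h]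
          rw [← (hp _).2 (isBar_partnerOpt.not.2 h), partnerOpt_partnerOpt, Fin.rev_rev]⟩
  invFun s := ⟨fun i x => s.1 (x, i, Dir.up), by
    intro i x
    have hup := s.2.2 (x, i, Dir.up)
    have hdown := s.2.2 (x, i + 1, Dir.down)
    have hrev := fun (x : V) (j : Fin (n + 1)) => s.2.1 (x, j, Dir.up)
    change ∀ (x : V) (j : Fin (n + 1)), s.1 (x, j, Dir.down) = (s.1 (x, j, Dir.up)).rev at hrev
    change s.1 (jumpFun w (x, i, Dir.up)) = _ at hup
    change s.1 (jumpFun w (x, i + 1, Dir.down)) = _ at hdown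
    simp only [jumpFun] at hup hdown
    rw [add_sub_cancel_right] at hdown
    constructor
    · intro h
      rw [if_pos h] at hup hdown
      rw [hrev, hrev, Fin.rev_inj] at hdown
      exact ⟨hdown, hup⟩
    · intro h
      rw [if_neg h] at hup
      rwa [hrev, Fin.rev_inj] at hup⟩
  left_inv p := rfl
  right_inv s := by
    ext ⟨x, i, d | d⟩
    · rfl
    · exact congrArg Fin.val (s.2.1 (x, i, Dir.up)).symm

-- The `none` at the end of the period encodes the periodicity that the trace imposes.
omit [Fintype V] in
theorem forall_compatible_closeUp (lab : Fin n → Letter G)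
    (p : Fin (n + 1) → V → Fin (2 * S + 1)) :
    (∀ i, Compatible (closeUp lab i) (p (i + 1)) (p i)) ↔
      p (Fin.last n) = p 0 ∧ ∀ k : Fin n, Compatible (some (lab k)) (p k.succ) (p k.castSucc) := by
  constructor
  · intro h
    refine ⟨?_, fun k => ?_⟩
    · have := h (Fin.last n)
      rw [closeUp_last, Fin.last_add_one] at this
      exact funext fun x => ((this x).2 id).symm
    · have := h k.castSucc
      rwa [closeUp_castSucc, castSucc_add_one] at this
  · rintro ⟨h, h'⟩ i
    induction i using Fin.lastCases with
    | last =>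
      rw [closeUp_last, Fin.last_add_one]
      exact fun x => ⟨fun hx => hx.elim, fun _ => by rw [h]; rfl⟩
    | cast k => rw [closeUp_castSucc, castSucc_add_one]; exact h' k

/-- The link between operators and loops. The gauge signs disappear, the path expansion keeps the
compatible periodic paths with weight one, and these are the odd functions. Only diagonal
observables are allowed because they must commute with the gauge. -/
theorem trace_interleave (lab : Fin n → Letter G) (x y : V) (k : Fin (n + 1))
    (f g : Fin (2 * S + 1) → ℂ)
    [Fintype {s : V × Fin (n + 1) × Dir → Fin (2 * S + 1) //
        FreeInvolutions.Odd (reversal V n) (jump (closeUp lab)) Fin.rev s}] :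
    (siteOp x (Matrix.diagonal f) * interleave (fun j => letterOp S (lab j))
      (fun i => if i = k then siteOp y (Matrix.diagonal g) else 1)).trace =
      ∑ s : {s : V × Fin (n + 1) × Dir → Fin (2 * S + 1) //
        FreeInvolutions.Odd (reversal V n) (jump (closeUp lab)) Fin.rev s},
        f (s.1 (x, 0, Dir.up)) * g (s.1 (y, k, Dir.up)) := by
  classical
  have hD : (Matrix.diagonal gaugeProd : Op V S) * Matrix.diagonal gaugeProd = 1 := by
    rw [Matrix.diagonal_mul_diagonal, ← Matrix.diagonal_one]
    congr 1; funext σ; exact gaugeProd_mul_self σ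
  have hins : (fun i : Fin (n + 1) => if i = k then siteOp y (Matrix.diagonal g) else (1 : Op V S)) =
      fun i => Matrix.diagonal (fun σ => if i = k then g (σ y) else 1) := by
    funext i
    split_ifs
    · exact siteOp_diagonal y g
    · exact Matrix.diagonal_one.symm
  simp_rw [letterOp_eq]
  rw [hins, interleave_conj hD _ fun i => by
    rw [Matrix.diagonal_mul_diagonal, Matrix.diagonal_mul_diagonal]
    congr 1; funext σ; ring]
  -- Cyclicity of the trace brings the right-hand gauge matrix to the left, where the two gauges
  -- cancel around the diagonal observable.
  rw [siteOp_diagonal, Matrix.mul_assoc, ← Matrix.mul_assoc, ← Matrix.mul_assoc,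
    Matrix.trace_mul_comm, Matrix.mul_assoc, ← Matrix.mul_assoc _ (Matrix.diagonal gaugeProd),
    ← Matrix.mul_assoc]
  have : (Matrix.diagonal gaugeProd : Op V S) * (Matrix.diagonal (fun σ => f (σ x)) *
      Matrix.diagonal gaugeProd) = Matrix.diagonal (fun σ => f (σ x)) := by
    simp only [Matrix.diagonal_mul_diagonal]
    congr 1; funext σ
    rw [mul_comm (f _), ← mul_assoc, gaugeProd_mul_self, one_mul]
  rw [this, Matrix.trace]
  simp only [Matrix.diag_apply, Matrix.diagonal_mul, interleave_diagonal, Finset.mul_sum]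
  rw [Finset.sum_comm]
  have key : ∀ p : Fin (n + 1) → V → Fin (2 * S + 1),
      (∑ σ : V → Fin (2 * S + 1), f (σ x) * if p (Fin.last n) = σ ∧ p 0 = σ then
        (∏ i, if i = k then g (p i y) else 1) *
          ∏ k : Fin n, compatibleOp S (lab k) (p k.succ) (p k.castSucc) else 0) =
      if ∀ i, Compatible (closeUp lab i) (p (i + 1)) (p i) then f (p 0 x) * g (p k y) else 0 := by
    intro p
    rw [Finset.sum_eq_single (p 0)]
    · simp only [forall_compatible_closeUp, compatibleOp, Matrix.of_apply, and_true]
      rw [Finset.prod_ite_eq' Finset.univ k, if_pos (Finset.mem_univ k), Finset.prod_ite_zero]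
      by_cases h1 : p (Fin.last n) = p 0
      · simp [h1]
      · simp [h1]
    · intro σ _ hσ
      rw [if_neg fun h => hσ h.2.symm, mul_zero]
    · simp
  rw [Finset.sum_congr rfl fun p _ => key p, ← Finset.sum_filter, ← Finset.sum_subtype_eq_sum_filter]
  rw [Finset.subtype_univ]
  exact Fintype.sum_equiv (compatibleEquiv (closeUp lab)) _ _ fun p => rfl

end Operators

/-! ### Spin rotation symmetry. -/

section Rotation

variable {S : ℕ}

theorem raising_apply (j k : Fin (2 * S + 1)) : raising S j k =
    if mag S j = mag S k + 1 then
      ((Real.sqrt ((S : ℝ) * (S + 1) - (mag S k : ℝ) * (mag S k + 1)) : ℝ) : ℂ) else 0 := rfl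

theorem raising_conjTranspose_apply (j k : Fin (2 * S + 1)) :
    (raising S).conjTranspose j k = if mag S k = mag S j + 1 then
      ((Real.sqrt ((S : ℝ) * (S + 1) - (mag S j : ℝ) * (mag S j + 1)) : ℝ) : ℂ) else 0 := by
  rw [Matrix.conjTranspose_apply, raising_apply]
  split_ifs
  · exact Complex.conj_ofReal _
  · simp

theorem mag_abs_le (k : Fin (2 * S + 1)) : -(S : ℤ) ≤ mag S k ∧ mag S k ≤ S := by
  simp only [mag]; omega

theorem exists_mag {a : ℤ} (h : -(S : ℤ) ≤ a) (h' : a ≤ S) : ∃ k : Fin (2 * S + 1), mag S k = a :=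
  ⟨⟨(a + S).toNat, by omega⟩, by simp only [mag]; omega⟩

theorem mul_succ_le (a : ℤ) (h : -(S : ℤ) ≤ a + 1) (h' : a ≤ S) :
    0 ≤ (S : ℝ) * (S + 1) - (a : ℝ) * (a + 1) := by
  -- `S(S+1) - a(a+1) = (S-a)(S+a+1)`.
  have h1 : (0 : ℤ) ≤ (S - a) * (S + a + 1) := mul_nonneg (by omega) (by omega)
  have h2 : (0 : ℝ) ≤ ((S - a) * (S + a + 1) : ℤ) := by exact_mod_cast h1
  push_cast at h2
  nlinarith

/-- Only one intermediate state contributes, the one with spin lower by one. At the lowest spin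
there is none, and the claimed diagonal entry vanishes there. -/
theorem raising_mul_conjTranspose :
    raising S * (raising S).conjTranspose = Matrix.diagonal fun k =>
      (((S : ℝ) * (S + 1) - (mag S k : ℝ) * (mag S k - 1) : ℝ) : ℂ) := by
  ext j k
  rw [Matrix.mul_apply, Matrix.diagonal_apply]
  simp only [raising_apply, raising_conjTranspose_apply]
  split_ifs with h
  · subst h
    by_cases hj : -(S : ℤ) ≤ mag S j - 1
    · obtain ⟨l, hl⟩ := exists_mag hj (by have := mag_abs_le j; omega)
      rw [Finset.sum_eq_single l]
      · rw [if_pos (by omega), ← Complex.ofReal_mul, Real.mul_self_sqrt, hl]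
        · push_cast; ring
        · apply mul_succ_le
          · have := mag_abs_le l; omega
          · have := mag_abs_le l; omega
      · intro m _ hm
        rw [if_neg, zero_mul]
        intro h
        exact hm (mag_injective (by omega))
      · simp
    · rw [Finset.sum_eq_zero]
      · have : mag S j = -S := by have := mag_abs_le j; omega
        rw [this]; push_cast; ring
      · intro m _
        rw [if_neg, zero_mul]
        have := mag_abs_le m
        omega
  · rw [Finset.sum_eq_zero]
    intro m _
    by_cases h1 : mag S j = mag S m + 1
    · rw [if_neg (c := mag S k = mag S m + 1), mul_zero]
      intro h2
      exact h (mag_injective (by omega))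
    · rw [if_neg h1, zero_mul]

theorem conjTranspose_mul_raising :
    (raising S).conjTranspose * raising S = Matrix.diagonal fun k =>
      (((S : ℝ) * (S + 1) - (mag S k : ℝ) * (mag S k + 1) : ℝ) : ℂ) := by
  ext j k
  rw [Matrix.mul_apply, Matrix.diagonal_apply]
  simp only [raising_apply, raising_conjTranspose_apply]
  split_ifs with h
  · subst h
    by_cases hj : mag S j + 1 ≤ S
    · obtain ⟨l, hl⟩ := exists_mag (by have := mag_abs_le j; omega) hj
      rw [Finset.sum_eq_single l]
      · rw [if_pos (by omega), ← Complex.ofReal_mul, Real.mul_self_sqrt]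
        apply mul_succ_le
        · have := mag_abs_le j; omega
        · have := mag_abs_le j; omega
      · intro m _ hm
        rw [if_neg, zero_mul]
        intro h
        exact hm (mag_injective (by omega))
      · simp
    · rw [Finset.sum_eq_zero]
      · have : mag S j = S := by have := mag_abs_le j; omega
        rw [this]; push_cast; ring
      · intro m _
        rw [if_neg, zero_mul]
        have := mag_abs_le m
        omega
  · rw [Finset.sum_eq_zero]
    intro m _
    by_cases h1 : mag S m = mag S j + 1
    · rw [if_neg (c := mag S m = mag S k + 1), mul_zero]
      intro h2
      exact h (mag_injective (by omega))
    · rw [if_neg h1, zero_mul]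

/-- The operator `S³`. -/
def spinZ (S : ℕ) : Matrix (Fin (2 * S + 1)) (Fin (2 * S + 1)) ℂ :=
  Matrix.diagonal fun k => (mag S k : ℂ)

theorem raising_commutator : raising S * (raising S).conjTranspose -
    (raising S).conjTranspose * raising S = (2 : ℂ) • spinZ S := by
  rw [raising_mul_conjTranspose, conjTranspose_mul_raising, Matrix.diagonal_sub, spinZ,
    ← Matrix.diagonal_smul]
  congr 1; funext k
  simp only [Pi.smul_apply, smul_eq_mul]
  push_cast; ring

theorem spinZ_mul_raising : spinZ S * raising S - raising S * spinZ S = raising S := by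
  ext j k
  rw [Matrix.sub_apply, spinZ, Matrix.diagonal_mul, Matrix.mul_diagonal, raising_apply]
  split_ifs with h
  · rw [h]; push_cast; ring
  · simp

theorem spinZ_mul_conjTranspose : spinZ S * (raising S).conjTranspose -
    (raising S).conjTranspose * spinZ S = -(raising S).conjTranspose := by
  ext j k
  rw [Matrix.sub_apply, spinZ, Matrix.diagonal_mul, Matrix.mul_diagonal, Matrix.neg_apply,
    raising_conjTranspose_apply]
  split_ifs with h
  · rw [h]; push_cast; ring
  · simp

theorem spin_zero : spin S 0 = (1 / 2 : ℂ) • (raising S + (raising S).conjTranspose) := rfl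

theorem spin_one :
    spin S 1 = (1 / (2 * Complex.I) : ℂ) • (raising S - (raising S).conjTranspose) := rfl

theorem spin_two : spin S 2 = spinZ S := rfl

/-- `[J, Z] = c W` and `[J, W] = -c Z`: infinitesimal rotations generated by `J`. -/
structure Rotates {A : Type*} [Ring A] [Module ℂ A] (c : ℂ) (J Z W : A) : Prop where
  ne_zero : c ≠ 0
  left : J * Z - Z * J = c • W
  right : J * W - W * J = -c • Z

theorem rotates_one : Rotates Complex.I (spin S 1) (spin S 2) (spin S 0) where
  ne_zero := Complex.I_ne_zero
  left := by
    have h1 := spinZ_mul_raising (S := S)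
    have h2 := spinZ_mul_conjTranspose (S := S)
    have : spin S 1 * spin S 2 - spin S 2 * spin S 1 = (1 / (2 * Complex.I) : ℂ) •
      (-(spinZ S * raising S - raising S * spinZ S) +
        (spinZ S * (raising S).conjTranspose - (raising S).conjTranspose * spinZ S)) := by
      rw [spin_one, spin_two]
      simp only [Matrix.smul_mul, Matrix.mul_smul, Matrix.sub_mul, Matrix.mul_sub]
      module
    rw [this, h1, h2, spin_zero, smul_smul, ← neg_add, smul_neg, ← neg_smul]
    congr 1
    field_simp
    simp
  right := by
    have h := raising_commutator (S := S)
    have : spin S 1 * spin S 0 - spin S 0 * spin S 1 = (1 / (2 * Complex.I) : ℂ) •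
      (raising S * (raising S).conjTranspose - (raising S).conjTranspose * raising S) := by
      rw [spin_one, spin_zero]
      simp only [Matrix.smul_mul, Matrix.mul_smul, Matrix.sub_mul, Matrix.mul_sub, Matrix.add_mul,
        Matrix.mul_add]
      module
    rw [this, h, spin_two, smul_smul]
    congr 1
    field_simp
    simp

theorem rotates_zero : Rotates (-Complex.I) (spin S 0) (spin S 2) (spin S 1) where
  ne_zero := neg_ne_zero.2 Complex.I_ne_zero
  left := by
    have h1 := spinZ_mul_raising (S := S)
    have h2 := spinZ_mul_conjTranspose (S := S)
    have : spin S 0 * spin S 2 - spin S 2 * spin S 0 = (1 / 2 : ℂ) •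
      (-(spinZ S * raising S - raising S * spinZ S) -
        (spinZ S * (raising S).conjTranspose - (raising S).conjTranspose * spinZ S)) := by
      rw [spin_zero, spin_two]
      simp only [Matrix.smul_mul, Matrix.mul_smul, Matrix.add_mul, Matrix.mul_add]
      module
    rw [this, h1, h2, spin_one, smul_smul]
    have e : -Complex.I * (1 / (2 * Complex.I)) = -(1 / 2) := by field_simp
    rw [e]
    module
  right := by
    have h := raising_commutator (S := S)
    have : spin S 0 * spin S 1 - spin S 1 * spin S 0 = (-1 / (2 * Complex.I) : ℂ) •
      (raising S * (raising S).conjTranspose - (raising S).conjTranspose * raising S) := by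
      rw [spin_one, spin_zero]
      simp only [Matrix.smul_mul, Matrix.mul_smul, Matrix.sub_mul, Matrix.mul_sub, Matrix.add_mul,
        Matrix.mul_add]
      module
    rw [this, h, spin_two, smul_smul]
    congr 1
    field_simp
    simp

/-! ### Consequences of invariance under an infinitesimal rotation. -/

section Invariance

variable {A : Type*} [Ring A] [Algebra ℂ A] {c : ℂ} {J Z W : A}

theorem Rotates.sq_left (h : Rotates c J Z W) :
    J * (Z * Z) - Z * Z * J = c • (Z * W + W * Z) := by
  have : J * (Z * Z) - Z * Z * J = (J * Z - Z * J) * Z + Z * (J * Z - Z * J) := by noncomm_ring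
  rw [this, h.left, smul_mul_assoc, mul_smul_comm, ← smul_add, add_comm]

theorem Rotates.sq_right (h : Rotates c J Z W) :
    J * (W * W) - W * W * J = -c • (Z * W + W * Z) := by
  have : J * (W * W) - W * W * J = (J * W - W * J) * W + W * (J * W - W * J) := by noncomm_ring
  rw [this, h.right, smul_mul_assoc, mul_smul_comm, ← smul_add]

theorem Rotates.mixed (h : Rotates c J Z W) :
    J * (Z * W + W * Z) - (Z * W + W * Z) * J = (2 * c) • (W * W - Z * Z) := by
  have : J * (Z * W + W * Z) - (Z * W + W * Z) * J =
      (J * Z - Z * J) * W + Z * (J * W - W * J) + (J * W - W * J) * Z + W * (J * Z - Z * J) := by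
    noncomm_ring
  rw [this, h.left, h.right]
  simp only [smul_mul_assoc, mul_smul_comm]
  module

/-- `W² - Z²` is a multiple of the commutator of `J` with `ZW + WZ`. -/
theorem Rotates.linear_eq (h : Rotates c J Z W) (E : A →ₗ[ℂ] ℂ)
    (hE : ∀ X, E (J * X - X * J) = 0) : E (W * W) = E (Z * Z) := by
  have := hE (Z * W + W * Z)
  rw [h.mixed, map_smul, map_sub, smul_eq_mul, mul_eq_zero] at this
  exact sub_eq_zero.1 (this.resolve_left (mul_ne_zero two_ne_zero h.ne_zero))

/-- Invariance applied to the pair `(Z, W)`. -/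
theorem Rotates.bilinear_eq (h : Rotates c J Z W) (C : A →ₗ[ℂ] A →ₗ[ℂ] ℂ)
    (hC : ∀ X Y, C (J * X - X * J) Y + C X (J * Y - Y * J) = 0) : C W W = C Z Z := by
  have := hC Z W
  rw [h.left, h.right] at this
  simp only [map_smul, LinearMap.smul_apply, smul_eq_mul] at this
  apply mul_left_cancel₀ h.ne_zero
  linear_combination this

/-- With `M = ZW + WZ`, invariance is used for `(Z², M)` and `(M, W²)`. On adding, both `C M M` and
`C Z² W²` cancel; `C` need not be symmetric. -/
theorem Rotates.bilinear_sq_eq (h : Rotates c J Z W) (C : A →ₗ[ℂ] A →ₗ[ℂ] ℂ)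
    (hC : ∀ X Y, C (J * X - X * J) Y + C X (J * Y - Y * J) = 0) :
    C (W * W) (W * W) = C (Z * Z) (Z * Z) := by
  have h1 := hC (Z * Z) (Z * W + W * Z)
  have h2 := hC (Z * W + W * Z) (W * W)
  rw [h.sq_left, h.mixed] at h1
  rw [h.sq_right, h.mixed] at h2
  generalize Z * W + W * Z = M at h1 h2
  simp only [map_smul, map_sub, LinearMap.smul_apply, LinearMap.sub_apply, smul_eq_mul] at h1 h2
  apply mul_left_cancel₀ (mul_ne_zero two_ne_zero h.ne_zero)
  linear_combination h1 + h2

end Invariance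

/-- The relation between the matrix elements at opposite spins for which the singlet is
annihilated by the total spin. -/
def AnnihilatesSinglet (X : Matrix (Fin (2 * S + 1)) (Fin (2 * S + 1)) ℂ) : Prop :=
  ∀ a b, X a b.rev * (-1) ^ mag S b + X b a.rev * (-1) ^ mag S a = 0

/-- The elements can be nonzero only if the spins `a` and `b` add up to one; then both square roots
agree while the signs `(-1) ^ a` and `(-1) ^ b` are opposite. -/
theorem annihilatesSinglet_raising : AnnihilatesSinglet (raising S) := by
  intro a b
  simp only [raising_apply, mag_rev]
  by_cases h : mag S a + mag S b = 1
  · rw [if_pos (by omega), if_pos (by omega)]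
    have e : mag S b = 1 + -mag S a := by omega
    have e2 : (-1 : ℂ) ^ (1 + -mag S a) = -(-1) ^ mag S a := by
      rw [zpow_add₀ (by norm_num), neg_one_zpow_neg]; simp
    rw [e, e2]
    push_cast
    have e3 : (S : ℝ) * (S + 1) - -(1 + -(mag S a : ℝ)) * (-(1 + -(mag S a : ℝ)) + 1) =
      (S : ℝ) * (S + 1) - -(mag S a : ℝ) * (-(mag S a : ℝ) + 1) := by ring
    rw [e3]; ring
  · rw [if_neg (by omega), if_neg (by omega)]; ring

theorem annihilatesSinglet_conjTranspose : AnnihilatesSinglet (raising S).conjTranspose := by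
  intro a b
  simp only [raising_conjTranspose_apply, mag_rev]
  by_cases h : mag S a + mag S b = -1
  · rw [if_pos (by omega), if_pos (by omega)]
    have e : mag S b = -1 + -mag S a := by omega
    have e2 : (-1 : ℂ) ^ (-1 + -mag S a) = -(-1) ^ mag S a := by
      rw [zpow_add₀ (by norm_num), neg_one_zpow_neg (mag S a)]; simp
    rw [e, e2]
    push_cast
    have e3 : (S : ℝ) * (S + 1) - (-1 + -(mag S a : ℝ)) * (-1 + -(mag S a : ℝ) + 1) =
      (S : ℝ) * (S + 1) - (mag S a : ℝ) * ((mag S a : ℝ) + 1) := by ring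
    rw [e3]; ring
  · rw [if_neg (by omega), if_neg (by omega)]; ring

theorem annihilatesSinglet_spin (i : Fin 3) : AnnihilatesSinglet (spin S i) := by
  intro a b
  have h1 := annihilatesSinglet_raising a b
  have h2 := annihilatesSinglet_conjTranspose a b
  fin_cases i
  · show spin S 0 a b.rev * _ + spin S 0 b a.rev * _ = 0
    rw [spin_zero]
    simp only [Matrix.smul_apply, Matrix.add_apply, smul_eq_mul]
    linear_combination (1 / 2 : ℂ) * (h1 + h2)
  · show spin S 1 a b.rev * _ + spin S 1 b a.rev * _ = 0
    rw [spin_one]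
    simp only [Matrix.smul_apply, Matrix.sub_apply, smul_eq_mul]
    linear_combination (1 / (2 * Complex.I) : ℂ) * (h1 - h2)
  · show spinZ S a b.rev * _ + spinZ S b a.rev * _ = 0
    simp only [spinZ, Matrix.diagonal_apply]
    by_cases h : a = b.rev
    · subst h
      rw [if_pos rfl, if_pos (Fin.rev_rev b).symm, mag_rev, neg_one_zpow_neg]
      push_cast; ring
    · have h' : b ≠ a.rev := fun hb => h (by rw [hb, Fin.rev_rev])
      rw [if_neg h, if_neg h']; ring

variable {V : Type*} [Fintype V] [DecidableEq V]

theorem siteOp_mul_apply (x : V) (A : Matrix (Fin (2 * S + 1)) (Fin (2 * S + 1)) ℂ) (M : Op V S)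
    (σ τ : V → Fin (2 * S + 1)) :
    (siteOp x A * M) σ τ = ∑ c, A (σ x) c * M (Function.update σ x c) τ := by
  rw [Matrix.mul_apply]
  refine (Finset.sum_of_injOn (fun c => Function.update σ x c) ?_ ?_ ?_ ?_).symm
  · intro a _ b _ h; simpa using congrFun h x
  · simp
  · intro ρ _ hρ
    rw [siteOp, Matrix.of_apply, if_neg, zero_mul]
    intro h
    refine hρ ⟨ρ x, Finset.mem_coe.2 (Finset.mem_univ _), ?_⟩
    funext z
    by_cases hz : z = x
    · subst hz; simp
    · simp [hz, h z hz]
  · intro c _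
    rw [siteOp, Matrix.of_apply, if_pos, Function.update_self]
    intro z hz; simp [hz]

theorem mul_siteOp_apply (x : V) (A : Matrix (Fin (2 * S + 1)) (Fin (2 * S + 1)) ℂ) (M : Op V S)
    (σ τ : V → Fin (2 * S + 1)) :
    (M * siteOp x A) σ τ = ∑ c, M σ (Function.update τ x c) * A c (τ x) := by
  rw [Matrix.mul_apply]
  refine (Finset.sum_of_injOn (fun c => Function.update τ x c) ?_ ?_ ?_ ?_).symm
  · intro a _ b _ h; simpa using congrFun h x
  · simp
  · intro ρ _ hρ
    rw [siteOp, Matrix.of_apply, if_neg, mul_zero]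
    intro h
    refine hρ ⟨ρ x, Finset.mem_coe.2 (Finset.mem_univ _), ?_⟩
    funext z
    by_cases hz : z = x
    · subst hz; simp
    · simp [hz, h z hz]
  · intro c _
    rw [siteOp, Matrix.of_apply, if_pos, Function.update_self]
    intro z hz; simp [hz]

/-- `siteOp` as a linear map. -/
def siteOpLinear (x : V) : Matrix (Fin (2 * S + 1)) (Fin (2 * S + 1)) ℂ →ₗ[ℂ] Op V S where
  toFun := siteOp x
  map_add' A B := by
    ext σ τ
    simp only [siteOp, Matrix.of_apply, Matrix.add_apply]
    split_ifs <;> simp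
  map_smul' c A := by
    ext σ τ
    simp only [siteOp, Matrix.of_apply, Matrix.smul_apply, RingHom.id_apply]
    split_ifs <;> simp

theorem siteOp_mul (x : V) (A B : Matrix (Fin (2 * S + 1)) (Fin (2 * S + 1)) ℂ) :
    siteOp x A * siteOp x B = siteOp x (A * B) := by
  ext σ τ
  rw [siteOp_mul_apply]
  simp only [siteOp, Matrix.of_apply, Function.update_self]
  have : ∀ c, (∀ z, z ≠ x → Function.update σ x c z = τ z) ↔ ∀ z, z ≠ x → σ z = τ z := fun c =>
    forall₂_congr fun z hz => by rw [Function.update_of_ne hz]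
  simp only [this]
  split_ifs
  · rw [Matrix.mul_apply]
  · simp

theorem siteOp_comm {x y : V} (hxy : x ≠ y)
    (A B : Matrix (Fin (2 * S + 1)) (Fin (2 * S + 1)) ℂ) :
    siteOp x A * siteOp y B = siteOp y B * siteOp x A := by
  ext σ τ
  rw [siteOp_mul_apply, mul_siteOp_apply]
  have h1 : ∀ c, siteOp y B (Function.update σ x c) τ =
      if c = τ x then (if ∀ z, z ≠ x → z ≠ y → σ z = τ z then B (σ y) (τ y) else 0) else 0 := by
    intro c
    simp only [siteOp, Matrix.of_apply, Function.update_of_ne hxy.symm]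
    rw [← ite_and]
    congr 1
    apply propext
    constructor
    · intro h
      refine ⟨by simpa using h x hxy, fun z hz hz' => ?_⟩
      simpa [hz] using h z hz'
    · rintro ⟨rfl, h⟩ z hz
      by_cases hz' : z = x
      · subst hz'; simp
      · simp [hz', h z hz' hz]
  have h2 : ∀ c, siteOp y B σ (Function.update τ x c) =
      if c = σ x then (if ∀ z, z ≠ x → z ≠ y → σ z = τ z then B (σ y) (τ y) else 0) else 0 := by
    intro c
    simp only [siteOp, Matrix.of_apply, Function.update_of_ne hxy.symm]
    rw [← ite_and]
    congr 1
    apply propext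
    constructor
    · intro h
      refine ⟨by simpa using (h x hxy).symm, fun z hz hz' => ?_⟩
      simpa [hz] using h z hz'
    · rintro ⟨rfl, h⟩ z hz
      by_cases hz' : z = x
      · subst hz'; simp
      · simp [hz', h z hz' hz]
  simp only [h1, h2, mul_ite, ite_mul, mul_zero, zero_mul, Finset.sum_ite_eq', Finset.mem_univ,
    if_true]
  split_ifs
  · ring
  · rfl

/-- The total spin operator. -/
def totalOp (V : Type*) [Fintype V] [DecidableEq V]
    (A : Matrix (Fin (2 * S + 1)) (Fin (2 * S + 1)) ℂ) : Op V S :=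
  ∑ z, siteOp z A

/-- Operators at other sites commute with the one at `x`, so the total operator acts locally as a
derivation. -/
theorem totalOp_commutator (x : V) (A B : Matrix (Fin (2 * S + 1)) (Fin (2 * S + 1)) ℂ) :
    totalOp V A * siteOp x B - siteOp x B * totalOp V A = siteOp x (A * B - B * A) := by
  rw [totalOp, Finset.sum_mul, Finset.mul_sum, ← Finset.sum_sub_distrib,
    Finset.sum_eq_single x]
  · rw [siteOp_mul, siteOp_mul]
    exact ((siteOpLinear x).map_sub _ _).symm
  · intro z _ hz
    rw [siteOp_comm hz, sub_self]
  · simp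

theorem siteOp_mul_bondOp_of_ne {x a b : V} (ha : x ≠ a) (hb : x ≠ b)
    (A : Matrix (Fin (2 * S + 1)) (Fin (2 * S + 1)) ℂ)
    (B : Fin (2 * S + 1) → Fin (2 * S + 1) → Fin (2 * S + 1) → Fin (2 * S + 1) → ℂ) :
    siteOp x A * bondOp a b B = bondOp a b B * siteOp x A := by
  ext σ τ
  rw [siteOp_mul_apply, mul_siteOp_apply]
  have h1 : ∀ c, bondOp a b B (Function.update σ x c) τ =
      if c = τ x then (if ∀ z, z ≠ x → z ≠ a → z ≠ b → σ z = τ z then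
        B (σ a) (σ b) (τ a) (τ b) else 0) else 0 := by
    intro c
    simp only [bondOp, Matrix.of_apply, Function.update_of_ne ha.symm, Function.update_of_ne hb.symm]
    rw [← ite_and]
    congr 1
    apply propext
    constructor
    · intro h
      refine ⟨by simpa using h x ha hb, fun z hz hz' hz'' => ?_⟩
      simpa [hz] using h z hz' hz''
    · rintro ⟨rfl, h⟩ z hz hz''
      by_cases hz' : z = x
      · subst hz'; simp
      · simp [hz', h z hz' hz hz'']
  have h2 : ∀ c, bondOp a b B σ (Function.update τ x c) =
      if c = σ x then (if ∀ z, z ≠ x → z ≠ a → z ≠ b → σ z = τ z then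
        B (σ a) (σ b) (τ a) (τ b) else 0) else 0 := by
    intro c
    simp only [bondOp, Matrix.of_apply, Function.update_of_ne ha.symm, Function.update_of_ne hb.symm]
    rw [← ite_and]
    congr 1
    apply propext
    constructor
    · intro h
      refine ⟨by simpa using (h x ha hb).symm, fun z hz hz' hz'' => ?_⟩
      simpa [hz] using h z hz' hz''
    · rintro ⟨rfl, h⟩ z hz hz''
      by_cases hz' : z = x
      · subst hz'; simp
      · simp [hz', h z hz' hz hz'']
  simp only [h1, h2, mul_ite, ite_mul, mul_zero, zero_mul, Finset.sum_ite_eq', Finset.mem_univ,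
    if_true]
  split_ifs
  · ring
  · rfl

theorem siteOp_mul_bondOp {a b : V} (hab : a ≠ b)
    (A : Matrix (Fin (2 * S + 1)) (Fin (2 * S + 1)) ℂ)
    (B : Fin (2 * S + 1) → Fin (2 * S + 1) → Fin (2 * S + 1) → Fin (2 * S + 1) → ℂ)
    (σ τ : V → Fin (2 * S + 1)) :
    ((siteOp a A + siteOp b A) * bondOp a b B) σ τ = if ∀ z, z ≠ a → z ≠ b → σ z = τ z then
      ∑ c, (A (σ a) c * B c (σ b) (τ a) (τ b) + A (σ b) c * B (σ a) c (τ a) (τ b)) else 0 := by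
  rw [Matrix.add_mul, Matrix.add_apply, siteOp_mul_apply, siteOp_mul_apply,
    ← Finset.sum_add_distrib]
  simp only [bondOp, Matrix.of_apply, Function.update_self, Function.update_of_ne hab,
    Function.update_of_ne hab.symm]
  have h1 : ∀ c, (∀ z, z ≠ a → z ≠ b → Function.update σ a c z = τ z) ↔
      ∀ z, z ≠ a → z ≠ b → σ z = τ z := fun c =>
    forall₃_congr fun z hz _ => by rw [Function.update_of_ne hz]
  have h2 : ∀ c, (∀ z, z ≠ a → z ≠ b → Function.update σ b c z = τ z) ↔
      ∀ z, z ≠ a → z ≠ b → σ z = τ z := fun c =>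
    forall₃_congr fun z _ hz => by rw [Function.update_of_ne hz]
  simp only [h1, h2]
  split_ifs <;> simp

theorem bondOp_mul_siteOp {a b : V} (hab : a ≠ b)
    (A : Matrix (Fin (2 * S + 1)) (Fin (2 * S + 1)) ℂ)
    (B : Fin (2 * S + 1) → Fin (2 * S + 1) → Fin (2 * S + 1) → Fin (2 * S + 1) → ℂ)
    (σ τ : V → Fin (2 * S + 1)) :
    (bondOp a b B * (siteOp a A + siteOp b A)) σ τ = if ∀ z, z ≠ a → z ≠ b → σ z = τ z then
      ∑ c, (B (σ a) (σ b) c (τ b) * A c (τ a) + B (σ a) (σ b) (τ a) c * A c (τ b)) else 0 := by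
  rw [Matrix.mul_add, Matrix.add_apply, mul_siteOp_apply, mul_siteOp_apply,
    ← Finset.sum_add_distrib]
  simp only [bondOp, Matrix.of_apply, Function.update_self, Function.update_of_ne hab,
    Function.update_of_ne hab.symm]
  have h1 : ∀ c, (∀ z, z ≠ a → z ≠ b → σ z = Function.update τ a c z) ↔
      ∀ z, z ≠ a → z ≠ b → σ z = τ z := fun c =>
    forall₃_congr fun z hz _ => by rw [Function.update_of_ne hz]
  have h2 : ∀ c, (∀ z, z ≠ a → z ≠ b → σ z = Function.update τ b c z) ↔
      ∀ z, z ≠ a → z ≠ b → σ z = τ z := fun c =>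
    forall₃_congr fun z _ hz => by rw [Function.update_of_ne hz]
  simp only [h1, h2]
  split_ifs <;> simp

/-- Sites off the bond commute with it; the hypothesis is the remaining two-site identity for `A ⊗ 1
+ 1 ⊗ A`. -/
theorem totalOp_commute_bondOp {a b : V} (hab : a ≠ b)
    (A : Matrix (Fin (2 * S + 1)) (Fin (2 * S + 1)) ℂ)
    (B : Fin (2 * S + 1) → Fin (2 * S + 1) → Fin (2 * S + 1) → Fin (2 * S + 1) → ℂ)
    (h : ∀ i j k l, ∑ c, (A i c * B c j k l + A j c * B i c k l) =
      ∑ c, (B i j c l * A c k + B i j k c * A c l)) :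
    Commute (totalOp V A) (bondOp a b B) := by
  have e : totalOp V A = (siteOp a A + siteOp b A) +
      ∑ z ∈ (Finset.univ.erase a).erase b, siteOp z A := by
    rw [totalOp, ← Finset.add_sum_erase _ _ (Finset.mem_univ a),
      ← Finset.add_sum_erase _ _ (Finset.mem_erase.2 ⟨hab.symm, Finset.mem_univ b⟩), add_assoc]
  rw [e]
  refine Commute.add_left ?_ (Commute.sum_left _ _ _ fun z hz => ?_)
  · ext σ τ
    rw [siteOp_mul_bondOp hab, bondOp_mul_siteOp hab, h]
  · simp only [Finset.mem_erase, Finset.mem_univ, and_true] at hz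
    exact siteOp_mul_bondOp_of_ne hz.2 hz.1 A B

variable {G : SimpleGraph V}

theorem totalOp_commute_edgeT (A : Matrix (Fin (2 * S + 1)) (Fin (2 * S + 1)) ℂ)
    {e : Sym2 V} (he : e ∈ G.edgeSet) : Commute (totalOp V A) (edgeT S e) := by
  induction e with | _ a b =>
  refine totalOp_commute_bondOp (G.mem_edgeSet.1 he).ne A _ fun i j k l => ?_
  simp only [transpositionCoeff, Finset.sum_add_distrib, mul_ite, ite_mul, mul_one, one_mul,
    mul_zero, zero_mul, ite_and, Finset.sum_ite_eq, Finset.sum_ite_eq', Finset.mem_univ, if_true]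
  simp only [← ite_and]
  simp [Finset.sum_ite_eq, ite_and, Finset.sum_ite_irrel, add_comm]

/-- `P` has rank one, being built from the singlet vector `∑ (-1)^a |a, -a⟩` on both sides. `A ⊗ 1 +
1 ⊗ A` annihilates it, so both products `hl` and `hr` vanish. -/
theorem totalOp_commute_edgeP {A : Matrix (Fin (2 * S + 1)) (Fin (2 * S + 1)) ℂ}
    (hA : AnnihilatesSinglet A) {e : Sym2 V} (he : e ∈ G.edgeSet) :
    Commute (totalOp V A) (edgeP S e) := by
  induction e with | _ a b =>
  refine totalOp_commute_bondOp (G.mem_edgeSet.1 he).ne A _ fun i j k l => ?_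
  have hP : ∀ a b c d : Fin (2 * S + 1), singletCoeff S a b c d =
      if b = a.rev ∧ d = c.rev then (-1) ^ mag S a * (-1) ^ mag S c else 0 := by
    intro a b c d
    simp only [singletCoeff, mag_eq_neg_iff]
    rw [sub_eq_add_neg, zpow_add₀ (by norm_num), neg_one_zpow_neg]
  have hrev : ∀ a b : Fin (2 * S + 1), a = b.rev ↔ b = a.rev := fun a b => by
    rw [eq_comm, Fin.rev_eq_iff]
  have hs : ∀ a : Fin (2 * S + 1), (-1 : ℂ) ^ mag S a.rev = (-1) ^ mag S a := fun a => by
    rw [mag_rev, neg_one_zpow_neg]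
  have hl : ∑ c, (A i c * singletCoeff S c j k l + A j c * singletCoeff S i c k l) = 0 := by
    rw [Finset.sum_add_distrib, Finset.sum_eq_single j.rev, Finset.sum_eq_single i.rev]
    · have := hA i j
      simp only [hP, Fin.rev_rev, true_and, hs]
      split_ifs
      · linear_combination (-1 : ℂ) ^ mag S k * this
      · simp
    · intro c _ hc
      rw [hP, if_neg fun h => hc h.1, mul_zero]
    · simp
    · intro c _ hc
      rw [hP, if_neg fun h => hc ((hrev _ _).1 h.1), mul_zero]
    · simp
  have hr : ∑ c, (singletCoeff S i j c l * A c k + singletCoeff S i j k c * A c l) = 0 := by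
    rw [Finset.sum_add_distrib, Finset.sum_eq_single l.rev, Finset.sum_eq_single k.rev]
    -- Annihilation from the right involves the same matrix elements with spins negated; multiplying
    -- by both signs, whose squares are one, turns one relation into the other.
    · have := hA l.rev k.rev
      simp only [hP, Fin.rev_rev, and_true, hs] at this ⊢
      have h1 := neg_one_zpow_mul_self (mag S l)
      have h2 := neg_one_zpow_mul_self (mag S k)
      split_ifs
      · generalize (-1 : ℂ) ^ mag S l = p at *
        generalize (-1 : ℂ) ^ mag S k = q at *
        linear_combination (-1 : ℂ) ^ mag S i * (p * q * this - A l.rev k * p * h2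
          - A k.rev l * q * h1)
      · simp
    · intro c _ hc
      rw [hP, if_neg fun h => hc h.2, zero_mul]
    · simp
    · intro c _ hc
      rw [hP, if_neg fun h => hc ((hrev _ _).1 h.2), zero_mul]
    · simp
  rw [hl, hr]

variable [Fintype G.edgeSet]

theorem totalOp_commute_gibbs {A : Matrix (Fin (2 * S + 1)) (Fin (2 * S + 1)) ℂ}
    (hA : AnnihilatesSinglet A) (u s : ℝ) : Commute (totalOp V A) (gibbs G S u s) := by
  refine Commute.exp_right (Commute.smul_right (Commute.neg_right
    (Commute.sum_right _ _ _ fun e he => ?_)) _)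
  have he' : e ∈ G.edgeSet := SimpleGraph.mem_edgeFinset.1 he
  exact (((totalOp_commute_edgeT A he').smul_right _).add_right
    ((totalOp_commute_edgeP hA he').smul_right _)).sub_right (Commute.one_right _)

/-- The bilinear form `(A, B) ↦ Tr A_x g B_y g'`. -/
def traceForm (x y : V) (g g' : Op V S) :
    Matrix (Fin (2 * S + 1)) (Fin (2 * S + 1)) ℂ →ₗ[ℂ]
      Matrix (Fin (2 * S + 1)) (Fin (2 * S + 1)) ℂ →ₗ[ℂ] ℂ :=
  LinearMap.mk₂ ℂ (fun A B => (siteOpLinear x A * g * siteOpLinear y B * g').trace)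
    (fun _ _ _ => by simp [Matrix.add_mul]) (fun _ _ _ => by simp)
    (fun _ _ _ => by simp [Matrix.mul_add, Matrix.add_mul]) (fun _ _ _ => by simp)

-- The two terms add up to the trace of the commutator of the total operator with the whole product,
-- because that operator commutes with `g` and `g'`.
omit [Fintype G.edgeSet] in
theorem traceForm_invariant (x y : V) {g g' : Op V S}
    {J : Matrix (Fin (2 * S + 1)) (Fin (2 * S + 1)) ℂ} (h : Commute (totalOp V J) g)
    (h' : Commute (totalOp V J) g') (A B : Matrix (Fin (2 * S + 1)) (Fin (2 * S + 1)) ℂ) :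
    traceForm x y g g' (J * A - A * J) B + traceForm x y g g' A (J * B - B * J) = 0 := by
  show (siteOp x (J * A - A * J) * g * siteOp y B * g').trace +
    (siteOp x A * g * siteOp y (J * B - B * J) * g').trace = 0
  rw [← totalOp_commutator, ← totalOp_commutator]
  generalize siteOp x A = a
  generalize siteOp y B = b
  generalize totalOp V J = j at h h'
  have e : (j * a - a * j) * g * b * g' + a * g * (j * b - b * j) * g' =
      j * (a * g * b * g') - a * g * b * g' * j := by
    have e₁ : a * j * g = a * g * j := by rw [Matrix.mul_assoc, h.eq, ← Matrix.mul_assoc]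
    have e₂ : a * g * b * g' * j = a * g * b * j * g' := by
      rw [Matrix.mul_assoc _ g', ← h'.eq, ← Matrix.mul_assoc]
    rw [e₂, sub_mul, e₁]
    noncomm_ring
  rw [← Matrix.trace_add, e, Matrix.trace_sub, Matrix.trace_mul_comm, sub_self]

/-- The linear form `A ↦ Tr A_x g`. -/
def traceLinear (x : V) (g : Op V S) :
    Matrix (Fin (2 * S + 1)) (Fin (2 * S + 1)) ℂ →ₗ[ℂ] ℂ :=
  Matrix.traceLinearMap _ ℂ ℂ ∘ₗ LinearMap.mulRight ℂ g ∘ₗ siteOpLinear x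

omit [Fintype G.edgeSet] in
theorem traceLinear_invariant (x : V) {g : Op V S}
    {J : Matrix (Fin (2 * S + 1)) (Fin (2 * S + 1)) ℂ} (h : Commute (totalOp V J) g)
    (A : Matrix (Fin (2 * S + 1)) (Fin (2 * S + 1)) ℂ) :
    traceLinear x g (J * A - A * J) = 0 := by
  show (siteOp x (J * A - A * J) * g).trace = 0
  rw [← totalOp_commutator]
  generalize siteOp x A = a
  generalize totalOp V J = j at h
  have e : (j * a - a * j) * g = j * (a * g) - a * g * j := by
    rw [sub_mul, Matrix.mul_assoc a j, h.eq]
    noncomm_ring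
  rw [e, Matrix.trace_sub, Matrix.trace_mul_comm, sub_self]

theorem exists_rotates (i : Fin 3) : i = 2 ∨ ∃ (j : Fin 3) (c : ℂ),
    Rotates c (spin S j) (spin S 2) (spin S i) := by
  fin_cases i
  · exact Or.inr ⟨1, _, rotates_one⟩
  · exact Or.inr ⟨0, _, rotates_zero⟩
  · exact Or.inl rfl

theorem siteOp_sq (x : V) (A : Matrix (Fin (2 * S + 1)) (Fin (2 * S + 1)) ℂ) :
    siteOp x A ^ 2 = siteOp x (A * A) := by rw [sq, siteOp_mul]

variable (G) (β u t : ℝ) (x y : V) (i : Fin 3)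

theorem schwinger_spin : schwinger G S β u (siteOp x (spin S i)) (siteOp y (spin S i)) t =
    schwinger G S β u (siteOp x (spinZ S)) (siteOp y (spinZ S)) t := by
  rcases exists_rotates (S := S) i with rfl | ⟨j, c, h⟩
  · rfl
  · have := h.bilinear_eq (traceForm x y (gibbs G S u (β - t)) (gibbs G S u t))
      (traceForm_invariant x y (totalOp_commute_gibbs (annihilatesSinglet_spin j) _ _)
        (totalOp_commute_gibbs (annihilatesSinglet_spin j) _ _))
    exact congrArg (· / partition G S β u) this

theorem schwinger_spin_sq :
    schwinger G S β u (siteOp x (spin S i) ^ 2) (siteOp y (spin S i) ^ 2) t =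
      schwinger G S β u (siteOp x (spinZ S * spinZ S)) (siteOp y (spinZ S * spinZ S)) t := by
  rw [siteOp_sq, siteOp_sq]
  rcases exists_rotates (S := S) i with rfl | ⟨j, c, h⟩
  · rfl
  · have := h.bilinear_sq_eq (traceForm x y (gibbs G S u (β - t)) (gibbs G S u t))
      (traceForm_invariant x y (totalOp_commute_gibbs (annihilatesSinglet_spin j) _ _)
        (totalOp_commute_gibbs (annihilatesSinglet_spin j) _ _))
    exact congrArg (· / partition G S β u) this

theorem expectation_spin_sq : expectation G S β u (siteOp x (spin S i) ^ 2) =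
    expectation G S β u (siteOp x (spinZ S * spinZ S)) := by
  rw [siteOp_sq]
  rcases exists_rotates (S := S) i with rfl | ⟨j, c, h⟩
  · rfl
  · have := h.linear_eq (traceLinear x (gibbs G S u β))
      (traceLinear_invariant x (totalOp_commute_gibbs (annihilatesSinglet_spin j) _ _))
    exact congrArg (· / partition G S β u) this

end Rotation

/-! ### Integration against the Poisson process. -/

section PoissonIntegral

instance : Fintype Kind where
  elems := Finset.cons Kind.cross {Kind.bar} (by simp)
  complete := by intro k; cases k <;> simp

theorem sum_kind {A : Type*} [AddCommMonoid A] (f : Kind → A) :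
    ∑ k, f k = f Kind.cross + f Kind.bar := by
  have : (Finset.univ : Finset Kind) = Finset.cons Kind.cross {Kind.bar} (by simp) := rfl
  rw [this, Finset.sum_cons, Finset.sum_singleton]

variable {V : Type*} {G : SimpleGraph V}

/-- The transition with given letter and time. -/
def Transition.mk' (l : Letter G) (s : ℝ) : Transition G := ⟨l.1, l.2, s⟩

/-- The letter of a transition. -/
def Transition.letter (m : Transition G) : Letter G := (m.edge, m.kind)

theorem Transition.ext' {m m' : Transition G} (h : m.letter = m'.letter) (h' : m.time = m'.time) :
    m = m' := by
  cases m; cases m'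
  simp only [letter, Prod.mk.injEq] at h
  obtain ⟨rfl, rfl⟩ := h
  cases h'
  rfl

theorem measurable_mk' (l : Letter G) : Measurable (Transition.mk' l) := by
  rw [measurable_iff_comap_le]
  refine (MeasurableSpace.comap_sup).le.trans (sup_le ?_ ?_)
  · rw [MeasurableSpace.comap_comp]
    have : (fun m : Transition G => (m.edge, m.kind)) ∘ Transition.mk' l = fun _ => l := rfl
    rw [this, MeasurableSpace.comap_const]
    exact bot_le
  · rw [MeasurableSpace.comap_comp]
    have : (fun m : Transition G => m.time) ∘ Transition.mk' l = fun s => s := rfl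
    rw [this]
    exact (MeasurableSpace.comap_id).le

theorem measurable_time : Measurable (Transition.time : Transition G → ℝ) := by
  rw [measurable_iff_comap_le]
  exact le_sup_right

theorem measurableSet_letter (l : Letter G) : MeasurableSet {m : Transition G | m.letter = l} := by
  have h : MeasurableSpace.comap (fun m : Transition G => (m.edge, m.kind)) ⊤ ≤
    (inferInstance : MeasurableSpace (Transition G)) := le_sup_left
  exact h _ ⟨{l}, trivial, rfl⟩

theorem measurable_sigma_mk {α : Type*} [MeasurableSpace α] (n : ℕ) :
    Measurable (fun l : Fin n → α => (⟨n, l⟩ : Σ n : ℕ, (Fin n → α))) :=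
  fun _ hs => MeasurableSpace.measurableSet_iInf.1 hs n

theorem measurable_ofTuple {α : Type*} [MeasurableSpace α] :
    Measurable (Config.ofTuple : (Σ n : ℕ, (Fin n → α)) → Config α) := fun _ hs => hs

theorem measurableSet_config {α : Type*} [MeasurableSpace α] {A : Set (Config α)}
    (h : ∀ n, MeasurableSet {l : Fin n → α | Config.ofTuple ⟨n, l⟩ ∈ A}) : MeasurableSet A :=
  MeasurableSpace.measurableSet_iInf.2 h

variable [Fintype G.edgeSet]

/-- The intensities of crosses and double bars. -/
def weight (u : ℝ) (l : Letter G) : ℝ :=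
  match l.2 with
  | Kind.cross => u
  | Kind.bar => 1 - u

omit [Fintype G.edgeSet] in
theorem weight_nonneg {u : ℝ} (hu : u ∈ Set.Icc (0 : ℝ) 1) (l : Letter G) : 0 ≤ weight u l := by
  obtain ⟨e, k⟩ := l
  cases k
  · exact hu.1
  · exact sub_nonneg.2 hu.2

theorem intensity_eq (β u : ℝ) : intensity G β u = ∑ l : Letter G,
    ENNReal.ofReal (weight u l) •
      (volume.restrict (Set.Icc 0 β)).map (Transition.mk' l) := by
  rw [Fintype.sum_prod_type, intensity]
  refine Finset.sum_congr rfl fun e _ => ?_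
  rw [sum_kind]
  rfl

theorem intensity_univ {β u : ℝ} (hu : u ∈ Set.Icc (0 : ℝ) 1) :
    intensity G β u Set.univ = ENNReal.ofReal (β * Fintype.card G.edgeSet) := by
  rw [intensity, Measure.finsetSum_apply]
  have : ∀ e ∈ (Finset.univ : Finset G.edgeSet),
      (ENNReal.ofReal u • (volume.restrict (Set.Icc 0 β)).map (fun s => (⟨e, Kind.cross, s⟩ :
        Transition G)) + ENNReal.ofReal (1 - u) • (volume.restrict (Set.Icc 0 β)).map
          (fun s => (⟨e, Kind.bar, s⟩ : Transition G))) Set.univ = ENNReal.ofReal β := by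
    intro e _
    have h1 : Measurable (fun s => (⟨e, Kind.cross, s⟩ : Transition G)) :=
      measurable_mk' (e, Kind.cross)
    have h2 : Measurable (fun s => (⟨e, Kind.bar, s⟩ : Transition G)) :=
      measurable_mk' (e, Kind.bar)
    rw [Measure.add_apply, Measure.smul_apply, Measure.smul_apply,
      Measure.map_apply h1 MeasurableSet.univ, Measure.map_apply h2 MeasurableSet.univ]
    simp only [Set.preimage_univ, Measure.restrict_apply_univ, Real.volume_Icc, sub_zero,
      smul_eq_mul]
    rw [← add_mul, ← ENNReal.ofReal_add hu.1 (sub_nonneg.2 hu.2)]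
    simp
  rw [Finset.sum_congr rfl this, Finset.sum_const, Finset.card_univ, nsmul_eq_mul, mul_comm β,
    ENNReal.ofReal_mul (by positivity), ENNReal.ofReal_natCast]

theorem isFiniteMeasure_intensity {β u : ℝ} (hu : u ∈ Set.Icc (0 : ℝ) 1) :
    IsFiniteMeasure (intensity G β u) :=
  ⟨by rw [intensity_univ hu]; exact ENNReal.ofReal_lt_top⟩

/-- The law of independent uniform times. -/
abbrev timesMeasure (β : ℝ) (n : ℕ) : Measure (Fin n → ℝ) :=
  Measure.pi fun _ => volume.restrict (Set.Icc 0 β)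

omit [Fintype G.edgeSet] in
theorem measurable_tuple {n : ℕ} (lab : Fin n → Letter G) :
    Measurable (fun (τ : Fin n → ℝ) i => Transition.mk' (lab i) (τ i)) :=
  measurable_pi_lambda _ fun i => (measurable_mk' (lab i)).comp (measurable_pi_apply i)

/-- A product of sums of measures, expanded on boxes: letters and times separate. -/
theorem pi_intensity {β u : ℝ} (hu : u ∈ Set.Icc (0 : ℝ) 1) (n : ℕ) :
    (Measure.pi fun _ : Fin n => intensity G β u) = ∑ lab : Fin n → Letter G,
      (∏ i, ENNReal.ofReal (weight u (lab i))) •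
        (timesMeasure β n).map (fun τ i => Transition.mk' (lab i) (τ i)) := by
  classical
  have := isFiniteMeasure_intensity (G := G) (β := β) hu
  refine Measure.pi_eq fun s hs => ?_
  have h1 : ∀ lab : Fin n → Letter G,
      ((∏ i, ENNReal.ofReal (weight u (lab i))) •
        (timesMeasure β n).map (fun τ i => Transition.mk' (lab i) (τ i))) (Set.univ.pi s) =
      ∏ i, (ENNReal.ofReal (weight u (lab i)) *
        (volume.restrict (Set.Icc 0 β)) (Transition.mk' (lab i) ⁻¹' s i)) := by
    intro lab
    rw [Measure.smul_apply, Measure.map_apply (measurable_tuple lab)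
      (MeasurableSet.univ_pi hs), smul_eq_mul, Finset.prod_mul_distrib]
    congr 1
    exact Measure.pi_pi _ fun i => Transition.mk' (lab i) ⁻¹' s i
  have h2 : ∀ i, intensity G β u (s i) = ∑ l : Letter G, ENNReal.ofReal (weight u l) *
      (volume.restrict (Set.Icc 0 β)) (Transition.mk' l ⁻¹' s i) := by
    intro i
    rw [intensity_eq, Measure.finsetSum_apply]
    refine Finset.sum_congr rfl fun l _ => ?_
    rw [Measure.smul_apply, Measure.map_apply (measurable_mk' l) (hs i), smul_eq_mul]
  rw [Measure.finsetSum_apply]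
  simp_rw [h1, h2]
  rw [Finset.prod_univ_sum, Fintype.piFinset_univ]

/-- The exceptional times lie in finitely many hyperplanes `τ i = c` or `τ i = τ j`, and in the
complement of the box. -/
theorem ae_times (β t : ℝ) (n : ℕ) : ∀ᵐ τ ∂timesMeasure β n,
    Function.Injective τ ∧ ∀ i, 0 < τ i ∧ τ i < β ∧ τ i ≠ t := by
  have h0 : timesMeasure β n = (volume : Measure (Fin n → ℝ)).restrict
      (Set.univ.pi fun _ => Set.Icc 0 β) := (Measure.restrict_pi_pi _ _).symm
  have hne : ∀ (i : Fin n) (c : ℝ), ∀ᵐ τ ∂timesMeasure β n, τ i ≠ c := fun i c => by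
    rw [h0]
    exact ae_restrict_of_ae (ae_iff.2 (by
      simpa [← volume_pi] using Measure.pi_hyperplane (fun _ : Fin n => (volume : Measure ℝ)) i c))
  have hinj : ∀ i j : Fin n, i ≠ j → ∀ᵐ τ ∂timesMeasure β n, τ i ≠ τ j := fun i j hij => by
    rw [h0]
    apply ae_restrict_of_ae
    let W : Submodule ℝ (Fin n → ℝ) :=
      LinearMap.ker ((LinearMap.proj i : (Fin n → ℝ) →ₗ[ℝ] ℝ) - LinearMap.proj j)
    have hW : W ≠ ⊤ := by
      intro h
      have : (Pi.single i 1 : Fin n → ℝ) ∈ W := h ▸ Submodule.mem_top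
      simp [W, LinearMap.mem_ker, hij.symm] at this
    have := Measure.addHaar_submodule volume W hW
    refine ae_iff.2 (measure_mono_null (fun τ hτ => ?_) this)
    have hτ' : τ i = τ j := not_not.1 hτ
    simp [W, LinearMap.mem_ker, hτ']
  have hIcc : ∀ᵐ τ ∂timesMeasure β n, ∀ i, τ i ∈ Set.Icc 0 β := by
    rw [h0]
    filter_upwards [ae_restrict_mem (MeasurableSet.univ_pi fun _ => measurableSet_Icc)] with τ hτ i
    exact hτ i trivial
  have h1 := ae_all_iff.2 fun i => hne i 0
  have h2 := ae_all_iff.2 fun i => hne i β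
  have h3 := ae_all_iff.2 fun i => hne i t
  have h4 := ae_all_iff.2 fun i => ae_all_iff.2 fun j => ae_all_iff.2 fun h => hinj i j h
  filter_upwards [h1, h2, h3, h4, hIcc] with τ h1 h2 h3 h4 h5
  refine ⟨fun i j hij => ?_, fun i => ⟨lt_of_le_of_ne (h5 i).1 (h1 i).symm,
    lt_of_le_of_ne (h5 i).2 (h2 i), h3 i⟩⟩
  by_contra h
  exact h4 i j h hij

/-- The times are split according to the set `J` of indices before `t`. Each such region has volume
`t ^ |J| * (β - t) ^ (n - |J|)`, and `n.choose k` sets have size `k`. -/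
theorem lintegral_idx {β t : ℝ} (ht : t ∈ Set.Icc 0 β) (n : ℕ) (c : Fin (n + 1) → ENNReal) :
    ∫⁻ τ, c (idx τ t) ∂timesMeasure β n = ∑ k : Fin (n + 1), (n.choose k : ENNReal) *
      (ENNReal.ofReal t ^ (k : ℕ) * ENNReal.ofReal (β - t) ^ (n - k)) * c k := by
  classical
  let A : Finset (Fin n) → Set (Fin n → ℝ) := fun J =>
    Set.univ.pi fun i => if i ∈ J then Set.Iio t else Set.Ici t
  have hA : ∀ J τ, τ ∈ A J ↔ (Finset.univ.filter fun j => τ j < t) = J := by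
    intro J τ
    simp only [A, Set.mem_univ_pi, Finset.ext_iff, Finset.mem_filter, Finset.mem_univ, true_and]
    refine forall_congr' fun i => ?_
    by_cases hi : i ∈ J <;> simp [hi]
  -- Extension of `c` to all naturals; the default `0` is never reached, since `J` has at most `n`
  -- elements.
  let c' : ℕ → ENNReal := fun m => if h : m < n + 1 then c ⟨m, h⟩ else 0
  have hc : ∀ τ : Fin n → ℝ, c (idx τ t) = ∑ J, (A J).indicator (fun _ => c' J.card) τ := by
    intro τ
    rw [Finset.sum_eq_single (Finset.univ.filter fun j => τ j < t)]
    · rw [Set.indicator_of_mem ((hA _ _).2 rfl)]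
      have : c' (idx τ t) = c (idx τ t) := dif_pos (idx τ t).2
      exact this.symm
    · intro J _ hJ
      exact Set.indicator_of_notMem (fun h => hJ ((hA _ _).1 h).symm) _
    · simp
  have hmeas : ∀ J, MeasurableSet (A J) := fun J => MeasurableSet.univ_pi fun i => by
    split_ifs
    · exact measurableSet_Iio
    · exact measurableSet_Ici
  have hvol : ∀ J, timesMeasure β n (A J) =
      ENNReal.ofReal t ^ J.card * ENNReal.ofReal (β - t) ^ (n - J.card) := by
    intro J
    rw [Measure.pi_pi]
    have h1 : (volume.restrict (Set.Icc 0 β)) (Set.Iio t) = ENNReal.ofReal t := by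
      rw [Measure.restrict_apply measurableSet_Iio]
      have : Set.Iio t ∩ Set.Icc 0 β = Set.Ico 0 t := by
        ext s; simp only [Set.mem_inter_iff, Set.mem_Iio, Set.mem_Icc, Set.mem_Ico]
        exact ⟨fun h => ⟨h.2.1, h.1⟩, fun h => ⟨h.2, h.1, h.2.le.trans ht.2⟩⟩
      rw [this, Real.volume_Ico, sub_zero]
    have h2 : (volume.restrict (Set.Icc 0 β)) (Set.Ici t) = ENNReal.ofReal (β - t) := by
      rw [Measure.restrict_apply measurableSet_Ici]
      have : Set.Ici t ∩ Set.Icc 0 β = Set.Icc t β := by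
        ext s; simp only [Set.mem_inter_iff, Set.mem_Ici, Set.mem_Icc]
        exact ⟨fun h => ⟨h.1, h.2.2⟩, fun h => ⟨h.1, ht.1.trans h.1, h.2⟩⟩
      rw [this, Real.volume_Icc]
    have h3 : ∀ i, (volume.restrict (Set.Icc 0 β)) (if i ∈ J then Set.Iio t else Set.Ici t) =
        if i ∈ J then ENNReal.ofReal t else ENNReal.ofReal (β - t) := by
      intro i; split_ifs
      · exact h1
      · exact h2
    simp_rw [h3]
    rw [Finset.prod_ite, Finset.prod_const, Finset.prod_const, Finset.filter_not,
      Finset.card_sdiff_of_subset (Finset.filter_subset _ _)]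
    simp
  simp_rw [hc]
  rw [lintegral_finsetSum _ fun J _ => measurable_const.indicator (hmeas J)]
  simp_rw [lintegral_indicator_const (hmeas _), hvol]
  have := Finset.sum_powerset_apply_card
    (fun m => c' m * (ENNReal.ofReal t ^ m * ENNReal.ofReal (β - t) ^ (n - m)))
    (x := (Finset.univ : Finset (Fin n)))
  rw [Finset.powerset_univ, Finset.card_univ, Fintype.card_fin, Finset.sum_range] at this
  rw [this]
  refine Finset.sum_congr rfl fun k _ => ?_
  have : c' k = c k := dif_pos k.2
  rw [this, nsmul_eq_mul]
  ring

/-- The configurations whose sequence of letters is `w.2.1`, with transitions inside `(0, β)`, at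
pairwise distinct times, `w.2.2` of them being before `t`. -/
def cell (β t : ℝ) (w : Σ n : ℕ, (Fin n → Letter G) × Fin (n + 1)) : Set (Config (Transition G)) :=
  {ω | ∃ τ : Fin w.1 → ℝ, Ordered β τ ∧ (∀ j, τ j ≠ t) ∧ idx τ t = w.2.2 ∧ ω = config w.2.1 τ}

omit [Fintype G.edgeSet] in
theorem config_eq_ofTuple {n : ℕ} (lab : Fin n → Letter G) (τ : Fin n → ℝ) :
    config lab τ = Config.ofTuple ⟨n, fun i => Transition.mk' (lab i) (τ i)⟩ := rfl

omit [Fintype G.edgeSet] in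
theorem mem_ofTuple {n : ℕ} {l : Fin n → Transition G} {m : Transition G} :
    m ∈ Config.ofTuple ⟨n, l⟩ ↔ ∃ j, l j = m := by
  classical
  show m ∈ Finset.image _ _ ↔ _
  simp

omit [Fintype G.edgeSet] in
theorem config_ext {ω ω' : Config (Transition G)} (h : ∀ m, m ∈ ω ↔ m ∈ ω') : ω = ω' :=
  Finset.ext h

-- A tuple may list a point several times, so `N` can exceed the word length. `sec` picks the
-- positions of the word's transitions, and the condition becomes a finite combination of measurable
-- ones.
omit [Fintype G.edgeSet] in
theorem ofTuple_mem_cell {β t : ℝ} {w : Σ n : ℕ, (Fin n → Letter G) × Fin (n + 1)} {N : ℕ}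
    {l : Fin N → Transition G} :
    Config.ofTuple ⟨N, l⟩ ∈ cell β t w ↔ ∃ sec : Fin w.1 → Fin N,
      (∀ i j, i < j → (l (sec i)).time < (l (sec j)).time) ∧ (∀ j, 0 < (l (sec j)).time) ∧
      (∀ j, (l (sec j)).time < β) ∧ (∀ j, (l (sec j)).time ≠ t) ∧
      (∀ j, ((l (sec j)).time < t ↔ j.castSucc < w.2.2)) ∧
      (∀ j, (l (sec j)).letter = w.2.1 j) ∧
      ∀ i, ∃ j, (l i).letter = (l (sec j)).letter ∧ (l i).time = (l (sec j)).time := by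
  constructor
  · rintro ⟨τ, hτ, hne, hidx, h⟩
    have h1 : ∀ j, ∃ i, l i = Transition.mk' (w.2.1 j) (τ j) := fun j => by
      rw [← mem_ofTuple, h]
      exact mem_config.2 ⟨j, rfl⟩
    choose sec hsec using h1
    have ht : ∀ j, (l (sec j)).time = τ j := fun j => by rw [hsec]; rfl
    refine ⟨sec, ?_⟩
    simp only [ht]
    refine ⟨fun i j hij => hτ.strictMono hij, hτ.pos, hτ.lt, hne, fun j => ?_, fun j => ?_,
      fun i => ?_⟩
    · rw [← hidx, lt_idx_iff hτ.strictMono]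
    · rw [hsec]; rfl
    · have : l i ∈ config w.2.1 τ := by rw [← h]; exact mem_ofTuple.2 ⟨i, rfl⟩
      obtain ⟨j, hj⟩ := mem_config.1 this
      exact ⟨j, by rw [hsec, ← hj]; rfl, by rw [← hj]⟩
  · rintro ⟨sec, h1, h2, h3, h4, h5, h6, h7⟩
    refine ⟨fun j => (l (sec j)).time, ⟨fun i j => h1 i j, h2, h3⟩, h4, idx_eq_of h5, ?_⟩
    apply config_ext
    intro m
    rw [mem_ofTuple, config_eq_ofTuple, mem_ofTuple]
    constructor
    · rintro ⟨i, rfl⟩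
      obtain ⟨j, hj, hj'⟩ := h7 i
      exact ⟨j, Transition.ext' ((h6 j).symm.trans hj.symm) hj'.symm⟩
    · rintro ⟨j, rfl⟩
      exact ⟨sec j, Transition.ext' (h6 j) rfl⟩

theorem measurableSet_cell (β t : ℝ) (w : Σ n : ℕ, (Fin n → Letter G) × Fin (n + 1)) :
    MeasurableSet (cell β t w) := by
  refine measurableSet_config fun N => ?_
  simp only [ofTuple_mem_cell]
  have ht : ∀ i : Fin N, Measurable fun l : Fin N → Transition G => (l i).time := fun i =>
    measurable_time.comp (measurable_pi_apply i)
  have hl : ∀ (i : Fin N) (a : Letter G),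
      MeasurableSet {l : Fin N → Transition G | (l i).letter = a} := fun i a =>
    (measurableSet_letter a).preimage (measurable_pi_apply i)
  have hll : ∀ i j : Fin N,
      MeasurableSet {l : Fin N → Transition G | (l i).letter = (l j).letter} := fun i j => by
    have : {l : Fin N → Transition G | (l i).letter = (l j).letter} =
        ⋃ a : Letter G, {l | (l i).letter = a} ∩ {l | (l j).letter = a} := by
      ext l
      simp only [Set.mem_ofPred_eq, Set.mem_iUnion, Set.mem_inter_iff]
      exact ⟨fun h => ⟨_, rfl, h.symm⟩, fun ⟨a, h, h'⟩ => h.trans h'.symm⟩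
    rw [this]
    exact MeasurableSet.iUnion fun a => (hl i a).inter (hl j a)
  simp only [Set.ofPred_exists, Set.ofPred_and, Set.ofPred_forall]
  refine MeasurableSet.iUnion fun sec => ?_
  refine (MeasurableSet.iInter fun i => MeasurableSet.iInter fun j => MeasurableSet.iInter fun _ =>
    measurableSet_lt (ht _) (ht _)).inter ?_
  refine (MeasurableSet.iInter fun i => measurableSet_lt measurable_const (ht _)).inter ?_
  refine (MeasurableSet.iInter fun i => measurableSet_lt (ht _) measurable_const).inter ?_
  refine (MeasurableSet.iInter fun i =>
    (measurableSet_eq_fun (ht _) measurable_const).compl).inter ?_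
  refine (MeasurableSet.iInter fun i => ?_).inter ?_
  · by_cases h : i.castSucc < w.2.2
    · simp only [h, iff_true]
      exact measurableSet_lt (ht _) measurable_const
    · simp only [h, iff_false]
      exact (measurableSet_lt (ht _) measurable_const).compl
  refine (MeasurableSet.iInter fun i => hl _ _).inter ?_
  exact MeasurableSet.iInter fun i => MeasurableSet.iUnion fun j =>
    (hll _ _).inter (measurableSet_eq_fun (ht _) (ht _))

omit [Fintype G.edgeSet] in
theorem config_comp_perm {n : ℕ} (lab : Fin n → Letter G) (τ : Fin n → ℝ)
    (π : Equiv.Perm (Fin n)) : config (lab ∘ π) (τ ∘ π) = config lab τ := by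
  apply config_ext
  intro m
  rw [mem_config, mem_config]
  exact ⟨fun ⟨j, hj⟩ => ⟨π j, hj⟩, fun ⟨j, hj⟩ => ⟨π.symm j, by simpa using hj⟩⟩

theorem idx_comp_perm {n : ℕ} (τ : Fin n → ℝ) (π : Equiv.Perm (Fin n)) (t : ℝ) :
    idx (τ ∘ π) t = idx τ t := by
  ext
  show (Finset.univ.filter fun j => τ (π j) < t).card = (Finset.univ.filter fun j => τ j < t).card
  rw [← Finset.card_map π.toEmbedding]
  congr 1
  ext j
  simp only [Finset.mem_map, Finset.mem_filter, Finset.mem_univ, true_and]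
  exact ⟨fun ⟨i, hi, hij⟩ => hij ▸ hi, fun h => ⟨π.symm j, by simpa using h, by simp⟩⟩

theorem ordered_sort {n : ℕ} {β t : ℝ} {τ : Fin n → ℝ} (hinj : Function.Injective τ)
    (h : ∀ i, 0 < τ i ∧ τ i < β ∧ τ i ≠ t) : Ordered β (τ ∘ Tuple.sort τ) :=
  ⟨(Tuple.monotone_sort τ).strictMono_of_injective (hinj.comp (Tuple.sort τ).injective),
    fun _ => (h _).1, fun _ => (h _).2.1⟩

theorem lintegral_poisson {β u : ℝ} (hβ : 0 ≤ β) (hu : u ∈ Set.Icc (0 : ℝ) 1)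
    (f : Config (Transition G) → ENNReal) (hf : Measurable f) :
    ∫⁻ ω, f ω ∂rho G β u = ∑' n : ℕ,
      ENNReal.ofReal (Real.exp (-(β * Fintype.card G.edgeSet))) / (n ! : ENNReal) *
        ∑ lab : Fin n → Letter G, (∏ i, ENNReal.ofReal (weight u (lab i))) *
          ∫⁻ τ, f (config lab τ) ∂timesMeasure β n := by
  rw [rho, poissonLaw, lintegral_map hf measurable_ofTuple, lintegral_sum_measure]
  have h0 : (intensity G β u Set.univ).toReal = β * Fintype.card G.edgeSet := by
    rw [intensity_univ hu, ENNReal.toReal_ofReal (by positivity)]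
  have h1 := hf.comp measurable_ofTuple
  refine tsum_congr fun n => ?_
  rw [lintegral_smul_measure, smul_eq_mul, h0, lintegral_map (f := fun l => f (Config.ofTuple l)) h1 (measurable_sigma_mk n),
    pi_intensity hu, lintegral_finsetSum_measure]
  congr 1
  refine Finset.sum_congr rfl fun lab _ => ?_
  rw [lintegral_smul_measure, smul_eq_mul, lintegral_map
    (f := fun l => f (Config.ofTuple ⟨n, l⟩)) (h1.comp (measurable_sigma_mk n))
    (measurable_tuple lab)]
  rfl

-- Sorting the times changes neither the configuration nor the number of times before `t`.
omit [Fintype G.edgeSet] in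
theorem config_mem_cell {β t : ℝ} {n : ℕ} (lab : Fin n → Letter G) {τ : Fin n → ℝ}
    (hinj : Function.Injective τ) (h : ∀ i, 0 < τ i ∧ τ i < β ∧ τ i ≠ t) :
    config lab τ ∈ cell β t ⟨n, lab ∘ Tuple.sort τ, idx τ t⟩ :=
  ⟨τ ∘ Tuple.sort τ, ordered_sort hinj h, fun _ => (h _).2.2, idx_comp_perm _ _ _,
    (config_comp_perm _ _ _).symm⟩

/-- The cells are countably many measurable sets whose union has null complement. A function
constant on each is thus almost everywhere equal to a measurable one; no measurability of the loop
count or of the events is needed beforehand. -/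
theorem exists_measurable_of_cell {β t u : ℝ} (hβ : 0 ≤ β)
    (hu : u ∈ Set.Icc (0 : ℝ) 1) (f : Config (Transition G) → ENNReal)
    (c : (Σ n : ℕ, (Fin n → Letter G) × Fin (n + 1)) → ENNReal)
    (hf : ∀ w, ∀ ω ∈ cell β t w, f ω = c w) :
    ∃ f', Measurable f' ∧ f =ᵐ[rho G β u] f' ∧ ∀ w, ∀ ω ∈ cell β t w, f' ω = c w := by
  classical
  set good : Set (Config (Transition G)) := ⋃ w, cell β t w with hgood
  have hmg : MeasurableSet good := MeasurableSet.iUnion fun w => measurableSet_cell β t w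
  have hmf : Measurable (good.indicator f) := by
    intro A hA
    have hU : MeasurableSet (⋃ w ∈ {w | c w ∈ A}, cell (G := G) β t w) :=
      MeasurableSet.biUnion (Set.to_countable _) fun w _ => measurableSet_cell β t w
    have hsub : ∀ ω ∈ good, (f ω ∈ A ↔ ω ∈ ⋃ w ∈ {w | c w ∈ A}, cell (G := G) β t w) := by
      intro ω hω
      rw [Set.mem_iUnion₂]
      constructor
      · intro h
        obtain ⟨w, hw⟩ := Set.mem_iUnion.1 hω
        exact ⟨w, (hf w ω hw ▸ h : c w ∈ A), hw⟩
      · rintro ⟨w, hw, hw'⟩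
        rw [hf w ω hw']; exact hw
    -- The indicator vanishes off the cells, so the preimage contains their complement exactly when
    -- `0 ∈ A`.
    by_cases h0 : (0 : ENNReal) ∈ A
    · have : good.indicator f ⁻¹' A =
          (good ∩ ⋃ w ∈ {w | c w ∈ A}, cell (G := G) β t w) ∪ goodᶜ := by
        ext ω
        rw [Set.mem_preimage, Set.mem_union, Set.mem_inter_iff, Set.mem_compl_iff]
        by_cases hω : ω ∈ good
        · rw [Set.indicator_of_mem hω, hsub ω hω]
          exact ⟨fun h => Or.inl ⟨hω, h⟩, fun h => (h.resolve_right fun h' => h' hω).2⟩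
        · rw [Set.indicator_of_notMem hω]
          exact ⟨fun _ => Or.inr hω, fun _ => h0⟩
      rw [this]
      exact (hmg.inter hU).union hmg.compl
    · have : good.indicator f ⁻¹' A = good ∩ ⋃ w ∈ {w | c w ∈ A}, cell (G := G) β t w := by
        ext ω
        rw [Set.mem_preimage, Set.mem_inter_iff]
        by_cases hω : ω ∈ good
        · rw [Set.indicator_of_mem hω, hsub ω hω]
          exact ⟨fun h => ⟨hω, h⟩, fun h => h.2⟩
        · rw [Set.indicator_of_notMem hω]
          exact ⟨fun h => (h0 h).elim, fun h => (hω h.1).elim⟩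
      rw [this]
      exact hmg.inter hU
  have hnull : rho G β u goodᶜ = 0 := by
    have := lintegral_poisson hβ hu (goodᶜ.indicator fun _ => 1)
      (measurable_const.indicator hmg.compl)
    rw [lintegral_indicator_const hmg.compl, one_mul] at this
    rw [this, ENNReal.tsum_eq_zero]
    intro n
    rw [Finset.sum_eq_zero, mul_zero]
    intro lab _
    rw [lintegral_congr_ae (g := fun _ => 0), lintegral_zero, mul_zero]
    filter_upwards [ae_times β t n] with τ hτ
    have hmem : config lab τ ∈ good := Set.mem_iUnion.2 ⟨_, config_mem_cell lab hτ.1 hτ.2⟩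
    exact Set.indicator_of_notMem (Set.notMem_compl_iff.2 hmem) _
  have hae : f =ᵐ[rho G β u] good.indicator f := by
    filter_upwards [compl_mem_ae_iff.2 hnull] with ω hω
    rw [compl_compl] at hω
    rw [Set.indicator_of_mem hω]
  exact ⟨_, hmf, hae, fun w ω hω => by
    rw [Set.indicator_of_mem (Set.mem_iUnion.2 ⟨w, hω⟩), hf w ω hω]⟩

/-- Integral with respect to the Poisson process of a function that only depends on the sequence of
letters and on the number of transitions before `t`. -/
theorem lintegral_rho {β t u : ℝ} (ht : t ∈ Set.Icc 0 β)
    (hu : u ∈ Set.Icc (0 : ℝ) 1) (f : Config (Transition G) → ENNReal)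
    (c : (Σ n : ℕ, (Fin n → Letter G) × Fin (n + 1)) → ENNReal)
    (hf : ∀ w, ∀ ω ∈ cell β t w, f ω = c w) :
    ∫⁻ ω, f ω ∂rho G β u = ∑' n : ℕ,
      ENNReal.ofReal (Real.exp (-(β * Fintype.card G.edgeSet))) / (n ! : ENNReal) *
        ∑ k : Fin (n + 1), (n.choose k : ENNReal) *
          (ENNReal.ofReal t ^ (k : ℕ) * ENNReal.ofReal (β - t) ^ (n - k)) *
            ∑ lab : Fin n → Letter G, (∏ i, ENNReal.ofReal (weight u (lab i))) *
              c ⟨n, lab, k⟩ := by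
  have hβ : 0 ≤ β := ht.1.trans ht.2
  obtain ⟨f', hmf, hae, hf'⟩ := exists_measurable_of_cell hβ hu f c hf
  rw [lintegral_congr_ae hae, lintegral_poisson hβ hu _ hmf]
  refine tsum_congr fun n => ?_
  congr 1
  have h1 : ∀ lab : Fin n → Letter G, Measurable fun τ => f' (config lab τ) :=
    fun lab => hmf.comp (measurable_ofTuple.comp ((measurable_sigma_mk n).comp
      (measurable_tuple lab)))
  rw [← lintegral_idx ht n fun k => ∑ lab : Fin n → Letter G,
    (∏ i, ENNReal.ofReal (weight u (lab i))) * c ⟨n, lab, k⟩]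
  simp_rw [← lintegral_const_mul _ (h1 _)]
  rw [← lintegral_finsetSum _ fun lab _ => (h1 lab).const_mul _]
  refine lintegral_congr_ae ?_
  filter_upwards [ae_times β t n] with τ hτ
  -- For fixed times, sorting permutes the letters; this is a bijection of the words that preserves
  -- the product of weights.
  refine Fintype.sum_equiv (Equiv.arrowCongr (Tuple.sort τ).symm (Equiv.refl _)) _ _ fun lab => ?_
  rw [hf' _ _ (config_mem_cell lab hτ.1 hτ.2)]
  congr 1
  exact (Equiv.prod_comp (Tuple.sort τ) fun i => ENNReal.ofReal (weight u (lab i))).symm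

end PoissonIntegral

/-! ### Second and fourth moments of a uniform spin. -/

section PowerSums

theorem sum_range_sub (s : ℂ) (N : ℕ) :
    ∑ k ∈ Finset.range N, ((k : ℂ) - s) = N * (N - 1) / 2 - N * s := by
  induction N with
  | zero => simp
  | succ N ih => rw [Finset.sum_range_succ, ih]; push_cast; ring

theorem sum_range_sub_sq (s : ℂ) (N : ℕ) :
    ∑ k ∈ Finset.range N, ((k : ℂ) - s) ^ 2 =
      N * (N - 1) * (2 * N - 1) / 6 - s * (N * (N - 1)) + N * s ^ 2 := by
  induction N with
  | zero => simp
  | succ N ih => rw [Finset.sum_range_succ, ih]; push_cast; ring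

theorem sum_range_sub_pow_four (s : ℂ) (N : ℕ) :
    ∑ k ∈ Finset.range N, ((k : ℂ) - s) ^ 4 =
      N * (N - 1) * (2 * N - 1) * (3 * N ^ 2 - 3 * N - 1) / 30 - 4 * s * (N * (N - 1) / 2) ^ 2 +
        6 * s ^ 2 * (N * (N - 1) * (2 * N - 1) / 6) - 4 * s ^ 3 * (N * (N - 1) / 2) +
          N * s ^ 4 := by
  induction N with
  | zero => simp
  | succ N ih => rw [Finset.sum_range_succ, ih]; push_cast; ring

variable (S : ℕ)

theorem sum_mag : ∑ a, (mag S a : ℂ) = 0 := by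
  have := Fin.sum_univ_eq_sum_range (fun k => (k : ℂ) - S) (2 * S + 1)
  rw [sum_range_sub] at this
  simp only [mag]
  push_cast at this ⊢
  rw [this]; ring

theorem sum_mag_sq :
    ∑ a, (mag S a : ℂ) * mag S a = (2 * S + 1) * ((S : ℂ) * (S + 1) / 3) := by
  have := Fin.sum_univ_eq_sum_range (fun k => ((k : ℂ) - S) ^ 2) (2 * S + 1)
  rw [sum_range_sub_sq] at this
  simp only [mag, ← sq]
  push_cast at this ⊢
  rw [this]; ring

theorem sum_mag_pow_four :
    ∑ a, ((mag S a : ℂ) * mag S a) * (mag S a * mag S a) =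
      (2 * S + 1) * ((S : ℂ) * (S + 1) * (3 * S ^ 2 + 3 * S - 1) / 15) := by
  have := Fin.sum_univ_eq_sum_range (fun k => ((k : ℂ) - S) ^ 4) (2 * S + 1)
  rw [sum_range_sub_pow_four] at this
  simp only [mag, ← sq, ← pow_mul]
  push_cast at this ⊢
  rw [this]; ring

end PowerSums

/-! ### Series expansion of the Gibbs operators over words. -/

section Expansion

/-- The Cauchy product of the two exponential series, with `1 / (k! (n - k)!)` written as `n.choose
k / n!` to match the Poisson weights. -/
theorem hasSum_exp_mul_exp {𝔸 : Type*} [NormedRing 𝔸] [NormedAlgebra ℂ 𝔸] [CompleteSpace 𝔸]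
    (A B K : 𝔸) (a b : ℂ) :
    HasSum (fun n : ℕ => ((n ! : ℂ)⁻¹) • ∑ k : Fin (n + 1),
        ((n.choose k : ℂ) * (b ^ (k : ℕ) * a ^ (n - k))) • (A * (K ^ (n - k) * B * K ^ (k : ℕ))))
      (A * NormedSpace.exp (a • K) * B * NormedSpace.exp (b • K)) := by
  set f : ℕ → 𝔸 := fun k => ((k ! : ℂ)⁻¹) • (b • K) ^ k
  set g : ℕ → 𝔸 := fun m => ((m ! : ℂ)⁻¹) • (a • K) ^ m
  have hf : Summable fun k => ‖f k‖ := NormedSpace.norm_expSeries_summable' (𝕂 := ℂ) _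
  have hg : Summable fun k => ‖g k‖ := NormedSpace.norm_expSeries_summable' (𝕂 := ℂ) _
  have hf' : HasSum f (NormedSpace.exp (b • K)) := NormedSpace.exp_series_hasSum_exp' (𝕂 := ℂ) _
  have hg' : HasSum g (NormedSpace.exp (a • K)) := NormedSpace.exp_series_hasSum_exp' (𝕂 := ℂ) _
  have hh' := (hg'.mul_left A).mul_right B
  have hh : Summable fun m => ‖A * g m * B‖ :=
    Summable.of_nonneg_of_le (fun _ => norm_nonneg _)
      (fun m => (norm_mul_le _ _).trans (mul_le_mul_of_nonneg_right (norm_mul_le _ _)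
        (norm_nonneg _))) ((hg.mul_left ‖A‖).mul_right ‖B‖)
  have h1 := (summable_norm_sum_mul_antidiagonal_of_summable_norm hh hf).of_norm.hasSum
  rw [← tsum_mul_tsum_eq_tsum_sum_antidiagonal_of_summable_norm hh hf, hh'.tsum_eq,
    hf'.tsum_eq] at h1
  refine cast (congrArg (fun F => HasSum F _) (funext fun n => Eq.symm ?_)) h1
  -- The swap makes `k` the exponent in the right-hand factor, the one of the times before `t`.
  rw [← Finset.Nat.sum_antidiagonal_swap,
    Finset.Nat.sum_antidiagonal_eq_sum_range_succ_mk, Finset.sum_range, Finset.smul_sum]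
  refine Finset.sum_congr rfl fun k _ => ?_
  have hk : (k : ℕ) ≤ n := Nat.lt_succ_iff.1 k.2
  simp only [f, g, Prod.swap, smul_pow, mul_smul_comm, smul_mul_assoc, smul_smul, mul_assoc]
  congr 1
  rw [Nat.cast_choose ℂ hk]
  have h2 : ((n ! : ℕ) : ℂ) ≠ 0 := Nat.cast_ne_zero.2 n.factorial_ne_zero
  field_simp

variable {V : Type*} [Fintype V] [DecidableEq V] {G : SimpleGraph V} [Fintype G.edgeSet] {S : ℕ}

/-- The sum of the operators of the transitions, with their intensities. -/
def transferOp (G : SimpleGraph V) [Fintype G.edgeSet] (S : ℕ) (u : ℝ) : Op V S :=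
  ∑ l : Letter G, (weight u l : ℂ) • letterOp S l

theorem hamiltonian_eq (u : ℝ) :
    hamiltonian G S u = (Fintype.card G.edgeSet : ℂ) • 1 - transferOp G S u := by
  have h1 : ∑ e ∈ G.edgeFinset,
      ((u : ℂ) • edgeT (V := V) S e + ((1 - u : ℝ) : ℂ) • edgeP S e - 1) =
      ∑ e : G.edgeSet, ((u : ℂ) • edgeT (V := V) S e + ((1 - u : ℝ) : ℂ) • edgeP S e - 1) := by
    rw [SimpleGraph.edgeFinset]
    exact (Finset.sum_set_coe _).symm
  have h2 : transferOp G S u =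
      ∑ e : G.edgeSet, ((u : ℂ) • edgeT (V := V) S e + ((1 - u : ℝ) : ℂ) • edgeP S e) := by
    rw [transferOp, Fintype.sum_prod_type]
    exact Finset.sum_congr rfl fun e _ => sum_kind _
  rw [hamiltonian, h1, h2, Finset.sum_sub_distrib, neg_sub, Finset.sum_const, Finset.card_univ,
    ← Nat.cast_smul_eq_nsmul ℂ]

/-- The constant part of the Hamiltonian commutes with everything; for `s = β` its exponential is
the normalization of the Poisson law. -/
theorem gibbs_eq (u s : ℝ) : gibbs G S u s =
    (Real.exp (-(s * Fintype.card G.edgeSet)) : ℂ) •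
      NormedSpace.exp ((s : ℂ) • transferOp G S u) := by
  have e : -(s : ℂ) • hamiltonian G S u =
      Matrix.diagonal (fun _ => ((-(s * Fintype.card G.edgeSet) : ℝ) : ℂ)) +
        (s : ℂ) • transferOp G S u := by
    rw [hamiltonian_eq, smul_sub, smul_smul, Matrix.smul_one_eq_diagonal, sub_eq_add_neg,
      neg_smul (s : ℂ) (transferOp G S u), neg_neg]
    push_cast
    simp only [neg_mul]
  rw [gibbs, e, Matrix.exp_add_of_commute, Matrix.exp_diagonal]
  · have : NormedSpace.exp (fun _ : V → Fin (2 * S + 1) =>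
        ((-(s * Fintype.card G.edgeSet) : ℝ) : ℂ)) =
        fun _ => (Real.exp (-(s * Fintype.card G.edgeSet)) : ℂ) := by
      funext σ
      rw [Pi.coe_exp, ← Complex.exp_eq_exp_ℂ, Complex.ofReal_exp]
    rw [this, ← Matrix.smul_one_eq_diagonal, Matrix.smul_mul, Matrix.one_mul]
  · rw [← Matrix.smul_one_eq_diagonal]
    exact (Commute.one_left _).smul_left _

theorem gibbs_mul (u s t : ℝ) : gibbs G S u s * gibbs G S u t = gibbs G S u (s + t) := by
  rw [gibbs, gibbs, gibbs, ← Matrix.exp_add_of_commute, ← add_smul]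
  · push_cast; rw [neg_add]
  · exact ((Commute.refl _).smul_left _).smul_right _

/-- The sequences of letters of the transitions, with the number of those before a given time. -/
abbrev Word (G : SimpleGraph V) : Type _ := Σ n : ℕ, (Fin n → Letter G) × Fin (n + 1)

/-- The contribution of the configurations with `n` transitions to the integral of a function
of the word. -/
def wordTerm (β t u : ℝ) (c : Word G → ℝ) (n : ℕ) : ℝ :=
  Real.exp (-(β * Fintype.card G.edgeSet)) / n ! * ∑ k : Fin (n + 1), (n.choose k : ℝ) *
    (t ^ (k : ℕ) * (β - t) ^ (n - k)) * ∑ lab : Fin n → Letter G,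
      (∏ i, weight u (lab i)) * c ⟨n, lab, k⟩

/-- The quantum side in the form that `lintegral_rho_eq_tsum` gives to Poisson integrals: only the
values `c` on words remain to be compared. -/
theorem hasSum_trace (β t u : ℝ) (A B : Op V S) (c : Word G → ℝ)
    (hc : ∀ (n : ℕ) (lab : Fin n → Letter G) (k : Fin (n + 1)),
      (A * interleave (fun j => letterOp S (lab j)) (fun i => if i = k then B else 1)).trace =
        c ⟨n, lab, k⟩) :
    HasSum (fun n => (wordTerm β t u c n : ℂ))
      (A * gibbs G S u (β - t) * B * gibbs G S u t).trace := by
  let : NormedRing (Op V S) := Matrix.linftyOpNormedRing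
  let : NormedAlgebra ℂ (Op V S) := Matrix.linftyOpNormedAlgebra
  have h1 := hasSum_exp_mul_exp A B (transferOp G S u) ((β - t : ℝ) : ℂ) (t : ℂ)
  have h2 := (h1.map (Matrix.traceAddMonoidHom (V → Fin (2 * S + 1)) ℂ)
    (Continuous.matrix_trace continuous_id)).mul_left
      (Real.exp (-(β * Fintype.card G.edgeSet)) : ℂ)
  have e1 : (A * gibbs G S u (β - t) * B * gibbs G S u t).trace =
      (Real.exp (-(β * Fintype.card G.edgeSet)) : ℂ) *
        (A * NormedSpace.exp (((β - t : ℝ) : ℂ) • transferOp G S u) * B *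
          NormedSpace.exp ((t : ℂ) • transferOp G S u)).trace := by
    rw [gibbs_eq, gibbs_eq]
    simp only [Matrix.mul_smul, Matrix.smul_mul, smul_smul, Matrix.trace_smul, smul_eq_mul]
    rw [← Complex.ofReal_mul, ← Real.exp_add]
    congr 4
    ring
  rw [e1]
  refine cast (congrArg (fun F => HasSum F _) (funext fun n => Eq.symm ?_)) h2
  simp only [Function.comp, Matrix.traceAddMonoidHom_apply, Matrix.trace_smul, Matrix.trace_sum,
    wordTerm]
  push_cast
  rw [smul_eq_mul, ← mul_assoc, div_eq_mul_inv]
  congr 1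
  refine Finset.sum_congr rfl fun k _ => ?_
  rw [smul_eq_mul]
  congr 1
  rw [← interleave_insert, transferOp, ← sum_interleave, Finset.mul_sum, Matrix.trace_sum]
  refine Finset.sum_congr rfl fun lab _ => ?_
  rw [interleave_smul, Matrix.mul_smul, Matrix.trace_smul, hc, smul_eq_mul]

end Expansion

/-! ### Values of the traces on a single word. -/

section WordValues

variable {V : Type*} [DecidableEq V] {G : SimpleGraph V}

/-- The number of loops of a word. -/
def Word.loops (w : Word G) : ℕ := (freeInvolutions (closeUp w.2.1)).numClasses

/-- The sites at time `0` and at the marked time are on the same loop, with identical or opposite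
directions according to `d`. -/
def Word.Connects (x y : V) (d : Dir) (w : Word G) : Prop :=
  WordOriented w.2.1 (x, 0, Dir.up) (y, w.2.2, d)

theorem Word.not_connects_both {x y : V} {w : Word G} (h : w.Connects x y Dir.up) :
    ¬ w.Connects x y Dir.down := fun h' =>
  (freeInvolutions (closeUp w.2.1)).not_oriented_left _ (h.symm.trans h')

variable [Fintype V] {S : ℕ}

/-- Here `m` is the mean of `f`. The trivial `if` is an insertion of the identity, kept in the shape
that `hasSum_trace` requires. -/
theorem trace_word_one (w : Word G) (x : V) (f : Fin (2 * S + 1) → ℂ) (m : ℂ)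
    (hm : ∑ a, f a = (2 * S + 1) * m) :
    (siteOp x (Matrix.diagonal f) * interleave (fun j => letterOp S (w.2.1 j))
      (fun i => if i = w.2.2 then 1 else 1)).trace = (2 * S + 1) ^ w.loops * m := by
  classical
  let := Fintype.ofFinite {s : V × Fin (w.1 + 1) × Dir → Fin (2 * S + 1) //
        FreeInvolutions.Odd (reversal V w.1) (jump (closeUp w.2.1)) Fin.rev s}
  have h1 := trace_interleave w.2.1 x x w.2.2 f fun _ => 1
  rw [siteOp_diagonal x fun _ => (1 : ℂ), Matrix.diagonal_one] at h1
  rw [h1]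
  have h2 := FreeInvolutions.sum_odd_apply (freeInvolutions (closeUp w.2.1)) Fin.rev_involutive f
    (x, 0, Dir.up)
  rw [hm, Fintype.card_fin] at h2
  have h3 : (2 * S + 1 : ℂ) ≠ 0 := by exact_mod_cast (2 * S).succ_ne_zero
  simp only [mul_one]
  apply mul_left_cancel₀ h3
  push_cast at h2
  rw [h2, Word.loops]
  ring

-- `m`, `m₁` and `m₂` are the means of `f(a)`, `f(a)²` and `f(a) f(-a)`: the three cases are
-- distinct loops, identical directions and opposite directions.
open Classical in
theorem trace_word_two (w : Word G) (x y : V) (f : Fin (2 * S + 1) → ℂ) (m m₁ m₂ : ℂ)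
    (hm : ∑ a, f a = (2 * S + 1) * m) (hm₁ : ∑ a, f a * f a = (2 * S + 1) * m₁)
    (hm₂ : ∑ a, f a * f a.rev = (2 * S + 1) * m₂) :
    (siteOp x (Matrix.diagonal f) * interleave (fun j => letterOp S (w.2.1 j))
      (fun i => if i = w.2.2 then siteOp y (Matrix.diagonal f) else 1)).trace =
      (2 * S + 1) ^ w.loops * if w.Connects x y Dir.up then m₁ else
        if w.Connects x y Dir.down then m₂ else m ^ 2 := by
  let := Fintype.ofFinite {s : V × Fin (w.1 + 1) × Dir → Fin (2 * S + 1) //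
        FreeInvolutions.Odd (reversal V w.1) (jump (closeUp w.2.1)) Fin.rev s}
  rw [trace_interleave w.2.1 x y w.2.2 f f]
  have h3 : (2 * S + 1 : ℂ) ≠ 0 := by exact_mod_cast (2 * S).succ_ne_zero
  split_ifs with hu hd
  · have h2 := FreeInvolutions.sum_odd_of_oriented (freeInvolutions (closeUp w.2.1))
      Fin.rev_involutive f f hu
    rw [hm₁, Fintype.card_fin] at h2
    apply mul_left_cancel₀ h3
    push_cast at h2
    rw [h2, Word.loops]
    ring
  · have h2 := FreeInvolutions.sum_odd_of_opposite (freeInvolutions (closeUp w.2.1))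
      Fin.rev_involutive f f (q := (y, w.2.2, Dir.up)) hd
    rw [hm₂, Fintype.card_fin] at h2
    apply mul_left_cancel₀ h3
    push_cast at h2
    rw [h2, Word.loops]
    ring
  · have h2 := FreeInvolutions.sum_odd_of_not (freeInvolutions (closeUp w.2.1))
      Fin.rev_involutive f f (p := (x, 0, Dir.up)) (q := (y, w.2.2, Dir.up))
      (fun h => h.elim hu hd)
    rw [hm, Fintype.card_fin] at h2
    apply mul_left_cancel₀ (pow_ne_zero 2 h3)
    push_cast at h2
    rw [h2, Word.loops]
    ring

end WordValues

/-! ### Probabilities of loop events as series over words. -/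

section LoopMeasure

variable {V : Type*} [DecidableEq V] {G : SimpleGraph V} [Fintype G.edgeSet] {β t u : ℝ}

omit [DecidableEq V] in
theorem wordTerm_linear (a b : ℝ) (c c' : Word G → ℝ) (n : ℕ) :
    wordTerm β t u (fun w => a * c w + b * c' w) n =
      a * wordTerm β t u c n + b * wordTerm β t u c' n := by
  unfold wordTerm
  simp only [mul_add, Finset.sum_add_distrib, Finset.mul_sum]
  congr 1 <;> exact Finset.sum_congr rfl fun k _ => Finset.sum_congr rfl fun lab _ => by ring

omit [DecidableEq V] in
theorem wordTerm_mono (ht : t ∈ Set.Icc 0 β) (hu : u ∈ Set.Icc (0 : ℝ) 1) {c c' : Word G → ℝ}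
    (h : ∀ w, c w ≤ c' w) (n : ℕ) : wordTerm β t u c n ≤ wordTerm β t u c' n := by
  have h1 : 0 ≤ β - t := sub_nonneg.2 ht.2
  have h2 := ht.1
  unfold wordTerm
  refine mul_le_mul_of_nonneg_left (Finset.sum_le_sum fun k _ =>
    mul_le_mul_of_nonneg_left (Finset.sum_le_sum fun lab _ =>
      mul_le_mul_of_nonneg_left (h _) (Finset.prod_nonneg fun i _ => weight_nonneg hu _))
        (by positivity)) (by positivity)

omit [DecidableEq V] in
theorem wordTerm_nonneg (ht : t ∈ Set.Icc 0 β) (hu : u ∈ Set.Icc (0 : ℝ) 1) {c : Word G → ℝ}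
    (h : ∀ w, 0 ≤ c w) (n : ℕ) : 0 ≤ wordTerm β t u c n := by
  have := wordTerm_mono ht hu h n
  simpa [wordTerm] using this

-- The empty word alone contributes positively; this makes the partition function nonzero.
omit [DecidableEq V] in
theorem wordTerm_zero_pos {c : Word G → ℝ} (h : ∀ w, 0 < c w) : 0 < wordTerm β t u c 0 := by
  have := h ⟨0, fun i => i.elim0, 0⟩
  unfold wordTerm
  rw [Fin.sum_univ_succ, Fin.sum_univ_zero, add_zero]
  simp only [Finset.univ_unique, Finset.sum_singleton]
  have e : (default : Fin 0 → Letter G) = fun i => i.elim0 := Subsingleton.elim _ _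
  rw [e]
  simp only [Fin.val_zero, Nat.choose_self, pow_zero, Nat.sub_zero, Finset.univ_eq_empty,
    Finset.prod_empty]
  positivity

omit [DecidableEq V] in
theorem lintegral_rho_eq_tsum (ht : t ∈ Set.Icc 0 β) (hu : u ∈ Set.Icc (0 : ℝ) 1)
    (f : Config (Transition G) → ENNReal) (c : Word G → ℝ) (hc : ∀ w, 0 ≤ c w)
    (hf : ∀ w, ∀ ω ∈ cell β t w, f ω = ENNReal.ofReal (c w)) :
    ∫⁻ ω, f ω ∂rho G β u = ∑' n, ENNReal.ofReal (wordTerm β t u c n) := by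
  have h1 : 0 ≤ β - t := sub_nonneg.2 ht.2
  have h2 := ht.1
  have hp : ∀ {n : ℕ} (lab : Fin n → Letter G), 0 ≤ ∏ i, weight u (lab i) := fun lab =>
    Finset.prod_nonneg fun i _ => weight_nonneg hu _
  have hsum : ∀ (n : ℕ) (k : Fin (n + 1)),
      0 ≤ ∑ lab : Fin n → Letter G, (∏ i, weight u (lab i)) * c ⟨n, lab, k⟩ := fun n k =>
    Finset.sum_nonneg fun lab _ => mul_nonneg (hp lab) (hc _)
  rw [lintegral_rho ht hu f (fun w => ENNReal.ofReal (c w)) hf]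
  refine tsum_congr fun n => ?_
  rw [wordTerm, ENNReal.ofReal_mul (by positivity), ENNReal.ofReal_div_of_pos (by positivity),
    ENNReal.ofReal_natCast, ENNReal.ofReal_sum_of_nonneg fun k _ =>
      mul_nonneg (by positivity) (hsum n k)]
  congr 1
  refine Finset.sum_congr rfl fun k _ => ?_
  rw [ENNReal.ofReal_mul (by positivity), ENNReal.ofReal_mul (by positivity),
    ENNReal.ofReal_mul (by positivity), ENNReal.ofReal_natCast, ENNReal.ofReal_pow h2,
    ENNReal.ofReal_pow h1, ENNReal.ofReal_sum_of_nonneg fun lab _ => mul_nonneg (hp lab) (hc _)]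
  congr 1
  refine Finset.sum_congr rfl fun lab _ => ?_
  rw [ENNReal.ofReal_mul (hp lab), ENNReal.ofReal_prod_of_nonneg fun i _ => weight_nonneg hu _]

/-- The probability of an event that is determined by the word of the configuration. -/
theorem loopMeasure_real (hβ : 0 < β) (ht : t ∈ Set.Icc 0 β) (hu : u ∈ Set.Icc (0 : ℝ) 1)
    {θ Z : ℝ} (hθ : 0 ≤ θ)
    (hZ : HasSum (wordTerm (G := G) β t u fun w => θ ^ w.loops) Z)
    (E : Set (Config (Transition G))) (Q : Word G → Prop) [DecidablePred Q]
    (hE : ∀ w, ∀ ω ∈ cell β t w, (ω ∈ E ↔ Q w)) :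
    HasSum (wordTerm β t u fun w => if Q w then θ ^ w.loops else 0)
      (Z * (loopMeasure G β u θ).real E) := by
  classical
  have hnum : ∀ w : Word G, ∀ ω ∈ cell β t w, numLoops β ω = w.loops := by
    rintro w ω ⟨τ, hτ, _, _, rfl⟩
    exact numLoops_config hτ hβ _
  have hpow : ∀ w : Word G, 0 ≤ θ ^ w.loops := fun w => pow_nonneg hθ _
  have hc : ∀ w : Word G, 0 ≤ if Q w then θ ^ w.loops else 0 := fun w => by
    split_ifs
    · exact hpow w
    · exact le_rfl
  have hle : ∀ w : Word G, (if Q w then θ ^ w.loops else 0) ≤ θ ^ w.loops := fun w => by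
    split_ifs
    · exact le_rfl
    · exact hpow w
  have hsum : Summable (wordTerm β t u fun w : Word G => if Q w then θ ^ w.loops else 0) :=
    Summable.of_nonneg_of_le (wordTerm_nonneg ht hu hc) (wordTerm_mono ht hu hle) hZ.summable
  have hZpart : loopPartition G β u θ = ENNReal.ofReal Z := by
    rw [loopPartition, lintegral_rho_eq_tsum ht hu _ (fun w => θ ^ w.loops) hpow, ← hZ.tsum_eq,
      ENNReal.ofReal_tsum_of_nonneg (wordTerm_nonneg ht hu hpow) hZ.summable]
    intro w ω hω
    rw [hnum w ω hω, ENNReal.ofReal_pow hθ]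
  -- The event is controlled only on the cells, that is up to a null set, which suffices for
  -- `withDensity_apply₀`.
  have hnull : NullMeasurableSet E (rho G β u) := by
    rw [← aemeasurable_indicator_const_iff (1 : ENNReal)]
    obtain ⟨f', hf', hae, _⟩ := exists_measurable_of_cell hβ.le hu (E.indicator fun _ => 1)
      (fun w => if Q w then 1 else 0) (t := t) (fun w ω hω => by
        by_cases h : ω ∈ E
        · rw [Set.indicator_of_mem h, if_pos ((hE w ω hω).1 h)]
        · rw [Set.indicator_of_notMem h, if_neg fun h' => h ((hE w ω hω).2 h')])
    exact ⟨f', hf', hae⟩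
  have hint : ∫⁻ ω in E, ENNReal.ofReal θ ^ numLoops β ω ∂rho G β u = ENNReal.ofReal
      (∑' n, wordTerm β t u (fun w : Word G => if Q w then θ ^ w.loops else 0) n) := by
    rw [← lintegral_indicator₀ hnull, lintegral_rho_eq_tsum ht hu _
      (fun w => if Q w then θ ^ w.loops else 0) hc,
      ENNReal.ofReal_tsum_of_nonneg (wordTerm_nonneg ht hu hc) hsum]
    intro w ω hω
    by_cases h : ω ∈ E
    · rw [Set.indicator_of_mem h, if_pos ((hE w ω hω).1 h), hnum w ω hω, ENNReal.ofReal_pow hθ]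
    · rw [Set.indicator_of_notMem h, if_neg fun h' => h ((hE w ω hω).2 h'), ENNReal.ofReal_zero]
  have hZ0 : 0 ≤ Z := hZ.nonneg (wordTerm_nonneg ht hu hpow)
  have hreal : (loopMeasure G β u θ).real E =
      Z⁻¹ * ∑' n, wordTerm β t u (fun w : Word G => if Q w then θ ^ w.loops else 0) n := by
    rw [measureReal_def, loopMeasure, Measure.smul_apply, withDensity_apply₀ _ hnull, hint, hZpart,
      smul_eq_mul, ENNReal.toReal_mul, ENNReal.toReal_inv, ENNReal.toReal_ofReal hZ0,
      ENNReal.toReal_ofReal (tsum_nonneg (wordTerm_nonneg ht hu hc))]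
  -- If `Z = 0`, domination forces the series of the event to vanish too, whatever the normalized
  -- measure is.
  rcases hZ0.eq_or_lt with h0 | h0
  · have h1 : ∑' n, wordTerm β t u (fun w : Word G => if Q w then θ ^ w.loops else 0) n = 0 := by
      refine le_antisymm ?_ (tsum_nonneg (wordTerm_nonneg ht hu hc))
      exact (hsum.tsum_le_tsum (wordTerm_mono ht hu hle) hZ.summable).trans_eq
        (hZ.tsum_eq.trans h0.symm)
    have h2 : Z * (loopMeasure G β u θ).real E =
        ∑' n, wordTerm β t u (fun w : Word G => if Q w then θ ^ w.loops else 0) n := by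
      rw [h1, ← h0, zero_mul]
    rw [h2]
    exact hsum.hasSum
  · rw [hreal, mul_inv_cancel_left₀ h0.ne']
    exact hsum.hasSum

omit [Fintype G.edgeSet] in
theorem sameTrajectory_cell (hβ : 0 < β) (ht : t ∈ Set.Icc 0 β) (x y : V) (d : Dir) (w : Word G)
    {ω : Config (Transition G)} (hω : ω ∈ cell β t w) :
    SameTrajectory β ω (x, 0, Dir.up) (y, t, d) ↔ w.Connects x y d := by
  obtain ⟨τ, hτ, hne, hidx, rfl⟩ := hω
  rw [sameTrajectory_config_iff hτ _ hβ _ _ ⟨le_rfl, hβ.le⟩ ht, hτ.idx_zero, hidx]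
  · rfl
  · intro h
    obtain ⟨j, _, hj⟩ := touches_config.1 h
    exact (hτ.pos j).ne' hj
  · intro h
    obtain ⟨j, _, hj⟩ := touches_config.1 h
    exact hne j hj

end LoopMeasure

/-! ### Gibbs expectations and Schwinger functions of diagonal observables. -/

section Correlations

variable {V : Type*} [Fintype V] [DecidableEq V] {G : SimpleGraph V} [Fintype G.edgeSet]
  {β t u : ℝ} {S : ℕ}

/-- The identity is inserted at time `t`, which splits `gibbs β` harmlessly and yields a series over
the same marked words as the Schwinger function. -/
theorem expectation_hasSum (x : V) (f : Fin (2 * S + 1) → ℂ) (m : ℝ)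
    (hm : ∑ a, f a = (2 * S + 1) * m) :
    HasSum (fun n => (wordTerm (G := G) β t u (fun w => m * (2 * S + 1 : ℝ) ^ w.loops) n : ℂ))
      (siteOp x (Matrix.diagonal f) * gibbs G S u β).trace := by
  have := hasSum_trace (G := G) β t u (siteOp x (Matrix.diagonal f)) 1
    (fun w => m * (2 * S + 1 : ℝ) ^ w.loops) (fun n lab k => by
      have := trace_word_one ⟨n, lab, k⟩ x f m hm
      rw [this]; push_cast; ring)
  rwa [Matrix.mul_one, Matrix.mul_assoc, gibbs_mul, sub_add_cancel] at this

theorem partition_hasSum (x : V) :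
    ∃ Z : ℝ, HasSum (wordTerm (G := G) β t u fun w => (2 * S + 1 : ℝ) ^ w.loops) Z ∧
      partition G S β u = Z := by
  have h := expectation_hasSum (G := G) (β := β) (t := t) (u := u) (S := S) x (fun _ => 1) 1
    (by simp)
  rw [siteOp_diagonal x fun _ => (1 : ℂ), Matrix.diagonal_one, Matrix.one_mul] at h
  simp only [one_mul] at h
  have hs : Summable (wordTerm (G := G) β t u fun w => (2 * S + 1 : ℝ) ^ w.loops) :=
    Complex.summable_ofReal.1 h.summable
  exact ⟨_, hs.hasSum, h.unique (Complex.hasSum_ofReal.2 hs.hasSum)⟩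

theorem expectation_diagonal (ht : t ∈ Set.Icc 0 β) (hu : u ∈ Set.Icc (0 : ℝ) 1) (x : V)
    (f : Fin (2 * S + 1) → ℂ) (m : ℝ) (hm : ∑ a, f a = (2 * S + 1) * m) :
    expectation G S β u (siteOp x (Matrix.diagonal f)) = m := by
  obtain ⟨Z, hZ, hpart⟩ := partition_hasSum (G := G) (β := β) (t := t) (u := u) (S := S) x
  have h0 : 0 < Z := (wordTerm_zero_pos fun w => by positivity).trans_le
    (le_hasSum hZ 0 fun n _ => wordTerm_nonneg ht hu (fun w => by positivity) n)
  have h := expectation_hasSum (G := G) (β := β) (t := t) (u := u) x f m hm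
  have h2 : HasSum (wordTerm (G := G) β t u fun w => m * (2 * S + 1 : ℝ) ^ w.loops) (m * Z) := by
    have := hZ.mul_left m
    refine cast (congrArg (fun F => HasSum F _) (funext fun n => Eq.symm ?_)) this
    have := wordTerm_linear (G := G) (β := β) (t := t) (u := u) m 0
      (fun w => (2 * S + 1 : ℝ) ^ w.loops) (fun _ => 0) n
    simpa using this
  rw [expectation, hpart, h.unique (Complex.hasSum_ofReal.2 h2)]
  have : (Z : ℂ) ≠ 0 := Complex.ofReal_ne_zero.2 h0.ne'
  push_cast
  field_simp

open Classical in
/-- The Schwinger function of a diagonal observable in terms of random loops. -/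
theorem schwinger_diagonal (hβ : 0 < β) (ht : t ∈ Set.Icc 0 β) (hu : u ∈ Set.Icc (0 : ℝ) 1)
    (x y : V) (f : Fin (2 * S + 1) → ℂ) (m m₁ m₂ : ℝ)
    (hm : ∑ a, f a = (2 * S + 1) * m) (hm₁ : ∑ a, f a * f a = (2 * S + 1) * m₁)
    (hm₂ : ∑ a, f a * f a.rev = (2 * S + 1) * m₂) :
    schwinger G S β u (siteOp x (Matrix.diagonal f)) (siteOp y (Matrix.diagonal f)) t =
      ((m ^ 2 + (m₁ - m ^ 2) * (loopMeasure G β u (2 * S + 1)).real (eventPlus G β x y t) +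
        (m₂ - m ^ 2) * (loopMeasure G β u (2 * S + 1)).real (eventMinus G β x y t) : ℝ) : ℂ) := by
  obtain ⟨Z, hZ, hpart⟩ := partition_hasSum (G := G) (β := β) (t := t) (u := u) (S := S) x
  have hθ : (0 : ℝ) ≤ 2 * S + 1 := by positivity
  have h0 : 0 < Z := (wordTerm_zero_pos fun w => by positivity).trans_le
    (le_hasSum hZ 0 fun n _ => wordTerm_nonneg ht hu (fun w => by positivity) n)
  have hp := loopMeasure_real hβ ht hu hθ hZ (eventPlus G β x y t) (Word.Connects x y Dir.up)
    fun w ω hω => sameTrajectory_cell hβ ht x y Dir.up w hω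
  have hq := loopMeasure_real hβ ht hu hθ hZ (eventMinus G β x y t) (Word.Connects x y Dir.down)
    fun w ω hω => sameTrajectory_cell hβ ht x y Dir.down w hω
  set P := (loopMeasure G β u (2 * S + 1)).real (eventPlus G β x y t)
  set Q := (loopMeasure G β u (2 * S + 1)).real (eventMinus G β x y t)
  set c : Word G → ℝ := fun w => (2 * S + 1 : ℝ) ^ w.loops
  set cp : Word G → ℝ := fun w => if w.Connects x y Dir.up then (2 * S + 1 : ℝ) ^ w.loops else 0
  set cq : Word G → ℝ := fun w => if w.Connects x y Dir.down then (2 * S + 1 : ℝ) ^ w.loops else 0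
  have h := hasSum_trace (G := G) β t u (siteOp x (Matrix.diagonal f))
    (siteOp y (Matrix.diagonal f))
    -- The three cases are written as `m²` plus corrections on two exclusive events. The factor `1
    -- *` gives the shape in which `wordTerm_linear` applies twice.
    (fun w => m ^ 2 * c w + 1 * ((m₁ - m ^ 2) * cp w + (m₂ - m ^ 2) * cq w))
    (fun n lab k => by
      rw [trace_word_two ⟨n, lab, k⟩ x y f m m₁ m₂ hm hm₁ hm₂]
      simp only [c, cp, cq]
      by_cases h1 : Word.Connects x y Dir.up (⟨n, lab, k⟩ : Word G)
      · have h2 := Word.not_connects_both h1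
        simp only [if_pos h1, if_neg h2]
        push_cast; ring
      · by_cases h2 : Word.Connects x y Dir.down (⟨n, lab, k⟩ : Word G)
        · simp only [if_neg h1, if_pos h2]
          push_cast; ring
        · simp only [if_neg h1, if_neg h2]
          push_cast; ring)
  simp only [wordTerm_linear] at h
  have h' := (hZ.mul_left (m ^ 2)).add (((hp.mul_left (m₁ - m ^ 2)).add
    (hq.mul_left (m₂ - m ^ 2))).mul_left 1)
  rw [schwinger, hpart, h.unique (Complex.hasSum_ofReal.2 h')]
  have : (Z : ℂ) ≠ 0 := Complex.ofReal_ne_zero.2 h0.ne'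
  push_cast
  field_simp
  ring

-- Additivity is checked on words, where the two events are exclusive.
open Classical in
theorem loopMeasure_real_eventConn (hβ : 0 < β) (ht : t ∈ Set.Icc 0 β)
    (hu : u ∈ Set.Icc (0 : ℝ) 1) (x y : V) :
    (loopMeasure G β u (2 * S + 1)).real (eventConn G β x y t) =
      (loopMeasure G β u (2 * S + 1)).real (eventPlus G β x y t) +
        (loopMeasure G β u (2 * S + 1)).real (eventMinus G β x y t) := by
  obtain ⟨Z, hZ, hpart⟩ := partition_hasSum (G := G) (β := β) (t := t) (u := u) (S := S) x
  have hθ : (0 : ℝ) ≤ 2 * S + 1 := by positivity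
  have h0 : 0 < Z := (wordTerm_zero_pos fun w => by positivity).trans_le
    (le_hasSum hZ 0 fun n _ => wordTerm_nonneg ht hu (fun w => by positivity) n)
  have hp := loopMeasure_real hβ ht hu hθ hZ (eventPlus G β x y t) (Word.Connects x y Dir.up)
    fun w ω hω => sameTrajectory_cell hβ ht x y Dir.up w hω
  have hq := loopMeasure_real hβ ht hu hθ hZ (eventMinus G β x y t) (Word.Connects x y Dir.down)
    fun w ω hω => sameTrajectory_cell hβ ht x y Dir.down w hω
  have hr := loopMeasure_real hβ ht hu hθ hZ (eventConn G β x y t)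
    (fun w => w.Connects x y Dir.up ∨ w.Connects x y Dir.down)
    fun w ω hω => or_congr (sameTrajectory_cell hβ ht x y Dir.up w hω)
      (sameTrajectory_cell hβ ht x y Dir.down w hω)
  have hs := hp.add hq
  have e : ∀ n, wordTerm (G := G) β t u (fun w : Word G => if w.Connects x y Dir.up ∨
      w.Connects x y Dir.down then (2 * S + 1 : ℝ) ^ w.loops else 0) n =
      wordTerm β t u (fun w : Word G => if w.Connects x y Dir.up then (2 * S + 1 : ℝ) ^ w.loops else 0) n +
      wordTerm β t u
        (fun w : Word G => if w.Connects x y Dir.down then (2 * S + 1 : ℝ) ^ w.loops else 0) n := by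
    intro n
    have := wordTerm_linear (G := G) (β := β) (t := t) (u := u) 1 1
      (fun w : Word G => if w.Connects x y Dir.up then (2 * S + 1 : ℝ) ^ w.loops else 0)
      (fun w : Word G => if w.Connects x y Dir.down then (2 * S + 1 : ℝ) ^ w.loops else 0) n
    rw [one_mul, one_mul] at this
    rw [← this]
    congr 1
    funext w
    by_cases h1 : w.Connects x y Dir.up
    · simp [h1, Word.not_connects_both h1]
    · simp [h1]
  rw [funext e] at hr
  apply mul_left_cancel₀ h0.ne'
  rw [hr.unique hs, mul_add]

end Correlations

end RandomLoops

end

/-! ### Reduction to `S³` and evaluation of the moments. -/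

theorem mainTheorem5 {V : Type*} [Fintype V] [DecidableEq V] (G : SimpleGraph V)
    [Fintype G.edgeSet] (β : ℝ) (hβ : 0 < β) (u : ℝ) (hu : u ∈ Set.Icc (0 : ℝ) 1) (S : ℕ)
    (x y : V) (t : ℝ) (ht : t ∈ Set.Icc 0 β) (i : Fin 3) :
    RandomLoops.schwinger G S β u
        (RandomLoops.siteOp x (RandomLoops.spin S i))
        (RandomLoops.siteOp y (RandomLoops.spin S i)) t =
      (((1 / 3 : ℝ) * S * (S + 1) *
        ((RandomLoops.loopMeasure G β u (2 * S + 1)).real (RandomLoops.eventPlus G β x y t) -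
          (RandomLoops.loopMeasure G β u (2 * S + 1)).real
            (RandomLoops.eventMinus G β x y t)) : ℝ) : ℂ) ∧
    RandomLoops.schwinger G S β u
        (RandomLoops.siteOp x (RandomLoops.spin S i) ^ 2)
        (RandomLoops.siteOp y (RandomLoops.spin S i) ^ 2) t -
      RandomLoops.expectation G S β u (RandomLoops.siteOp x (RandomLoops.spin S i) ^ 2) *
        RandomLoops.expectation G S β u (RandomLoops.siteOp y (RandomLoops.spin S i) ^ 2) =
      (((1 / 45 : ℝ) * S * (S + 1) * (2 * S - 1) * (2 * S + 3) *
        (RandomLoops.loopMeasure G β u (2 * S + 1)).real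
          (RandomLoops.eventConn G β x y t) : ℝ) : ℂ) := by
  have hsq : RandomLoops.spinZ S * RandomLoops.spinZ S =
      Matrix.diagonal fun a => (RandomLoops.mag S a : ℂ) * RandomLoops.mag S a :=
    Matrix.diagonal_mul_diagonal _ _
  have h2 := RandomLoops.sum_mag_sq S
  have h4 := RandomLoops.sum_mag_pow_four S
  constructor
  -- The eigenvalue of `S³` is odd under reversal of the spin: mean zero, and opposite values for
  -- the two directions.
  · rw [RandomLoops.schwinger_spin, RandomLoops.spinZ, RandomLoops.schwinger_diagonal hβ ht hu x y
      (fun a => (RandomLoops.mag S a : ℂ)) 0 ((S : ℝ) * (S + 1) / 3) (-((S : ℝ) * (S + 1) / 3))]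
    · congr 1; ring
    · rw [RandomLoops.sum_mag]; simp
    · rw [h2]; push_cast; ring
    · simp only [RandomLoops.mag_rev]
      push_cast
      simp only [mul_neg, Finset.sum_neg_distrib]
      rw [h2]
  -- The square is even, so both directions give the fourth moment and the two probabilities add up.
  -- The variance is `S(S+1)` times `(3S²+3S-1)/15 - S(S+1)/9 = (2S-1)(2S+3)/45`.
  · have hm : ∑ a, (RandomLoops.mag S a : ℂ) * RandomLoops.mag S a =
        (2 * S + 1) * (((S : ℝ) * (S + 1) / 3 : ℝ) : ℂ) := by
      rw [h2]; push_cast; ring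
    rw [RandomLoops.schwinger_spin_sq, RandomLoops.expectation_spin_sq,
      RandomLoops.expectation_spin_sq, hsq,
      RandomLoops.expectation_diagonal ht hu x _ ((S : ℝ) * (S + 1) / 3) hm,
      RandomLoops.expectation_diagonal ht hu y _ ((S : ℝ) * (S + 1) / 3) hm,
      RandomLoops.schwinger_diagonal hβ ht hu x y _ ((S : ℝ) * (S + 1) / 3)
        ((S : ℝ) * (S + 1) * (3 * S ^ 2 + 3 * S - 1) / 15)
        ((S : ℝ) * (S + 1) * (3 * S ^ 2 + 3 * S - 1) / 15) hm,
      RandomLoops.loopMeasure_real_eventConn hβ ht hu]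
    · push_cast; ring
    · rw [h4]; push_cast; ring
    · simp only [RandomLoops.mag_rev]
      push_cast
      simp only [neg_mul_neg]
      rw [h4]
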